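/- Let $L\ge 1$, let $\sigma:\mathbb R\to\mathbb R$ be Lipschitz, let $n_0,\dots,n_L\ge 1$ be integers, and let $W^{(\ell)}$, $\ell=0,\dots,L-1$, be random $n_{\ell+1}\times n_\ell$ matrices all of whose entries are independent and centred, with $\mathrm{Var}(W^{(\ell)}_{ij})=c_w^{(\ell)}/n_\ell$ for constants $c_w^{(\ell)}>0$, and such that the law of $W^{(0)}_{ij}$ does not depend on $i$. Define the network (with $L-1$ hidden layers) by $F^{(1)}(x)=W^{(0)}x$ and $F^{(\ell)}(x)=W^{(\ell-1)}\sigma(F^{(\ell-1)}(x))$ for $2\le \ell\le L$, where $\sigma$ acts coordinatewise. Define random fields by $G^{(1)}=F^{(1)}$ in law and, for $1\le \ell<L$, let $G^{(\ell+1)}$ be a centred Gaussian field with covariance $$\mathrm{Cov}\bigl(G^{(\ell+1)}_i(x),G^{(\ell+1)}_j(y)\bigr)=\delta_{ij}\,c_w^{(\ell)}\,\mathbb E\bigl[\sigma(G^{(\ell)}_1(x))\,\sigma(G^{(\ell)}_1(y))\bigr].$$ For $\chi=(x_1,\dots,x_s)\in(\mathbb R^{n_0})^s$ and a field $H$ with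 values in $\mathbb R^d$ let $H(\chi)=(H(x_1),\dots,H(x_s))\in\mathbb R^{d\times s}$, and let $\mathsf d_1(X,Y)=\sup_\zeta|\mathbb E\zeta(X)-\mathbb E\zeta(Y)|$, the supremum being over all $\zeta:\mathbb R^{d\times s}\to\mathbb R$ that are 1-Lipschitz for the Euclidean norm (the Wasserstein-1 distance). (i) Let $p>2$ be real, and assume that $\mathbb E|W^{(\ell)}_{ij}|^{2p}\le c_{2p}^{(\ell)}/n_\ell^{p}$ for $0\le\ell\le L-2$, with constants $c_{2p}^{(\ell)}\ge1$, and that $\mathbb E|W^{(L-1)}_{ij}|^{3}\le c_3^{(L-1)}n_{L-1}^{-3/2}$. Then $F^{(L)}(\chi)$ and $G^{(L)}(\chi)$ are integrable and $$\mathsf d_1\bigl(F^{(L)}(\chi),G^{(L)}(\chi)\bigr)\le \mathtt C\,n_L^{1/3}\sum_{m=1}^{L-1}n_m^{-\frac16\left(\frac{p-2}{3(2p-1)}\right)^{L-m-1}},$$ where $\mathtt C$ depends only on $\sigma$, $p$, $L$, $\chi$, the constants $c_{2p}^{(\ell)}$ ($0\le\ell\le L-2$), $c_3^{(L-1)}$,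 and the (fixed) output dimension $n_L$; the dependence on $n_L$ is such that $\mathtt C\le \mathtt C_0\,n_L^{1/3}$ with $\mathtt C_0$ independent of $n_L$. No nondegeneracy of the covariance of $G^{(L)}(\chi)$ is assumed. (ii) Assume that such constants $c_{2p}^{(\ell)}$ exist for every real $p>2$, that the third-moment bound on the last layer holds as in (i), and that $\kappa N\le n_m\le\kappa' N$ for $1\le m\le L-1$, with an integer $N\ge1$ and constants $0<\kappa\le\kappa'$. Then for every $\varepsilon>0$ $$\mathsf d_1\bigl(F^{(L)}(\chi),G^{(L)}(\chi)\bigr)\le \mathtt C\,n_L^{1/3}\,N^{-(1/6)^{L-1}+\varepsilon},$$ where $\mathtt C$ depends only on $\sigma$, $L$, $\chi$, the functions $p\mapsto c_{2p}^{(\ell)}$ ($0\le \ell\le L-2$), $c_3^{(L-1)}$, $\kappa$, $\kappa'$, $\varepsilon$ and $n_L$, with $\mathtt C\le \mathtt C_0\,n_L^{1/3}$ and $\mathtt C_0$ independent of $n_L$. -/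

import Mathlib

open MeasureTheory ProbabilityTheory
open scoped ENNReal

namespace DeepNet

/-- The Wasserstein-1 distance in its dual form: the supremum, in `[0, ∞]`, of
`|∫ ζ dμ - ∫ ζ dν|` over all real functions `ζ` that are 1-Lipschitz for the distance of `E`. -/
noncomputable def wassersteinOne {E : Type*} [PseudoEMetricSpace E] [MeasurableSpace E]
    (μ ν : Measure E) : ℝ≥0∞ :=
  ⨆ (ζ : E → ℝ) (_ : LipschitzWith 1 ζ), ENNReal.ofReal |∫ v, ζ v ∂μ - ∫ v, ζ v ∂ν|

/-- The layers of the network with widths `n 0, n 1, …` and weight matrices `w 0, w 1, …`,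
evaluated at the input `x`: `F⁽¹⁾(x) = w⁽⁰⁾ x` and `F⁽ˡ⁺¹⁾(x) = w⁽ˡ⁾ σ(F⁽ˡ⁾(x))` for `l ≥ 1`,
where `σ` acts coordinatewise. (The value at index `0` is the input itself.) -/
def network (σ : ℝ → ℝ) {n : ℕ → ℕ} (w : ∀ l, Matrix (Fin (n (l + 1))) (Fin (n l)) ℝ)
    (x : Fin (n 0) → ℝ) : ∀ l, Fin (n l) → ℝ
  | 0 => x
  | 1 => (w 0).mulVec x
  | l + 2 => (w (l + 1)).mulVec (fun k => σ (network σ w x (l + 1) k))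

/-- The random matrix `F⁽ˡ⁾(χ) = (F⁽ˡ⁾(x₁), …, F⁽ˡ⁾(xₛ))`, a point of the Euclidean space
`ℝ^(n l × s)`: the entry `(i, a)` is the `i`-th coordinate of `F⁽ˡ⁾(x_a)`. -/
noncomputable def networkSample (σ : ℝ → ℝ) {n : ℕ → ℕ}
    (w : ∀ l, Matrix (Fin (n (l + 1))) (Fin (n l)) ℝ) {s : ℕ} (x : Fin s → Fin (n 0) → ℝ) (l : ℕ) :
    EuclideanSpace ℝ (Fin (n l) × Fin s) :=
  WithLp.toLp 2 (fun α => network σ w (x α.2) l α.1)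

/-- The law of `F⁽ˡ⁾(χ)` for random weights `W`. -/
noncomputable def networkLaw (σ : ℝ → ℝ) {n : ℕ → ℕ} {Ω : Type*} [MeasurableSpace Ω]
    (μ : Measure Ω) (W : ∀ l, Ω → Matrix (Fin (n (l + 1))) (Fin (n l)) ℝ) {s : ℕ}
    (x : Fin s → Fin (n 0) → ℝ) (l : ℕ) : Measure (EuclideanSpace ℝ (Fin (n l) × Fin s)) :=
  μ.map (fun ω => networkSample σ (fun l => W l ω) x l)

/-- The law of `G⁽ˡ⁾(χ)`, for the limiting fields `G⁽¹⁾, G⁽²⁾, …`. The law of `G⁽¹⁾(χ)` is the given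
measure `ν` (to be taken as the law of `F⁽¹⁾(χ)`), and for `l ≥ 1` the law of `G⁽ˡ⁺¹⁾(χ)` is the
centred Gaussian law in which the entries `(i, a)` and `(j, b)` have covariance
`δᵢⱼ c⁽ˡ⁾ E[σ(G⁽ˡ⁾₁(x_a)) σ(G⁽ˡ⁾₁(x_b))]`. The first coordinate has index `0` here.
(The value at index `0` is not used.) -/
noncomputable def limitLaw (σ : ℝ → ℝ) (c : ℕ → ℝ) {n : ℕ → ℕ} [∀ l, NeZero (n l)] {s : ℕ}
    (ν : Measure (EuclideanSpace ℝ (Fin (n 1) × Fin s))) :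
    ∀ l, Measure (EuclideanSpace ℝ (Fin (n l) × Fin s))
  | 0 => 0
  | 1 => ν
  | l + 2 => multivariateGaussian 0 (Matrix.of fun α β =>
      if α.1 = β.1 then
        c (l + 1) * ∫ g, σ (g (0, α.2)) * σ (g (0, β.2)) ∂(limitLaw σ c ν (l + 1))
      else 0)

/-- The random weight matrices `W 0, …, W (L - 1)`: all entries of all of them are independent,
centred and square integrable, the entries of `W l` have variance `c l / n l` with `c l > 0`,
and the entries of `W 0` in a same column have the same law. -/
structure IsRandomWeights (L : ℕ) {n : ℕ → ℕ} (c : ℕ → ℝ) {Ω : Type*} [MeasurableSpace Ω]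
    (μ : Measure Ω) (W : ∀ l, Ω → Matrix (Fin (n (l + 1))) (Fin (n l)) ℝ) : Prop where
  measurable : ∀ l < L, ∀ i j, Measurable (fun ω => W l ω i j)
  indep : iIndepFun
    (fun (k : Σ l : Fin L, Fin (n (l + 1)) × Fin (n l)) ω => W k.1 ω k.2.1 k.2.2) μ
  memLp : ∀ l < L, ∀ i j, MemLp (fun ω => W l ω i j) 2 μ
  centred : ∀ l < L, ∀ i j, ∫ ω, W l ω i j ∂μ = 0
  pos : ∀ l < L, 0 < c l
  variance_eq : ∀ l < L, ∀ i j, Var[fun ω => W l ω i j; μ] = c l / n l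
  identDistrib : ∀ i i' j, IdentDistrib (fun ω => W 0 ω i j) (fun ω => W 0 ω i' j) μ μ

/-- The absolute moment of order `q` of `X` is finite and at most `B`. -/
def HasMomentLE {Ω : Type*} [MeasurableSpace Ω] (μ : Measure Ω) (X : Ω → ℝ) (q B : ℝ) : Prop :=
  Integrable (fun ω => |X ω| ^ q) μ ∧ ∫ ω, |X ω| ^ q ∂μ ≤ B

end DeepNet

/-! Given the activations y of the last hidden layer, the output is a sum of independent centred
scalar weights times fixed vectors. It is therefore nearly Gaussian with the empirical covariance of
y, and this covariance concentrates around the deterministic covariance of the limit. The theorem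
averages these two facts and propagates them through the layers.

The conditional statement is a Lindeberg replacement carried out in the Wasserstein distance itself.
Isotropic Gaussian noise of size t is added to both laws, at a cost of order t. Against the smoothed
laws a 1-Lipschitz test function has a second order Taylor expansion along each direction, so that
exchanging one weight for a Gaussian one of the same variance costs only third moments
(`lipClose_smul_conv_noise`, `lipClose_sum_conv_noise`). Two Gaussian laws are compared in the same
spirit, by adding a multiple of the identity to the covariance; this costs the square root of the
distance of the covariances and needs no nondegeneracy (`lipClose_gaussLaw`). With the best t, a
layer with M rows and n inputs is within a constant times M^(2/3) (n^(-1/6) + √δ) of its limit,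
where δ is the distance of the covariances and the constant involves the fourth powers of y
(`lipClose_layer_le`).

It remains to bound the mean of δ. Given y, the rows of the next layer are independent, so averages
of products of activations are within (width)^(-1/2) of their means. These means are near the
Gaussian ones by the conditional statement for a single row, applied to a truncated product of two
Lipschitz functions. Truncation at height S^(-1/3) and the splitting √δ ≤ δ/S + S give a recursion
that is linear in δ (`covDist_nextAct_gauss`) and can be integrated over the earlier layers. With S
the `rate` of a layer, bounded fourth moments and E δ ≤ C S² pass to the next layer
(`layerBound_succ`), because S^(1/3) plus the contribution of the new width is at most the next rate
(`rate_step`).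

Only fourth moments of the hidden weights enter, so for every p > 2 the width n_m carries the
exponent (1/6)^(L-m). This is at least the exponent required in (i), because (p-2)/(3(2p-1)) < 1/6,
and it gives (ii) with ε to spare. -/

namespace DeepNet

set_option linter.unusedSectionVars false

/-! ### The Wasserstein distance in dual form, under Lipschitz maps and convolutions. -/

section Lipschitz

open scoped NNReal

variable {E F : Type*} [NormedAddCommGroup E] [MeasurableSpace E] [BorelSpace E]
  [SecondCountableTopology E]
  [NormedAddCommGroup F] [MeasurableSpace F] [BorelSpace F] [SecondCountableTopology F]

/-- The Wasserstein-1 distance between `μ` and `ν` is at most `B`, in its dual form. -/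
def LipClose {E : Type*} [PseudoEMetricSpace E] [MeasurableSpace E] (μ ν : Measure E) (B : ℝ) :
    Prop :=
  ∀ ζ : E → ℝ, LipschitzWith 1 ζ → |∫ v, ζ v ∂μ - ∫ v, ζ v ∂ν| ≤ B

theorem integrable_of_lipschitz {μ : Measure E} [IsFiniteMeasure μ] (hμ : Integrable id μ)
    {ζ : E → ℝ} {K : ℝ≥0} (hζ : LipschitzWith K ζ) : Integrable ζ μ := by
  refine Integrable.mono' ((integrable_const |ζ 0|).add (hμ.norm.const_mul (K : ℝ)))
    hζ.continuous.aestronglyMeasurable (Filter.Eventually.of_forall fun x => ?_)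
  have h := hζ.norm_sub_le x 0
  simp only [Real.norm_eq_abs, sub_zero, Pi.add_apply, id] at h ⊢
  have := abs_sub_abs_le_abs_sub (ζ x) (ζ 0)
  linarith

theorem integrable_id_conv {μ ν : Measure E} [IsFiniteMeasure μ] [IsFiniteMeasure ν]
    (hμ : Integrable id μ) (hν : Integrable id ν) : Integrable id (μ.conv ν) := by
  rw [Measure.conv, integrable_map_measure (by fun_prop) (by fun_prop)]
  exact (hμ.comp_fst ν).add (hν.comp_snd μ)

theorem integrable_id_map {Ω : Type*} [MeasurableSpace Ω] {μ : Measure Ω} {X : Ω → E}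
    (hX : AEMeasurable X μ) (hi : Integrable X μ) : Integrable id (μ.map X) := by
  rw [integrable_map_measure (by fun_prop) hX]
  exact hi

namespace LipClose

variable {μ ν ρ : Measure E} {B B' : ℝ}

theorem nonneg (h : LipClose μ ν B) : 0 ≤ B := by
  simpa using h (fun _ => 0) (LipschitzWith.const' 0)

theorem symm (h : LipClose μ ν B) : LipClose ν μ B := fun ζ hζ => by
  rw [abs_sub_comm]; exact h ζ hζ

theorem trans (h : LipClose μ ν B) (h' : LipClose ν ρ B') : LipClose μ ρ (B + B') :=
  fun ζ hζ => (abs_sub_le _ (∫ v, ζ v ∂ν) _).trans (add_le_add (h ζ hζ) (h' ζ hζ))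

theorem mono (h : LipClose μ ν B) (hB : B ≤ B') : LipClose μ ν B' :=
  fun ζ hζ => (h ζ hζ).trans hB

theorem refl (μ : Measure E) : LipClose μ μ 0 := fun ζ _ => by simp

theorem abs_integral_sub_le (h : LipClose μ ν B) {ζ : E → ℝ} {K : ℝ≥0} (hζ : LipschitzWith K ζ) :
    |∫ v, ζ v ∂μ - ∫ v, ζ v ∂ν| ≤ K * B := by
  have key : ∀ k : ℝ≥0, 0 < k → LipschitzWith k ζ → |∫ v, ζ v ∂μ - ∫ v, ζ v ∂ν| ≤ k * B := by
    intro k hk hz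
    have hk' : (0 : ℝ) < k := hk
    have h1 : LipschitzWith 1 (fun v => (k : ℝ)⁻¹ * ζ v) := by
      refine LipschitzWith.of_dist_le_mul fun x y => ?_
      have := hz.dist_le_mul x y
      rw [Real.dist_eq] at this ⊢
      rw [← mul_sub, abs_mul, abs_of_pos (inv_pos.2 hk'), NNReal.coe_one, one_mul,
        inv_mul_le_iff₀ hk']
      exact this
    have h2 := h _ h1
    rw [integral_const_mul, integral_const_mul, ← mul_sub, abs_mul, abs_of_pos (inv_pos.2 hk'),
      inv_mul_le_iff₀ hk'] at h2
    exact h2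
  refine le_of_forall_pos_le_add fun ε hε => ?_
  have hB := h.nonneg
  -- Division by K fails for K = 0, so K is enlarged by ε / (B + 1), which adds at most ε to the
  -- bound.
  have hδ : 0 < ε / (B + 1) := by positivity
  refine (key (K + (ε / (B + 1)).toNNReal) (by positivity)
    (hζ.weaken (by simp))).trans ?_
  rw [NNReal.coe_add, Real.coe_toNNReal _ hδ.le, add_mul]
  gcongr
  rw [div_mul_eq_mul_div, div_le_iff₀ (by linarith)]
  nlinarith

theorem map (h : LipClose μ ν B) {f : E → F} {K : ℝ≥0} (hf : LipschitzWith K f) :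
    LipClose (μ.map f) (ν.map f) (K * B) := fun ζ hζ => by
  have hm : Measurable f := hf.continuous.measurable
  rw [integral_map hm.aemeasurable hζ.continuous.aestronglyMeasurable,
    integral_map hm.aemeasurable hζ.continuous.aestronglyMeasurable]
  have := h.abs_integral_sub_le (hζ.comp hf)
  simpa using this

/-- Translates of a 1-Lipschitz function are 1-Lipschitz, so the bound holds for each value of the
independent summand and survives averaging. -/
theorem conv_left [IsProbabilityMeasure ρ] [IsProbabilityMeasure μ] [IsProbabilityMeasure ν]
    (hρ : Integrable id ρ) (hμ : Integrable id μ) (hν : Integrable id ν) (h : LipClose μ ν B) :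
    LipClose (ρ.conv μ) (ρ.conv ν) B := fun ζ hζ => by
  have i1 := integrable_of_lipschitz (integrable_id_conv hρ hμ) hζ
  have i2 := integrable_of_lipschitz (integrable_id_conv hρ hν) hζ
  rw [integral_conv i1, integral_conv i2, ← integral_sub]
  · have hb := norm_integral_le_of_norm_le_const (μ := ρ) (C := B)
      (f := fun x => ∫ y, ζ (x + y) ∂μ - ∫ y, ζ (x + y) ∂ν) (Filter.Eventually.of_forall fun x =>
        h _ fun y z => by simpa using hζ (x + y) (x + z))
    simpa using hb
  · rw [Measure.conv, integrable_map_measure hζ.continuous.aestronglyMeasurable (by fun_prop)] at i1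
    exact i1.integral_prod_left
  · rw [Measure.conv, integrable_map_measure hζ.continuous.aestronglyMeasurable (by fun_prop)] at i2
    exact i2.integral_prod_left

theorem conv_right [IsProbabilityMeasure ρ] [IsProbabilityMeasure μ] [IsProbabilityMeasure ν]
    (hρ : Integrable id ρ) (hμ : Integrable id μ) (hν : Integrable id ν) (h : LipClose μ ν B) :
    LipClose (μ.conv ρ) (ν.conv ρ) B := by
  rw [Measure.conv_comm μ, Measure.conv_comm ν]
  exact h.conv_left hρ hμ hν

/-- Adding independent noise of mean norm at most `B` moves a measure by at most `B`. -/
theorem self_conv [IsProbabilityMeasure ρ] [IsProbabilityMeasure μ]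
    (hρ : Integrable id ρ) (hμ : Integrable id μ) (hB : ∫ x, ‖x‖ ∂ρ ≤ B) :
    LipClose μ (μ.conv ρ) B := by
  -- The noise is compared with the point mass at 0; convolution with μ then transfers the bound.
  have h0 : LipClose (Measure.dirac (0 : E)) ρ B := fun ζ hζ => by
    rw [integral_dirac]
    have : ζ 0 - ∫ v, ζ v ∂ρ = ∫ v, (ζ 0 - ζ v) ∂ρ := by
      rw [integral_sub (integrable_const _) (integrable_of_lipschitz hρ hζ)]; simp
    rw [this]
    refine (norm_integral_le_of_norm_le (f := fun v => ζ 0 - ζ v) hρ.norm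
      (Filter.Eventually.of_forall fun x => ?_)).trans hB
    simpa using hζ.norm_sub_le 0 x
  have hd : Integrable id (Measure.dirac (0 : E)) := integrable_dirac (by simp)
  have := h0.conv_left hμ hd hρ
  rwa [Measure.conv_dirac_zero] at this

end LipClose

end Lipschitz

/-! ### Taylor expansion of a Lipschitz function smoothed by a Gaussian on the line. -/

section Smoothing

/-- Cameron–Martin: the shift moves from f, which need not be differentiable, to an exponential
density that can be expanded in u. -/
theorem integral_add_gaussianReal (f : ℝ → ℝ) (hf : Continuous f) (u : ℝ) :
    ∫ z, f (u + z) ∂gaussianReal 0 1 =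
      ∫ z, f z * Real.exp (u * z - u ^ 2 / 2) ∂gaussianReal 0 1 := by
  have h1 : ∫ z, f (u + z) ∂gaussianReal 0 1 = ∫ z, f z ∂gaussianReal u 1 := by
    rw [← integral_map (φ := fun z => u + z) (f := f) (by fun_prop)
      hf.aestronglyMeasurable, gaussianReal_map_const_add, zero_add]
  rw [h1, integral_gaussianReal_eq_integral_smul one_ne_zero,
    integral_gaussianReal_eq_integral_smul one_ne_zero]
  congr 1 with z
  simp only [gaussianPDFReal, smul_eq_mul]
  have : Real.exp (-(z - u) ^ 2 / (2 * ((1 : NNReal) : ℝ))) =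
      Real.exp (-(z - 0) ^ 2 / (2 * ((1 : NNReal) : ℝ))) * Real.exp (u * z - u ^ 2 / 2) := by
    rw [← Real.exp_add]; congr 1; push_cast; ring
  rw [this]; ring

/-- The dominating function in the Taylor expansion of a Gaussian convolution. -/
noncomputable def taylorBound (z : ℝ) : ℝ :=
  48 * Real.exp 2 * (Real.exp (2 * z) + Real.exp (-2 * z))

theorem integrable_taylorBound : Integrable taylorBound (gaussianReal 0 1) :=
  ((integrable_exp_mul_gaussianReal 2).add (integrable_exp_mul_gaussianReal (-2))).const_mul _

/-- One integrable majorant serves for every term of the expansion: y⁴ ≤ 24 exp y absorbs the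
polynomial, and exp (2|z|) ≤ exp (2z) + exp (-2z). -/
theorem pow_four_mul_exp_le_taylorBound (z : ℝ) :
    2 * (|z| + 1) ^ 4 * Real.exp (|z| + 1) ≤ taylorBound z := by
  have h1 : (|z| + 1) ^ 4 ≤ 24 * Real.exp (|z| + 1) := by
    have := Real.pow_div_factorial_le_exp (|z| + 1) (by positivity) 4
    rw [div_le_iff₀ (by positivity)] at this
    norm_num [Nat.factorial] at this
    linarith
  have h2 : Real.exp (|z| + 1) * Real.exp (|z| + 1) = Real.exp 2 * Real.exp (2 * |z|) := by
    rw [← Real.exp_add, ← Real.exp_add]; congr 1; ring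
  have h3 : Real.exp (2 * |z|) ≤ Real.exp (2 * z) + Real.exp (-2 * z) := by
    rcases abs_cases z with ⟨h, _⟩ | ⟨h, _⟩ <;> rw [h]
    · linarith [Real.exp_pos (-2 * z)]
    · rw [show 2 * -z = -2 * z by ring]; linarith [Real.exp_pos (2 * z)]
  have e1 := Real.exp_pos (|z| + 1)
  have e2 := Real.exp_pos 2
  calc 2 * (|z| + 1) ^ 4 * Real.exp (|z| + 1)
      ≤ 2 * (24 * Real.exp (|z| + 1)) * Real.exp (|z| + 1) := by gcongr
    _ = 48 * (Real.exp 2 * Real.exp (2 * |z|)) := by rw [← h2]; ring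
    _ ≤ 48 * (Real.exp 2 * (Real.exp (2 * z) + Real.exp (-2 * z))) := by gcongr
    _ = taylorBound z := by rw [taylorBound]; ring

theorem abs_pow_mul_le_taylorBound (z : ℝ) {k : ℕ} (hk : k ≤ 3) :
    |z| * (|z| + 1) ^ k ≤ taylorBound z := by
  refine le_trans ?_ (pow_four_mul_exp_le_taylorBound z)
  have h1 : 1 ≤ |z| + 1 := by linarith [abs_nonneg z]
  have h2 : 1 ≤ Real.exp (|z| + 1) := Real.one_le_exp (by linarith)
  have h3 : (|z| + 1) ^ k ≤ (|z| + 1) ^ 3 := pow_le_pow_right₀ h1 hk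
  calc |z| * (|z| + 1) ^ k ≤ (|z| + 1) * (|z| + 1) ^ 3 := by gcongr; linarith
    _ = 1 * (|z| + 1) ^ 4 * 1 := by ring
    _ ≤ 2 * (|z| + 1) ^ 4 * Real.exp (|z| + 1) := by gcongr; norm_num

/-- The exponent is O(|u| (|z| + 1)). Expanding the exponential to second order in it leaves the
polynomial in u plus the exact remainder u³ (u/8 - z/2). The factor |z| stands for a 1-Lipschitz
function vanishing at 0. -/
theorem abs_exp_tilt_sub_le (u z : ℝ) (hu : |u| ≤ 1) :
    |z| * |Real.exp (u * z - u ^ 2 / 2) - (1 + u * z + u ^ 2 * ((z ^ 2 - 1) / 2))| ≤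
      taylorBound z * |u| ^ 3 := by
  set x := u * z - u ^ 2 / 2 with hx
  have hz := abs_nonneg z
  have hu0 := abs_nonneg u
  have hxle : |x| ≤ |u| * (|z| + 1) := by
    calc |x| ≤ |u * z| + |u ^ 2 / 2| := abs_sub _ _
      _ = |u| * |z| + |u| * (|u| / 2) := by
          rw [abs_mul, abs_div, abs_pow, abs_two]; ring
      _ ≤ |u| * |z| + |u| * 1 := by gcongr; linarith
      _ = _ := by ring
  have hxle' : |x| ≤ |z| + 1 := hxle.trans (by nlinarith)
  have hexp : |Real.exp x - (1 + x + x ^ 2 / 2)| ≤ |x| ^ 3 * Real.exp |x| := by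
    have := Complex.norm_exp_sub_sum_le_norm_mul_exp (x : ℂ) 3
    have e : Complex.exp x - ∑ m ∈ Finset.range 3, (x : ℂ) ^ m / (m.factorial : ℂ) =
        ((Real.exp x - (1 + x + x ^ 2 / 2) : ℝ) : ℂ) := by
      simp [Finset.sum_range_succ, Nat.factorial]
    rw [e, Complex.norm_real, Complex.norm_real] at this
    exact this
  have hrem : |(1 + x + x ^ 2 / 2) - (1 + u * z + u ^ 2 * ((z ^ 2 - 1) / 2))| ≤
      |u| ^ 3 * (|z| + 1) := by
    have : (1 + x + x ^ 2 / 2) - (1 + u * z + u ^ 2 * ((z ^ 2 - 1) / 2)) =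
        u ^ 3 * (u / 8 - z / 2) := by rw [hx]; ring
    rw [this, abs_mul, abs_pow]
    gcongr
    calc |u / 8 - z / 2| ≤ |u / 8| + |z / 2| := abs_sub _ _
      _ = |u| / 8 + |z| / 2 := by simp [abs_div]
      _ ≤ |z| + 1 := by linarith
  have h1 : 1 ≤ |z| + 1 := by linarith
  have h2 : 1 ≤ Real.exp (|z| + 1) := Real.one_le_exp (by linarith)
  have hmain : |Real.exp x - (1 + u * z + u ^ 2 * ((z ^ 2 - 1) / 2))| ≤
      |u| ^ 3 * (2 * (|z| + 1) ^ 3 * Real.exp (|z| + 1)) := by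
    calc _ ≤ |x| ^ 3 * Real.exp |x| + |u| ^ 3 * (|z| + 1) :=
          (abs_sub_le _ (1 + x + x ^ 2 / 2) _).trans (add_le_add hexp hrem)
      _ ≤ (|u| * (|z| + 1)) ^ 3 * Real.exp (|z| + 1) +
          |u| ^ 3 * ((|z| + 1) ^ 3 * Real.exp (|z| + 1)) := by
        gcongr
        calc |z| + 1 = (|z| + 1) ^ 1 * 1 := by ring
          _ ≤ (|z| + 1) ^ 3 * Real.exp (|z| + 1) := by gcongr; norm_num
      _ = _ := by ring
  calc |z| * _ ≤ (|z| + 1) * (|u| ^ 3 * (2 * (|z| + 1) ^ 3 * Real.exp (|z| + 1))) := by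
        gcongr; linarith
    _ = 2 * (|z| + 1) ^ 4 * Real.exp (|z| + 1) * |u| ^ 3 := by ring
    _ ≤ taylorBound z * |u| ^ 3 := by
        gcongr; exact pow_four_mul_exp_le_taylorBound z

/-- The constant in the third-order Taylor bound for Gaussian convolutions. -/
noncomputable def taylorConst : ℝ := 1 + 3 * ∫ z, taylorBound z ∂gaussianReal 0 1

theorem taylorBound_nonneg (z : ℝ) : 0 ≤ taylorBound z := by unfold taylorBound; positivity

theorem taylorConst_pos : 0 < taylorConst := by
  have : 0 ≤ ∫ z, taylorBound z ∂gaussianReal 0 1 := integral_nonneg taylorBound_nonneg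
  unfold taylorConst; linarith

/-- The convolution of a 1-Lipschitz function with the standard Gaussian law has a second order
Taylor expansion with a cubic remainder. -/
theorem exists_taylor {h : ℝ → ℝ} (hh : LipschitzWith 1 h) :
    ∃ a b c : ℝ, ∀ u, |∫ z, h (u + z) ∂gaussianReal 0 1 - (a + b * u + c * u ^ 2)| ≤
      taylorConst * |u| ^ 3 := by
  set γ := gaussianReal 0 1 with hγ
  set g : ℝ → ℝ := fun z => h z - h 0 with hg
  have hgc : Continuous g := by have := hh.continuous; fun_prop
  have hgz : ∀ z, |g z| ≤ |z| := fun z => by simpa using hh.norm_sub_le z 0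
  have hT := integrable_taylorBound
  have hI0 : 0 ≤ ∫ z, taylorBound z ∂γ := integral_nonneg taylorBound_nonneg
  have dom : ∀ (f : ℝ → ℝ), Continuous f → ∀ k ≤ 3, (∀ z, |f z| ≤ (|z| + 1) ^ k) →
      Integrable (fun z => g z * f z) γ ∧ |∫ z, g z * f z ∂γ| ≤ ∫ z, taylorBound z ∂γ := by
    intro f hf k hk hfk
    have hle : ∀ z, ‖g z * f z‖ ≤ taylorBound z := fun z => by
      rw [norm_mul]
      exact (mul_le_mul (hgz z) (hfk z) (abs_nonneg _) (abs_nonneg _)).trans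
        (abs_pow_mul_le_taylorBound z hk)
    exact ⟨Integrable.mono' hT (hgc.mul hf).aestronglyMeasurable
        (Filter.Eventually.of_forall hle),
      norm_integral_le_of_norm_le hT (Filter.Eventually.of_forall hle)⟩
  obtain ⟨i0, -⟩ := dom (fun _ => 1) continuous_const 0 (by norm_num) (by simp)
  obtain ⟨i1, b1⟩ := dom (fun z => z) continuous_id 1 (by norm_num) (fun z => by
    rw [pow_one]; linarith)
  obtain ⟨i2, b2⟩ := dom (fun z => (z ^ 2 - 1) / 2) (by fun_prop) 2 (by norm_num) (fun z => by
    have := sq_abs z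
    rw [abs_le]; constructor <;> nlinarith [abs_nonneg z])
  have hsplit : ∀ u, ∫ z, h (u + z) ∂γ = h 0 + ∫ z, g (u + z) ∂γ := fun u => by
    have : Integrable (fun z => g (u + z)) γ := by
      refine Integrable.mono' (hT.add (integrable_const |u|)) (by fun_prop)
        (Filter.Eventually.of_forall fun z => ?_)
      have := abs_pow_mul_le_taylorBound z (k := 0) (by norm_num)
      simp only [pow_zero, mul_one] at this
      calc ‖g (u + z)‖ ≤ |u + z| := hgz _
        _ ≤ |u| + |z| := abs_add_le _ _
        _ ≤ taylorBound z + |u| := by linarith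
    calc ∫ z, h (u + z) ∂γ = ∫ z, (h 0 + g (u + z)) ∂γ := by simp [hg]
      _ = _ := by rw [integral_add (integrable_const _) this]; simp
  refine ⟨h 0 + ∫ z, g z ∂γ, ∫ z, g z * z ∂γ, ∫ z, g z * ((z ^ 2 - 1) / 2) ∂γ, fun u => ?_⟩
  rcases le_or_gt |u| 1 with hu | hu
  · have hG := integral_add_gaussianReal g hgc u
    have hi : Integrable (fun z => g z * Real.exp (u * z - u ^ 2 / 2)) γ := by
      have hle : ∀ z, ‖g z * Real.exp (u * z - u ^ 2 / 2)‖ ≤ taylorBound z := fun z => by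
        refine le_trans ?_ (pow_four_mul_exp_le_taylorBound z)
        rw [norm_mul, Real.norm_eq_abs, Real.norm_eq_abs, Real.abs_exp]
        have h0 : |g z| ≤ 2 * (|z| + 1) ^ 4 := by
          have := hgz z
          have h1 : 1 ≤ |z| + 1 := by linarith [abs_nonneg z]
          have : (|z| + 1) ^ 1 ≤ (|z| + 1) ^ 4 := pow_le_pow_right₀ h1 (by norm_num)
          linarith
        refine mul_le_mul h0 (Real.exp_le_exp.2 ?_) (Real.exp_nonneg _) (by positivity)
        have : u * z ≤ |z| := by
          calc u * z ≤ |u * z| := le_abs_self _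
            _ = |u| * |z| := abs_mul _ _
            _ ≤ 1 * |z| := by gcongr
            _ = _ := one_mul _
        nlinarith [sq_nonneg u]
      exact Integrable.mono' hT (by fun_prop) (Filter.Eventually.of_forall hle)
    have hdiff : ∫ z, h (u + z) ∂γ - (h 0 + ∫ z, g z ∂γ + (∫ z, g z * z ∂γ) * u +
        (∫ z, g z * ((z ^ 2 - 1) / 2) ∂γ) * u ^ 2) =
        ∫ z, g z * (Real.exp (u * z - u ^ 2 / 2) - (1 + u * z + u ^ 2 * ((z ^ 2 - 1) / 2))) ∂γ := by
      simp only [mul_one] at i0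
      have e : ∀ z, g z * (Real.exp (u * z - u ^ 2 / 2) -
          (1 + u * z + u ^ 2 * ((z ^ 2 - 1) / 2))) =
          g z * Real.exp (u * z - u ^ 2 / 2) -
            ((g z + u * (g z * z)) + u ^ 2 * (g z * ((z ^ 2 - 1) / 2))) := fun z => by ring
      simp_rw [e]
      have i01 : Integrable (fun z => g z + u * (g z * z)) γ := i0.add (i1.const_mul u)
      have i012 : Integrable (fun z => g z + u * (g z * z) +
        u ^ 2 * (g z * ((z ^ 2 - 1) / 2))) γ := i01.add (i2.const_mul (u ^ 2))
      rw [integral_sub hi i012, integral_add i01 (i2.const_mul (u ^ 2)), integral_add i0 (i1.const_mul u), integral_const_mul, integral_const_mul, hsplit, hG]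
      ring
    rw [hdiff]
    calc _ ≤ ∫ z, taylorBound z * |u| ^ 3 ∂γ := by
          refine norm_integral_le_of_norm_le (f := fun z => g z * (Real.exp (u * z - u ^ 2 / 2) -
            (1 + u * z + u ^ 2 * ((z ^ 2 - 1) / 2)))) (hT.mul_const _)
            (Filter.Eventually.of_forall fun z => ?_)
          rw [norm_mul]
          exact (mul_le_mul_of_nonneg_right (hgz z) (norm_nonneg _)).trans
            (abs_exp_tilt_sub_le u z hu)
      _ = (∫ z, taylorBound z ∂γ) * |u| ^ 3 := integral_mul_const _ _
      _ ≤ taylorConst * |u| ^ 3 := by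
          gcongr; unfold taylorConst; linarith
  -- For |u| > 1 no expansion is needed: the increment of the smoothed function is at most |u|, and
  -- |u| and u² are both at most |u|³.
  · have h01 : |∫ z, h (u + z) ∂γ - (h 0 + ∫ z, g z ∂γ)| ≤ |u| := by
      have e0 := hsplit 0
      have eu := hsplit u
      simp only [zero_add] at e0
      rw [← e0, ← integral_sub]
      · have := norm_integral_le_of_norm_le_const (μ := γ) (C := |u|)
          (f := fun z => h (u + z) - h z) (Filter.Eventually.of_forall fun z => by
            simpa using hh.norm_sub_le (u + z) z)
        simpa using this
      · exact integrable_of_lipschitz (K := 1) (IsGaussian.integrable_id)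
          (fun x y => by simpa using hh (u + x) (u + y))
      · exact integrable_of_lipschitz IsGaussian.integrable_id hh
    set T := ∫ z, taylorBound z ∂γ
    have hu1 : |u| ≤ |u| ^ 3 := by
      calc |u| = |u| ^ 1 := (pow_one _).symm
        _ ≤ |u| ^ 3 := pow_le_pow_right₀ hu.le (by norm_num)
    have hu2 : |u| ^ 2 ≤ |u| ^ 3 := pow_le_pow_right₀ hu.le (by norm_num)
    set X := ∫ z, h (u + z) ∂γ
    set A := ∫ z, g z ∂γ
    set Bb := ∫ z, g z * z ∂γ
    set Cc := ∫ z, g z * ((z ^ 2 - 1) / 2) ∂γ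
    calc |X - (h 0 + A + Bb * u + Cc * u ^ 2)|
        = |(X - (h 0 + A)) - Bb * u - Cc * u ^ 2| := by congr 1; ring
      _ ≤ |X - (h 0 + A)| + |Bb * u| + |Cc * u ^ 2| := by
          refine (abs_sub _ _).trans ?_
          gcongr
          exact abs_sub _ _
      _ ≤ |u| + T * |u| + T * |u| ^ 2 := by
          rw [abs_mul, abs_mul, abs_pow]
          gcongr
      _ ≤ |u| ^ 3 + T * |u| ^ 3 + T * |u| ^ 3 := by gcongr
      _ ≤ taylorConst * |u| ^ 3 := by
          have : 0 ≤ T * |u| ^ 3 := by positivity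
          have e : taylorConst = 1 + 3 * T := rfl
          rw [e]; linarith

/-- Two centred laws with the same variance and finite third moments are close after a convolution
with the standard Gaussian law. -/
theorem lipClose_conv_gaussianReal {P Q : Measure ℝ} [IsProbabilityMeasure P]
    [IsProbabilityMeasure Q] (hP : Integrable (fun x => |x| ^ 3) P)
    (hQ : Integrable (fun x => |x| ^ 3) Q) (hP1 : ∫ x, x ∂P = 0) (hQ1 : ∫ x, x ∂Q = 0)
    (h2 : ∫ x, x ^ 2 ∂P = ∫ x, x ^ 2 ∂Q) :
    LipClose (P.conv (gaussianReal 0 1)) (Q.conv (gaussianReal 0 1))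
      (taylorConst * (∫ x, |x| ^ 3 ∂P + ∫ x, |x| ^ 3 ∂Q)) := by
  intro ζ hζ
  obtain ⟨a, b, c, hT⟩ := exists_taylor hζ
  have key : ∀ (τ : Measure ℝ) [IsProbabilityMeasure τ], Integrable (fun x => |x| ^ 3) τ →
      ∫ x, x ∂τ = 0 →
      |∫ v, ζ v ∂(τ.conv (gaussianReal 0 1)) - (a + c * ∫ x, x ^ 2 ∂τ)| ≤
        taylorConst * ∫ x, |x| ^ 3 ∂τ := by
    -- The linear term of the expansion integrates to 0; what remains besides the cubic error
    -- depends on τ only through its second moment, which P and Q share.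
    intro τ _ hR hR1
    have hle : ∀ x : ℝ, ∀ k ≤ 3, |x| ^ k ≤ 1 + |x| ^ 3 := fun x k hk => by
      rcases le_total |x| 1 with h | h
      · have := pow_le_one₀ (n := k) (abs_nonneg x) h
        have : 0 ≤ |x| ^ 3 := by positivity
        linarith
      · have := pow_le_pow_right₀ h hk
        linarith
    have i1 : Integrable (fun x : ℝ => x) τ :=
      Integrable.mono' ((integrable_const 1).add hR) (by fun_prop)
        (Filter.Eventually.of_forall fun x => by simpa using hle x 1 (by norm_num))
    have i2 : Integrable (fun x : ℝ => x ^ 2) τ :=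
      Integrable.mono' ((integrable_const 1).add hR) (by fun_prop)
        (Filter.Eventually.of_forall fun x => by simpa using hle x 2 (by norm_num))
    have ic := integrable_of_lipschitz
      (integrable_id_conv (μ := τ) (ν := gaussianReal 0 1) i1 IsGaussian.integrable_id) hζ
    rw [integral_conv ic]
    have iH : Integrable (fun u => ∫ z, ζ (u + z) ∂gaussianReal 0 1) τ := by
      rw [Measure.conv, integrable_map_measure hζ.continuous.aestronglyMeasurable
        (by fun_prop)] at ic
      exact ic.integral_prod_left
    have ip1 : Integrable (fun u => a + b * u) τ := (integrable_const a).add (i1.const_mul b)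
    have ip : Integrable (fun u => a + b * u + c * u ^ 2) τ := ip1.add (i2.const_mul c)
    have e : ∫ u, (a + b * u + c * u ^ 2) ∂τ = a + c * ∫ x, x ^ 2 ∂τ := by
      rw [integral_add ip1 (i2.const_mul c),
        integral_add (integrable_const a) (i1.const_mul b), integral_const_mul, integral_const_mul,
        hR1]
      simp
    rw [← e, ← integral_sub iH ip, ← integral_const_mul]
    exact norm_integral_le_of_norm_le
      (f := fun u => ∫ z, ζ (u + z) ∂gaussianReal 0 1 - (a + b * u + c * u ^ 2))
      (hR.const_mul _) (Filter.Eventually.of_forall hT)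
  have kP := key P hP hP1
  have kQ := key Q hQ hQ1
  rw [h2] at kP
  rw [abs_sub_comm] at kQ
  rw [mul_add]
  exact (abs_sub_le _ _ _).trans (add_le_add kP kQ)

end Smoothing

/-! ### Replacement of one random coefficient under isotropic Gaussian noise. -/

section Lindeberg

open scoped RealInnerProductSpace

variable {E : Type*} [NormedAddCommGroup E] [InnerProductSpace ℝ E] [FiniteDimensional ℝ E]
  [MeasurableSpace E] [BorelSpace E]

theorem charFun_map_of_inner {E F : Type*} [NormedAddCommGroup E] [InnerProductSpace ℝ E]
    [MeasurableSpace E] [BorelSpace E] [NormedAddCommGroup F] [InnerProductSpace ℝ F]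
    [MeasurableSpace F] [BorelSpace F] [SecondCountableTopology F] (μ : Measure E) {f : E → F}
    (hf : Measurable f) {s : F} {r : E}
    (h : ∀ x, ⟪f x, s⟫ = ⟪x, r⟫) : charFun (μ.map f) s = charFun μ r := by
  rw [charFun_apply, charFun_apply, integral_map hf.aemeasurable (by fun_prop)]
  simp_rw [h]

variable (E) in
/-- The law of `t` times a standard Gaussian vector of `E`. -/
noncomputable def noise (t : ℝ) : Measure E := (stdGaussian E).map (fun x => t • x)

instance (t : ℝ) : IsProbabilityMeasure (noise E t) :=
  Measure.isProbabilityMeasure_map (by fun_prop)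

theorem integrable_id_noise (t : ℝ) : Integrable id (noise E t) :=
  integrable_id_map (by fun_prop) (IsGaussian.integrable_id.smul t)

theorem integral_norm_noise_le {t : ℝ} (ht : 0 ≤ t) :
    ∫ x, ‖x‖ ∂noise E t ≤ t * ∫ x, ‖x‖ ∂stdGaussian E := by
  rw [noise, integral_map (by fun_prop) (by fun_prop), ← integral_const_mul]
  simp [norm_smul, abs_of_nonneg ht]

/-- Isotropy splits the noise into independent parts along e and orthogonal to it. Only the first is
needed to smooth a random multiple of e; the second is convolved back afterwards. -/
theorem noise_eq_conv (t : ℝ) {e : E} (he : ‖e‖ = 1) :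
    noise E t = ((gaussianReal 0 1).map (fun u : ℝ => u • (t • e))).conv
      ((stdGaussian E).map (fun z => t • (z - ⟪e, z⟫ • e))) := by
  have h1 : Measurable (fun u : ℝ => u • (t • e)) := by fun_prop
  have h2 : Measurable (fun z : E => t • (z - ⟪e, z⟫ • e)) :=
    Continuous.measurable (by fun_prop)
  have := Measure.isProbabilityMeasure_map (μ := gaussianReal 0 1) h1.aemeasurable
  have := Measure.isProbabilityMeasure_map (μ := stdGaussian E) h2.aemeasurable
  apply Measure.ext_of_charFun
  ext s
  rw [charFun_conv, noise, charFun_map_of_inner (r := t • s) _ (by fun_prop),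
    charFun_map_of_inner (r := t * ⟪e, s⟫) _ h1,
    charFun_map_of_inner (r := t • (s - ⟪e, s⟫ • e)) _ h2,
    charFun_stdGaussian, charFun_stdGaussian, charFun_gaussianReal, ← Complex.exp_add]
  · congr 1
    have hn : ‖t • (s - ⟪e, s⟫ • e)‖ ^ 2 = t ^ 2 * (‖s‖ ^ 2 - ⟪e, s⟫ ^ 2) := by
      rw [norm_smul, mul_pow, norm_sub_sq_real, norm_smul, inner_smul_right, real_inner_comm e s,
        he, Real.norm_eq_abs, sq_abs, Real.norm_eq_abs, mul_pow, sq_abs]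
      ring
    have hs : ‖t • s‖ ^ 2 = t ^ 2 * ‖s‖ ^ 2 := by
      rw [norm_smul, mul_pow, Real.norm_eq_abs, sq_abs]
    simp only [← Complex.ofReal_pow, hn, hs]
    push_cast
    ring
  · intro z
    rw [inner_smul_left, inner_smul_right, inner_sub_left, inner_sub_right, inner_smul_left,
      inner_smul_right, real_inner_comm z e]
    simp only [conj_trivial, real_inner_comm]
    ring
  · intro u
    simp only [inner_smul_left, conj_trivial]
    change _ = inner ℝ u (t * ⟪e, s⟫)
    simp [mul_comm]
  · intro z
    simp [inner_smul_left, inner_smul_right]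

theorem integrable_of_integrable_abs_pow_three {P : Measure ℝ} [IsProbabilityMeasure P]
    (hP : Integrable (fun x => |x| ^ 3) P) : Integrable id P :=
  Integrable.mono' ((integrable_const 1).add hP) (by fun_prop)
    (Filter.Eventually.of_forall fun x => by
      simp only [Pi.add_apply, id, Real.norm_eq_abs]
      nlinarith [abs_nonneg x, sq_nonneg (|x| - 1), mul_nonneg (abs_nonneg x) (sq_nonneg (|x| - 1))])

/-- Replacing a centred scalar random coefficient of a fixed vector by another one with the same
variance, in the presence of isotropic Gaussian noise. -/
theorem lipClose_smul_conv_noise {P Q : Measure ℝ} [IsProbabilityMeasure P]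
    [IsProbabilityMeasure Q] (hP : Integrable (fun x => |x| ^ 3) P)
    (hQ : Integrable (fun x => |x| ^ 3) Q) (hP1 : ∫ x, x ∂P = 0) (hQ1 : ∫ x, x ∂Q = 0)
    (h2 : ∫ x, x ^ 2 ∂P = ∫ x, x ^ 2 ∂Q) (v : E) {t : ℝ} (ht : 0 < t) :
    LipClose ((P.map (fun x => x • v)).conv (noise E t)) ((Q.map (fun x => x • v)).conv (noise E t))
      (taylorConst * ‖v‖ ^ 3 / t ^ 2 * (∫ x, |x| ^ 3 ∂P + ∫ x, |x| ^ 3 ∂Q)) := by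
  -- A zero vector has no direction, but then the two laws coincide.
  rcases eq_or_ne v 0 with rfl | hv
  · simp only [smul_zero, Measure.map_const, measure_univ, one_smul]
    simpa using LipClose.refl _
  have hv' : 0 < ‖v‖ := norm_pos_iff.2 hv
  set e : E := ‖v‖⁻¹ • v with he
  have he1 : ‖e‖ = 1 := by rw [he, norm_smul, norm_inv, norm_norm, inv_mul_cancel₀ hv'.ne']
  set r := ‖v‖ / t with hr
  have hr0 : 0 < r := by positivity
  set L : ℝ →L[ℝ] E := ContinuousLinearMap.toSpanSingleton ℝ (t • e) with hL
  have hLf : ⇑L = fun u : ℝ => u • (t • e) := by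
    ext u; simp [hL]
  have hLlip : LipschitzWith t.toNNReal L := by
    refine LipschitzWith.of_dist_le_mul fun x y => ?_
    rw [dist_eq_norm, ← map_sub, hLf]
    simp only [norm_smul, he1, mul_one, dist_eq_norm]
    rw [Real.coe_toNNReal _ ht.le, Real.norm_eq_abs, Real.norm_eq_abs, abs_of_pos ht, mul_comm]
  set O : Measure E := (stdGaussian E).map (fun z => t • (z - ⟪e, z⟫ • e)) with hO
  have hOm : Measurable (fun z : E => t • (z - ⟪e, z⟫ • e)) := Continuous.measurable (by fun_prop)
  have : IsProbabilityMeasure O := Measure.isProbabilityMeasure_map hOm.aemeasurable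
  have hOi : Integrable id O := by
    refine integrable_id_map hOm.aemeasurable ?_
    have h1 : Integrable (fun z : E => z) (stdGaussian E) := IsGaussian.integrable_id
    exact (h1.sub ((h1.const_inner e).smul_const e)).smul t
  have hn := noise_eq_conv (E := E) t he1
  rw [← hLf, ← hO] at hn
  -- Since x v + u t e = (x r + u) t e with r = ‖v‖ / t, the problem is one-dimensional. Third
  -- moments are multiplied by r³ and the embedding `L` has Lipschitz constant t; the product t r³
  -- is ‖v‖³ / t².
  have scaled : ∀ (S : Measure ℝ) [IsProbabilityMeasure S], Integrable (fun x => |x| ^ 3) S →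
      (S.map (fun x => x • v)).conv (noise E t) =
        (((S.map (fun x => x * r)).conv (gaussianReal 0 1)).map L).conv O ∧
      Integrable (fun x => |x| ^ 3) (S.map (fun x => x * r)) ∧
      ∫ x, |x| ^ 3 ∂(S.map (fun x => x * r)) = r ^ 3 * ∫ x, |x| ^ 3 ∂S ∧
      ∫ x, x ∂(S.map (fun x => x * r)) = r * ∫ x, x ∂S ∧
      ∫ x, x ^ 2 ∂(S.map (fun x => x * r)) = r ^ 2 * ∫ x, x ^ 2 ∂S := by
    intro S _ hS
    have hm : Measurable (fun x : ℝ => x * r) := by fun_prop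
    have := Measure.isProbabilityMeasure_map (μ := S) hm.aemeasurable
    have := Measure.isProbabilityMeasure_map (μ := gaussianReal 0 1)
      L.continuous.measurable.aemeasurable
    have h3 : ∀ x : ℝ, |x * r| ^ 3 = r ^ 3 * |x| ^ 3 := fun x => by
      rw [abs_mul, abs_of_pos hr0, mul_pow, mul_comm]
    refine ⟨?_, ?_, ?_, ?_, ?_⟩
    · rw [Measure.map_conv_continuousLinearMap, Measure.map_map L.continuous.measurable hm, hn,
        Measure.conv_assoc]
      congr 2
      ext x
      simp only [Function.comp, hLf, he, hr, smul_smul]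
      congr 1
      field_simp
    · rw [integrable_map_measure (by fun_prop) hm.aemeasurable]
      simp only [Function.comp_def, h3]
      exact hS.const_mul _
    · rw [integral_map hm.aemeasurable (by fun_prop), ← integral_const_mul]
      simp only [h3]
    · rw [integral_map hm.aemeasurable (by fun_prop), ← integral_const_mul]
      simp only [mul_comm]
    · rw [integral_map hm.aemeasurable (by fun_prop), ← integral_const_mul]
      simp only [mul_comm, mul_pow]
  obtain ⟨eP, iP, m3P, m1P, m2P⟩ := scaled P hP
  obtain ⟨eQ, iQ, m3Q, m1Q, m2Q⟩ := scaled Q hQ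
  have hm : Measurable (fun x : ℝ => x * r) := by fun_prop
  have := Measure.isProbabilityMeasure_map (μ := P) hm.aemeasurable
  have := Measure.isProbabilityMeasure_map (μ := Q) hm.aemeasurable
  have base := lipClose_conv_gaussianReal iP iQ (by rw [m1P, hP1, mul_zero])
    (by rw [m1Q, hQ1, mul_zero]) (by rw [m2P, m2Q, h2])
  have hLm : AEMeasurable L (gaussianReal 0 1) := L.continuous.measurable.aemeasurable
  have hc : ∀ (S : Measure ℝ) [IsProbabilityMeasure S], Integrable (fun x => |x| ^ 3) S →
      IsProbabilityMeasure ((S.conv (gaussianReal 0 1)).map L) ∧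
      Integrable id ((S.conv (gaussianReal 0 1)).map L) := fun S _ hS => by
    refine ⟨Measure.isProbabilityMeasure_map L.continuous.measurable.aemeasurable, ?_⟩
    refine integrable_id_map L.continuous.measurable.aemeasurable ?_
    exact L.integrable_comp
      (integrable_id_conv (integrable_of_integrable_abs_pow_three hS) IsGaussian.integrable_id)
  obtain ⟨_, jP⟩ := hc _ iP
  obtain ⟨_, jQ⟩ := hc _ iQ
  have fin := (base.map hLlip).conv_right hOi jP jQ
  rw [eP, eQ]
  refine fin.mono (le_of_eq ?_)
  rw [m3P, m3Q, Real.coe_toNNReal _ ht.le, hr]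
  field_simp

end Lindeberg

/-! ### Lindeberg's replacement for sums, and the passage to a Gaussian vector. -/

section Sums

open scoped RealInnerProductSpace NNReal

variable {E : Type*} [NormedAddCommGroup E] [InnerProductSpace ℝ E] [FiniteDimensional ℝ E]
  [MeasurableSpace E] [BorelSpace E]

/-- A real random variable that is centred and has a finite third moment. -/
structure IsCentredThird {Ω : Type*} [MeasurableSpace Ω] (μ : Measure Ω) (X : Ω → ℝ) : Prop where
  measurable : Measurable X
  integrable : Integrable (fun ω => |X ω| ^ 3) μ
  centred : ∫ ω, X ω ∂μ = 0

theorem IsCentredThird.integrable_self {Ω : Type*} [MeasurableSpace Ω] {μ : Measure Ω}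
    [IsProbabilityMeasure μ] {X : Ω → ℝ} (h : IsCentredThird μ X) : Integrable X μ :=
  Integrable.mono' ((integrable_const 1).add h.integrable) h.measurable.aestronglyMeasurable
    (Filter.Eventually.of_forall fun x => by
      simp only [Pi.add_apply, Real.norm_eq_abs]
      nlinarith [abs_nonneg (X x), sq_nonneg (|X x| - 1),
        mul_nonneg (abs_nonneg (X x)) (sq_nonneg (|X x| - 1))])

theorem map_sum_insert {κ : Type*} [DecidableEq κ] {Ω : Type*} [MeasurableSpace Ω] {μ : Measure Ω}
    [IsProbabilityMeasure μ] {X : κ → Ω → ℝ} (hi : iIndepFun X μ) (hm : ∀ k, Measurable (X k))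
    (v : κ → E) {a : κ} {T : Finset κ} (ha : a ∉ T) :
    μ.map (fun ω => ∑ k ∈ insert a T, X k ω • v k) =
      ((μ.map (X a)).map (fun x => x • v a)).conv (μ.map (fun ω => ∑ k ∈ T, X k ω • v k)) := by
  have hi' : iIndepFun (fun k ω => X k ω • v k) μ :=
    hi.comp (fun k x => x • v k) (fun k => by fun_prop)
  have hm' : ∀ k, Measurable (fun ω => X k ω • v k) := fun k => (hm k).smul_const _
  have h := (hi'.indepFun_finsetSum_of_notMem hm' ha).symm
  have hs : (∑ j ∈ T, fun ω => X j ω • v j) = fun ω => ∑ j ∈ T, X j ω • v j := by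
    ext1 ω; exact Finset.sum_apply _ _ _
  rw [hs] at h
  have h2 := h.map_add_eq_map_conv_map (hm' a) (Finset.measurable_sum T fun k _ => hm' k)
  rw [Measure.map_map (by fun_prop) (hm a)]
  convert h2 using 2
  · ext ω
    simp [Finset.sum_insert ha]
  · rfl

theorem IsCentredThird.map_sum {κ : Type*} {Ω : Type*} [MeasurableSpace Ω] {μ : Measure Ω}
    [IsProbabilityMeasure μ] {X : κ → Ω → ℝ} (c : ∀ k, IsCentredThird μ (X k)) (v : κ → E)
    (T : Finset κ) :
    IsProbabilityMeasure (μ.map (fun ω => ∑ k ∈ T, X k ω • v k)) ∧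
      Integrable id (μ.map (fun ω => ∑ k ∈ T, X k ω • v k)) := by
  have hm : AEMeasurable (fun ω => ∑ k ∈ T, X k ω • v k) μ :=
    (Finset.measurable_sum T fun k _ => (c k).measurable.smul_const _).aemeasurable
  exact ⟨Measure.isProbabilityMeasure_map hm, integrable_id_map hm
    (integrable_finsetSum _ fun k _ => (c k).integrable_self.smul_const _)⟩

theorem IsCentredThird.map_smul {Ω : Type*} [MeasurableSpace Ω] {μ : Measure Ω}
    [IsProbabilityMeasure μ] {X : Ω → ℝ} (c : IsCentredThird μ X) (v : E) :
    IsProbabilityMeasure (μ.map X) ∧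
      Integrable (fun x => |x| ^ 3) (μ.map X) ∧ ∫ x, x ∂μ.map X = 0 ∧
      IsProbabilityMeasure ((μ.map X).map (fun x => x • v)) ∧
      Integrable id ((μ.map X).map (fun x => x • v)) ∧
      ∫ x, |x| ^ 3 ∂(μ.map X) = ∫ ω, |X ω| ^ 3 ∂μ ∧
      ∫ x, x ^ 2 ∂(μ.map X) = ∫ ω, X ω ^ 2 ∂μ := by
  have p := Measure.isProbabilityMeasure_map (μ := μ) c.measurable.aemeasurable
  have i3 : Integrable (fun x => |x| ^ 3) (μ.map X) := by
    rw [integrable_map_measure (by fun_prop) c.measurable.aemeasurable]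
    exact c.integrable
  refine ⟨p, i3, ?_, Measure.isProbabilityMeasure_map (by fun_prop), ?_, ?_, ?_⟩
  · rw [integral_map c.measurable.aemeasurable (by fun_prop), c.centred]
  · exact integrable_id_map (by fun_prop)
      ((integrable_of_integrable_abs_pow_three i3).smul_const v)
  · rw [integral_map c.measurable.aemeasurable (by fun_prop)]
  · rw [integral_map c.measurable.aemeasurable (by fun_prop)]

/-- Lindeberg's replacement argument: sums of independent centred scalar multiples of fixed vectors
are close, in the presence of Gaussian noise, if the variances agree. -/
theorem lipClose_sum_conv_noise {κ : Type*} [DecidableEq κ] {Ω Ω' : Type*} [MeasurableSpace Ω]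
    [MeasurableSpace Ω'] {μ : Measure Ω} {μ' : Measure Ω'} [IsProbabilityMeasure μ]
    [IsProbabilityMeasure μ'] {X : κ → Ω → ℝ} {Y : κ → Ω' → ℝ} (hX : iIndepFun X μ)
    (hY : iIndepFun Y μ') (cX : ∀ k, IsCentredThird μ (X k)) (cY : ∀ k, IsCentredThird μ' (Y k))
    (hV : ∀ k, ∫ ω, X k ω ^ 2 ∂μ = ∫ ω, Y k ω ^ 2 ∂μ') (v : κ → E) {t : ℝ} (ht : 0 < t)
    (T : Finset κ) :
    LipClose ((μ.map (fun ω => ∑ k ∈ T, X k ω • v k)).conv (noise E t))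
      ((μ'.map (fun ω => ∑ k ∈ T, Y k ω • v k)).conv (noise E t))
      (∑ k ∈ T, taylorConst * ‖v k‖ ^ 3 / t ^ 2 *
        (∫ ω, |X k ω| ^ 3 ∂μ + ∫ ω, |Y k ω| ^ 3 ∂μ')) := by
  induction T using Finset.induction_on with
  | empty => 
    simp only [Finset.sum_empty, Measure.map_const, measure_univ, one_smul]
    exact LipClose.refl _
  | insert a T ha ih =>
    obtain ⟨_, iX⟩ := IsCentredThird.map_sum cX v T
    obtain ⟨_, iY⟩ := IsCentredThird.map_sum cY v T
    obtain ⟨_, p3, p1, _, pv, pm, p2⟩ := (cX a).map_smul (v a)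
    obtain ⟨_, q3, q1, _, qv, qm, q2⟩ := (cY a).map_smul (v a)
    have iN := integrable_id_noise (E := E) t
    rw [map_sum_insert hX (fun k => (cX k).measurable) v ha,
      map_sum_insert hY (fun k => (cY k).measurable) v ha, Finset.sum_insert ha, add_comm]
    -- The intermediate law keeps `X a` and has every other coefficient replaced: `s1` is the
    -- induction hypothesis convolved with the term of `X a`, and `s2` exchanges that last term.
    have s1 := ih.conv_left pv (integrable_id_conv iX iN) (integrable_id_conv iY iN)
    have s2 := (lipClose_smul_conv_noise p3 q3 p1 q1 (by rw [p2, q2, hV]) (v a) ht).conv_left iY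
      (integrable_id_conv pv iN) (integrable_id_conv qv iN)
    rw [pm, qm] at s2
    rw [← Measure.conv_assoc] at s1
    refine s1.trans ?_
    rw [← Measure.conv_assoc, ← Measure.conv_assoc, Measure.conv_comm _ (Measure.map _ (μ.map _)),
      Measure.conv_comm _ (Measure.map _ (μ'.map _)), Measure.conv_assoc] at s2
    exact s2

variable {ι : Type*} [Fintype ι] [DecidableEq ι]

/-- The mean of ‖x‖² is the trace, and (E ‖x‖)² ≤ E ‖x‖². -/
theorem integral_norm_multivariateGaussian_le {S : Matrix ι ι ℝ} (hS : S.PosSemidef) :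
    ∫ x, ‖x‖ ∂multivariateGaussian 0 S ≤ √S.trace := by
  have h2 : MemLp (fun x => x) 2 (multivariateGaussian (0 : EuclideanSpace ℝ ι) S) :=
    IsGaussian.memLp_two_id
  have hn := h2.norm
  have hv := variance_nonneg (fun x => ‖x‖) (multivariateGaussian (0 : EuclideanSpace ℝ ι) S)
  rw [variance_eq_sub hn] at hv
  have hsq : ∫ x, ‖x‖ ^ 2 ∂multivariateGaussian (0 : EuclideanSpace ℝ ι) S = S.trace := by
    simp_rw [EuclideanSpace.norm_sq_eq, Real.norm_eq_abs, sq_abs]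
    have hi : ∀ i, MemLp (fun x : EuclideanSpace ℝ ι => x i) 2 (multivariateGaussian 0 S) :=
      fun i => (EuclideanSpace.proj (𝕜 := ℝ) i).comp_memLp' h2
    rw [integral_finsetSum _ fun i _ => (hi i).integrable_sq, Matrix.trace]
    refine Finset.sum_congr rfl fun i _ => ?_
    have := variance_eval_multivariateGaussian (μ := 0) hS i
    rw [variance_eq_sub (hi i)] at this
    have h0 : ∫ x, x i ∂multivariateGaussian (0 : EuclideanSpace ℝ ι) S = 0 := by
      have := (EuclideanSpace.proj (𝕜 := ℝ) i).integral_comp_comm (h2.integrable (by norm_num))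
      rw [integral_id_multivariateGaussian] at this
      simpa using this
    rw [h0] at this
    simpa using this
  apply Real.le_sqrt_of_sq_le
  simp only [Pi.pow_apply] at hv
  rw [hsq] at hv
  linarith

/-- The third absolute moment of the standard Gaussian law. -/
noncomputable def gaussThird : ℝ := ∫ x, |x| ^ 3 ∂gaussianReal 0 1

theorem gaussThird_nonneg : 0 ≤ gaussThird := integral_nonneg fun _ => by positivity

theorem gaussianReal_eq_map_sqrt (V : ℝ≥0) :
    gaussianReal 0 V = (gaussianReal 0 1).map (fun x => √V * x) := by
  rw [gaussianReal_map_const_mul, mul_zero]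
  congr 1
  ext
  simp

theorem integrable_abs_pow_gaussianReal (V : ℝ≥0) (k : ℕ) :
    Integrable (fun x => |x| ^ k) (gaussianReal 0 V) := by
  have := (memLp_id_gaussianReal (μ := 0) (v := V) k).integrable_norm_pow'
  simpa using this

theorem integral_abs_pow_three_gaussianReal (V : ℝ≥0) :
    ∫ x, |x| ^ 3 ∂gaussianReal 0 V = √V ^ 3 * gaussThird := by
  rw [gaussianReal_eq_map_sqrt, integral_map (by fun_prop) (by fun_prop), gaussThird,
    ← integral_const_mul]
  simp only [abs_mul, mul_pow, abs_of_nonneg (Real.sqrt_nonneg _)]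

/-- A sum of independent centred scalar multiples of fixed vectors is close to a Gaussian vector
with the same covariance. -/
theorem lipClose_sum_multivariateGaussian {κ : Type*} [Fintype κ] {Ω : Type*} [MeasurableSpace Ω]
    {μ : Measure Ω} [IsProbabilityMeasure μ] {X : κ → Ω → ℝ} (hX : iIndepFun X μ)
    (cX : ∀ k, IsCentredThird μ (X k)) (V : ℝ≥0) (hV : ∀ k, ∫ ω, X k ω ^ 2 ∂μ = V) {β : ℝ}
    (hβ : ∀ k, ∫ ω, |X k ω| ^ 3 ∂μ ≤ β) (v : κ → EuclideanSpace ℝ ι) {S : Matrix ι ι ℝ}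
    (hS : S.PosSemidef)
    (hq : ∀ x : EuclideanSpace ℝ ι, x ⬝ᵥ S.mulVec x = V * ∑ k, ⟪v k, x⟫ ^ 2)
    {t : ℝ} (ht : 0 < t) :
    LipClose (μ.map (fun ω => ∑ k, X k ω • v k)) (multivariateGaussian 0 S)
      (2 * t * √(Fintype.card ι) +
        taylorConst / t ^ 2 * (β + √V ^ 3 * gaussThird) * ∑ k, ‖v k‖ ^ 3) := by
  classical
  -- The replacing coefficients are independent Gaussians of variance `V` on a space of their own.
  -- By `hq`, their combination with the vectors `v k` has exactly the law with covariance `S`.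
  set μ' : Measure (κ → ℝ) := Measure.pi (fun _ => gaussianReal 0 V) with hμ'
  set Y : κ → (κ → ℝ) → ℝ := fun k ω => ω k with hYd
  have hY : iIndepFun Y μ' := iIndepFun_pi (X := fun _ x => x) (fun _ => by fun_prop)
  have mp : ∀ k, MeasurePreserving (Y k) μ' (gaussianReal 0 V) := fun k =>
    measurePreserving_eval _ k
  have cY : ∀ k, IsCentredThird μ' (Y k) := fun k =>
    ⟨(mp k).measurable, (mp k).integrable_comp_of_integrable (integrable_abs_pow_gaussianReal V 3), by
      rw [← integral_map (φ := Y k) (f := fun x => x) (mp k).measurable.aemeasurable (by fun_prop),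
        (mp k).map_eq, integral_id_gaussianReal]⟩
  have vY : ∀ k, ∫ ω, Y k ω ^ 2 ∂μ' = V := fun k => by
    rw [← integral_map (φ := Y k) (f := fun x => x ^ 2) (mp k).measurable.aemeasurable
      (by fun_prop), (mp k).map_eq]
    have h := variance_fun_id_gaussianReal (μ := 0) (v := V)
    have hL : MemLp (fun x : ℝ => x) 2 (gaussianReal 0 V) := memLp_id_gaussianReal 2
    rw [variance_eq_sub hL] at h
    simpa [integral_id_gaussianReal] using h
  have tY : ∀ k, ∫ ω, |Y k ω| ^ 3 ∂μ' = √V ^ 3 * gaussThird := fun k => by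
    rw [← integral_map (φ := Y k) (f := fun x => |x| ^ 3) (mp k).measurable.aemeasurable
      (by fun_prop), (mp k).map_eq, integral_abs_pow_three_gaussianReal]
  have mX : Measurable (fun ω => ∑ k, X k ω • v k) :=
    Finset.measurable_sum _ fun k _ => (cX k).measurable.smul_const _
  have mY : Measurable (fun ω => ∑ k, Y k ω • v k) :=
    Finset.measurable_sum _ fun k _ => (cY k).measurable.smul_const _
  have lawY : μ'.map (fun ω => ∑ k, Y k ω • v k) = multivariateGaussian 0 S := by
    have := Measure.isProbabilityMeasure_map (μ := μ') mY.aemeasurable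
    apply Measure.ext_of_charFun
    ext s
    have hY' : iIndepFun (fun k ω => Y k ω • v k) μ' :=
      hY.comp (fun k x => x • v k) (fun k => by fun_prop)
    have hm' : ∀ k, Measurable (fun ω => Y k ω • v k) := fun k =>
      (cY k).measurable.smul_const _
    rw [hY'.charFun_map_fun_sum_eq_prod (fun k => (hm' k).aemeasurable),
      charFun_multivariateGaussian hS, Finset.prod_apply]
    have e : ∀ k, charFun (μ'.map (fun ω => Y k ω • v k)) s =
        Complex.exp (-(V * ⟪v k, s⟫ ^ 2 / 2 : ℝ)) := fun k => by
      have : (fun ω => Y k ω • v k) = (fun x : ℝ => x • v k) ∘ Y k := rfl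
      rw [this, ← Measure.map_map (by fun_prop) (mp k).measurable, (mp k).map_eq,
        charFun_map_of_inner (r := ⟪v k, s⟫) _ (by fun_prop), charFun_gaussianReal]
      · congr 1
        push_cast
        ring
      · intro u
        simp only [inner_smul_left, conj_trivial]
        change _ = inner ℝ u ⟪v k, s⟫
        simp [mul_comm]
    simp_rw [e]
    rw [← Complex.exp_sum]
    congr 1
    have := hq s
    simp only [inner_zero_right, Complex.ofReal_zero, zero_mul, zero_sub]
    rw [this]
    push_cast
    rw [Finset.sum_neg_distrib, Finset.mul_sum, Finset.sum_div]
  have main := lipClose_sum_conv_noise hX hY cX cY (fun k => by rw [hV, vY]) v ht Finset.univ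
  have pX := Measure.isProbabilityMeasure_map (μ := μ) mX.aemeasurable
  have iX : Integrable id (μ.map (fun ω => ∑ k, X k ω • v k)) :=
    integrable_id_map mX.aemeasurable
      (integrable_finsetSum _ fun k _ => (cX k).integrable_self.smul_const _)
  have hnoise : ∫ x, ‖x‖ ∂noise (EuclideanSpace ℝ ι) t ≤ t * √(Fintype.card ι) := by
    refine (integral_norm_noise_le ht.le).trans ?_
    have h1 := integral_norm_multivariateGaussian_le (Matrix.PosSemidef.one (n := ι) (R := ℝ))
    rw [multivariateGaussian_zero_one] at h1
    simp only [Matrix.trace_one] at h1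
    gcongr
  rw [lawY] at main
  have a := LipClose.self_conv (integrable_id_noise t) iX hnoise
  have b := LipClose.self_conv (μ := multivariateGaussian 0 S) (integrable_id_noise t)
    IsGaussian.integrable_id hnoise
  -- The noise is inserted on one side and removed on the other; each operation costs t times the
  -- square root of the dimension.
  refine ((a.trans main).trans b.symm).mono ?_
  have hsum : ∑ k, taylorConst * ‖v k‖ ^ 3 / t ^ 2 *
        (∫ ω, |X k ω| ^ 3 ∂μ + ∫ ω, |Y k ω| ^ 3 ∂μ') ≤
      taylorConst / t ^ 2 * (β + √V ^ 3 * gaussThird) * ∑ k, ‖v k‖ ^ 3 := by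
    rw [Finset.mul_sum]
    refine Finset.sum_le_sum fun k _ => ?_
    have := taylorConst_pos
    rw [tY]
    calc _ ≤ taylorConst * ‖v k‖ ^ 3 / t ^ 2 * (β + √V ^ 3 * gaussThird) := by
          gcongr; exact hβ k
      _ = _ := by ring
  linarith

end Sums

/-! ### Covariances with independent rows, and comparison of Gaussian laws. -/

section Block

open scoped RealInnerProductSpace NNReal Matrix

variable {R : Type*} [Fintype R] [DecidableEq R] {s : ℕ}

theorem posSemidef_of_quadratic {ι : Type*} [Fintype ι] {A : Matrix ι ι ℝ} (hA : A.IsHermitian)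
    (h : ∀ x, 0 ≤ x ⬝ᵥ A *ᵥ x) : A.PosSemidef :=
  Matrix.PosSemidef.of_dotProduct_mulVec_nonneg hA fun x => by simpa using h x

theorem _root_.Matrix.PosSemidef.quadratic_nonneg {ι : Type*} [Fintype ι] {A : Matrix ι ι ℝ}
    (hA : A.PosSemidef) (x : ι → ℝ) : 0 ≤ x ⬝ᵥ A *ᵥ x := by
  simpa using hA.dotProduct_mulVec_nonneg x

/-- The covariance of independent copies, indexed by `R`, of a vector with covariance `Γ`. -/
def blockCov (R : Type*) [DecidableEq R] {s : ℕ} (Γ : Matrix (Fin s) (Fin s) ℝ) :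
    Matrix (R × Fin s) (R × Fin s) ℝ :=
  Matrix.of fun α β => if α.1 = β.1 then Γ α.2 β.2 else 0

theorem blockCov_quadratic (Γ : Matrix (Fin s) (Fin s) ℝ) (x : R × Fin s → ℝ) :
    x ⬝ᵥ blockCov R Γ *ᵥ x = ∑ i, (fun a => x (i, a)) ⬝ᵥ Γ *ᵥ (fun a => x (i, a)) := by
  simp only [dotProduct, Matrix.mulVec, blockCov, Matrix.of_apply, Fintype.sum_prod_type]
  refine Finset.sum_congr rfl fun i _ => Finset.sum_congr rfl fun a _ => ?_
  congr 1
  rw [Finset.sum_eq_single i]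
  · simp
  · intro j _ hj
    simp [hj.symm]
  · simp

theorem blockCov_posSemidef {Γ : Matrix (Fin s) (Fin s) ℝ} (hΓ : Γ.PosSemidef) :
    (blockCov R Γ).PosSemidef := by
  refine posSemidef_of_quadratic ?_ fun x => ?_
  · ext α β
    have := hΓ.isHermitian.apply α.2 β.2
    simp only [star_trivial] at this
    simp [blockCov, Matrix.conjTranspose_apply, eq_comm, this]
  · rw [blockCov_quadratic]
    exact Finset.sum_nonneg fun i _ => hΓ.quadratic_nonneg _

theorem blockCov_trace (Γ : Matrix (Fin s) (Fin s) ℝ) :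
    (blockCov R Γ).trace = Fintype.card R * Γ.trace := by
  simp [Matrix.trace, blockCov, Fintype.sum_prod_type]

omit [Fintype R] in
theorem blockCov_add (Γ Γ' : Matrix (Fin s) (Fin s) ℝ) :
    blockCov R (Γ + Γ') = blockCov R Γ + blockCov R Γ' := by
  ext α β
  by_cases h : α.1 = β.1 <;> simp [blockCov, h]

/-- The law of a family, indexed by `R`, of independent centred Gaussian vectors with
covariance `Γ`. -/
noncomputable def gaussLaw (R : Type*) [Fintype R] [DecidableEq R] {s : ℕ}
    (Γ : Matrix (Fin s) (Fin s) ℝ) : Measure (EuclideanSpace ℝ (R × Fin s)) :=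
  multivariateGaussian 0 (blockCov R Γ)

instance (Γ : Matrix (Fin s) (Fin s) ℝ) : IsGaussian (gaussLaw R Γ) := by
  unfold gaussLaw; infer_instance

theorem multivariateGaussian_conv {ι : Type*} [Fintype ι] [DecidableEq ι] {S S' : Matrix ι ι ℝ}
    (hS : S.PosSemidef) (hS' : S'.PosSemidef) :
    (multivariateGaussian 0 S).conv (multivariateGaussian 0 S') =
      multivariateGaussian 0 (S + S') := by
  apply Measure.ext_of_charFun
  ext x
  rw [charFun_conv, charFun_multivariateGaussian hS, charFun_multivariateGaussian hS',
    charFun_multivariateGaussian (hS.add hS'), ← Complex.exp_add]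
  congr 1
  simp only [inner_zero_right, Matrix.add_mulVec, dotProduct_add]
  push_cast
  ring

theorem integral_norm_gaussLaw_le {Γ : Matrix (Fin s) (Fin s) ℝ} (hΓ : Γ.PosSemidef) :
    ∫ x, ‖x‖ ∂gaussLaw R Γ ≤ √(Fintype.card R * Γ.trace) := by
  rw [← blockCov_trace]
  exact integral_norm_multivariateGaussian_le (blockCov_posSemidef hΓ)

/-- The sum of the absolute values of the entries of the difference of two matrices. -/
def covDist (A Γ : Matrix (Fin s) (Fin s) ℝ) : ℝ := ∑ a, ∑ b, |A a b - Γ a b|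

theorem covDist_nonneg (A Γ : Matrix (Fin s) (Fin s) ℝ) : 0 ≤ covDist A Γ :=
  Finset.sum_nonneg fun _ _ => Finset.sum_nonneg fun _ _ => abs_nonneg _

theorem abs_quadratic_sub_le (A Γ : Matrix (Fin s) (Fin s) ℝ) (x : Fin s → ℝ) :
    |x ⬝ᵥ (A - Γ) *ᵥ x| ≤ covDist A Γ * (x ⬝ᵥ x) := by
  have hx : ∀ a, |x a| ≤ √(x ⬝ᵥ x) := fun a => by
    apply Real.le_sqrt_of_sq_le
    rw [sq_abs, sq]
    exact Finset.single_le_sum (f := fun a => x a * x a) (fun a _ => mul_self_nonneg _)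
      (Finset.mem_univ a)
  have hxx : 0 ≤ x ⬝ᵥ x := Finset.sum_nonneg fun a _ => mul_self_nonneg _
  have e : x ⬝ᵥ x = √(x ⬝ᵥ x) * √(x ⬝ᵥ x) := (Real.mul_self_sqrt hxx).symm
  have e' : x ⬝ᵥ (A - Γ) *ᵥ x = ∑ a, ∑ b, x a * ((A a b - Γ a b) * x b) := by
    simp [dotProduct, Matrix.mulVec, Finset.mul_sum]
  rw [e', covDist, Finset.sum_mul]
  refine (Finset.abs_sum_le_sum_abs _ _).trans (Finset.sum_le_sum fun a _ => ?_)
  rw [Finset.sum_mul]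
  refine (Finset.abs_sum_le_sum_abs _ _).trans (Finset.sum_le_sum fun b _ => ?_)
  rw [abs_mul, abs_mul, e]
  calc |x a| * (|A a b - Γ a b| * |x b|) = |A a b - Γ a b| * (|x a| * |x b|) := by ring
    _ ≤ _ := by gcongr <;> exact hx _

/-- The Wasserstein-1 distance between Gaussian laws is controlled by the square root of the
distance between the covariances, without any nondegeneracy assumption. -/
theorem lipClose_gaussLaw {A Γ : Matrix (Fin s) (Fin s) ℝ} (hA : A.PosSemidef)
    (hΓ : Γ.PosSemidef) :
    LipClose (gaussLaw R A) (gaussLaw R Γ)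
      (2 * √(Fintype.card R * ((s + 1) * covDist A Γ))) := by
  set δ := covDist A Γ with hδ
  have hδ0 : 0 ≤ δ := covDist_nonneg _ _
  have hD1 : (δ • (1 : Matrix (Fin s) (Fin s) ℝ)).PosSemidef :=
    Matrix.PosSemidef.one.smul hδ0
  have hD2 : (A - Γ + δ • (1 : Matrix (Fin s) (Fin s) ℝ)).PosSemidef := by
    refine posSemidef_of_quadratic ((hA.isHermitian.sub hΓ.isHermitian).add hD1.isHermitian)
      fun x => ?_
    rw [Matrix.add_mulVec, dotProduct_add, Matrix.smul_mulVec, Matrix.one_mulVec,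
      dotProduct_smul, smul_eq_mul]
    have := (abs_le.1 (abs_quadratic_sub_le A Γ x)).1
    linarith
  have htr : (A - Γ).trace ≤ δ := by
    rw [Matrix.trace, hδ, covDist]
    refine Finset.sum_le_sum fun a _ => ?_
    refine (le_abs_self _).trans ?_
    exact Finset.single_le_sum (f := fun b => |A a b - Γ a b|) (fun b _ => abs_nonneg _)
      (Finset.mem_univ a)
  -- The quadratic form of A - Γ is at most δ in absolute value on unit vectors, so A + δ = Γ + (A -
  -- Γ + δ) expresses one Gaussian law in two ways, each with an additional independent part of
  -- trace at most (s + 1) δ per row.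
  have hconv : (gaussLaw R A).conv (gaussLaw R (δ • (1 : Matrix (Fin s) (Fin s) ℝ))) =
      (gaussLaw R Γ).conv (gaussLaw R (A - Γ + δ • (1 : Matrix (Fin s) (Fin s) ℝ))) := by
    unfold gaussLaw
    rw [multivariateGaussian_conv (blockCov_posSemidef hA) (blockCov_posSemidef hD1),
      multivariateGaussian_conv (blockCov_posSemidef hΓ) (blockCov_posSemidef hD2),
      ← blockCov_add, ← blockCov_add]
    congr 2
    abel
  have b1 : ∫ x, ‖x‖ ∂gaussLaw R (δ • (1 : Matrix (Fin s) (Fin s) ℝ)) ≤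
      √(Fintype.card R * ((s + 1) * δ)) := by
    refine (integral_norm_gaussLaw_le hD1).trans (Real.sqrt_le_sqrt ?_)
    gcongr
    rw [Matrix.trace_smul, Matrix.trace_one, Fintype.card_fin, smul_eq_mul]
    nlinarith
  have b2 : ∫ x, ‖x‖ ∂gaussLaw R (A - Γ + δ • (1 : Matrix (Fin s) (Fin s) ℝ)) ≤
      √(Fintype.card R * ((s + 1) * δ)) := by
    refine (integral_norm_gaussLaw_le hD2).trans (Real.sqrt_le_sqrt ?_)
    gcongr
    rw [Matrix.trace_add, Matrix.trace_smul, Matrix.trace_one, Fintype.card_fin, smul_eq_mul]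
    nlinarith
  have l1 := LipClose.self_conv (μ := gaussLaw R A) IsGaussian.integrable_id
    IsGaussian.integrable_id b1
  have l2 := LipClose.self_conv (μ := gaussLaw R Γ) IsGaussian.integrable_id
    IsGaussian.integrable_id b2
  rw [hconv] at l1
  exact (l1.trans l2.symm).mono (by rw [two_mul])

/-- The covariance, given the values `y` of the previous layer, of the next layer. -/
def empCov {n : ℕ} (V : ℝ) (y : Fin n → Fin s → ℝ) : Matrix (Fin s) (Fin s) ℝ :=
  Matrix.of fun a b => V * ∑ j, y j a * y j b

theorem empCov_quadratic {n : ℕ} (V : ℝ) (y : Fin n → Fin s → ℝ) (x : Fin s → ℝ) :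
    x ⬝ᵥ empCov V y *ᵥ x = V * ∑ j, (∑ a, y j a * x a) ^ 2 := by
  simp only [dotProduct, Matrix.mulVec, empCov, Matrix.of_apply, Finset.mul_sum, sq,
    Finset.sum_mul]
  rw [Finset.sum_congr rfl fun a _ => Finset.sum_comm, Finset.sum_comm]
  refine Finset.sum_congr rfl fun j _ => Finset.sum_congr rfl fun a _ =>
    Finset.sum_congr rfl fun b _ => ?_
  ring

theorem empCov_posSemidef {n : ℕ} {V : ℝ} (hV : 0 ≤ V) (y : Fin n → Fin s → ℝ) :
    (empCov V y).PosSemidef := by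
  refine posSemidef_of_quadratic ?_ fun x => ?_
  · ext a b
    simp [empCov, Matrix.conjTranspose_apply, mul_comm]
  · rw [empCov_quadratic]
    positivity

/-- The rows of a layer with weights `w` if the previous layer has the values `y`. -/
noncomputable def layer {n : ℕ} (w : R × Fin n → ℝ) (y : Fin n → Fin s → ℝ) :
    EuclideanSpace ℝ (R × Fin s) :=
  WithLp.toLp 2 fun α => ∑ j, w (α.1, j) * y j α.2

/-- The contribution of the weight `k` to the next layer. -/
noncomputable def layerDir {n : ℕ} (y : Fin n → Fin s → ℝ) (k : R × Fin n) :
    EuclideanSpace ℝ (R × Fin s) :=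
  WithLp.toLp 2 fun α => if α.1 = k.1 then y k.2 α.2 else 0

/-- This puts a layer in the form of the Lindeberg argument: one scalar coefficient per weight, with
the activations fixed in the vectors. -/
theorem layer_eq_sum {n : ℕ} (w : R × Fin n → ℝ) (y : Fin n → Fin s → ℝ) :
    layer w y = ∑ k, w k • layerDir y k := by
  ext α
  simp [layer, layerDir, Fintype.sum_prod_type]

theorem inner_layerDir {n : ℕ} (y : Fin n → Fin s → ℝ) (k : R × Fin n)
    (x : EuclideanSpace ℝ (R × Fin s)) : ⟪layerDir y k, x⟫ = ∑ a, y k.2 a * x (k.1, a) := by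
  simp [layerDir, PiLp.inner_apply, Fintype.sum_prod_type, mul_comm]

theorem norm_layerDir {n : ℕ} (y : Fin n → Fin s → ℝ) (k : R × Fin n) :
    ‖layerDir y k‖ = √(∑ a, y k.2 a ^ 2) := by
  rw [EuclideanSpace.norm_eq]
  congr 1
  simp [layerDir, Fintype.sum_prod_type, apply_ite]

theorem layer_quadratic {n : ℕ} (V : ℝ) (y : Fin n → Fin s → ℝ)
    (x : EuclideanSpace ℝ (R × Fin s)) :
    x ⬝ᵥ (blockCov R (empCov V y)).mulVec x = V * ∑ k, ⟪layerDir y k, x⟫ ^ 2 := by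
  rw [blockCov_quadratic]
  simp only [empCov_quadratic, inner_layerDir, Fintype.sum_prod_type, Finset.mul_sum]

/-- A layer with independent weights is, given the previous layer, close to a Gaussian law with
any covariance close to the conditional covariance. -/
theorem lipClose_layer {n : ℕ} {Ω : Type*} [MeasurableSpace Ω]
    {μ : Measure Ω} [IsProbabilityMeasure μ] {X : R × Fin n → Ω → ℝ} (hX : iIndepFun X μ)
    (cX : ∀ k, IsCentredThird μ (X k)) (V : ℝ≥0) (hV : ∀ k, ∫ ω, X k ω ^ 2 ∂μ = V) {β : ℝ}
    (hβ : ∀ k, ∫ ω, |X k ω| ^ 3 ∂μ ≤ β) (y : Fin n → Fin s → ℝ)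
    {Γ : Matrix (Fin s) (Fin s) ℝ} (hΓ : Γ.PosSemidef) {t : ℝ} (ht : 0 < t) :
    LipClose (μ.map (fun ω => layer (fun k => X k ω) y)) (gaussLaw R Γ)
      (2 * t * √(Fintype.card R * s) +
        taylorConst / t ^ 2 * (β + √V ^ 3 * gaussThird) *
          (Fintype.card R * ∑ j, √(∑ a, y j a ^ 2) ^ 3) +
        2 * √(Fintype.card R * ((s + 1) * covDist (empCov V y) Γ))) := by
  have h1 := lipClose_sum_multivariateGaussian hX cX V hV hβ (layerDir y)
    (blockCov_posSemidef (empCov_posSemidef V.2 y)) (layer_quadratic (V : ℝ) y) ht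
  simp only [layer_eq_sum]
  refine (h1.trans (lipClose_gaussLaw (empCov_posSemidef V.2 y) hΓ)).mono (le_of_eq ?_)
  simp [norm_layerDir, Fintype.sum_prod_type]

end Block

/-! ### The conditional central limit theorem for a layer, with the noise level optimized. -/

section FixedInput

open scoped NNReal Matrix

variable {s : ℕ}

/-- The average over the neurons of the sum of the fourth powers of their values. -/
noncomputable def fourthAvg {n : ℕ} (y : Fin n → Fin s → ℝ) : ℝ :=
  (n : ℝ)⁻¹ * ∑ j, ∑ a, y j a ^ 4

theorem fourthAvg_nonneg {n : ℕ} (y : Fin n → Fin s → ℝ) : 0 ≤ fourthAvg y := by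
  unfold fourthAvg; positivity

/-- From u³ ≤ 1 + u⁴ and Cauchy–Schwarz over the s inputs. Fourth powers are the only statistic of
y, besides its covariance, carried through the layers. -/
theorem sum_sqrt_pow_three_le {n : ℕ} (hn : 0 < n) (y : Fin n → Fin s → ℝ) :
    ∑ j, √(∑ a, y j a ^ 2) ^ 3 ≤ n * ((1 + s) * (1 + fourthAvg y)) := by
  have h1 : ∀ j, √(∑ a, y j a ^ 2) ^ 3 ≤ 1 + s * ∑ a, y j a ^ 4 := fun j => by
    set u := √(∑ a, y j a ^ 2) with hu
    have hu0 : 0 ≤ u := Real.sqrt_nonneg _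
    have hu2 : u ^ 2 = ∑ a, y j a ^ 2 := Real.sq_sqrt (by positivity)
    have h4 : u ^ 4 ≤ s * ∑ a, y j a ^ 4 := by
      have := sq_sum_le_card_mul_sum_sq (s := Finset.univ) (f := fun a => y j a ^ 2)
      rw [← hu2] at this
      simpa [← pow_mul] using this
    nlinarith [sq_nonneg (u ^ 2 - u), sq_nonneg (u - 1), sq_nonneg (u ^ 2 - 1)]
  have hn' : (n : ℝ) ≠ 0 := by positivity
  have hq : ∑ j, ∑ a, y j a ^ 4 = n * fourthAvg y := by
    unfold fourthAvg; field_simp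
  have hq0 := fourthAvg_nonneg y
  calc _ ≤ ∑ j, (1 + s * ∑ a, y j a ^ 4) := Finset.sum_le_sum fun j _ => h1 j
    _ = n * (1 + s * fourthAvg y) := by
      rw [Finset.sum_add_distrib, ← Finset.mul_sum, hq]; simp; ring
    _ ≤ _ := by gcongr; nlinarith [mul_nonneg (Nat.cast_nonneg (α := ℝ) s) hq0]

/-- The constant in the conditional central limit theorem for a layer. -/
noncomputable def layerConst (s : ℕ) (c₃ : ℝ) : ℝ :=
  2 * √s + taylorConst * (c₃ + √(1 + c₃) ^ 3 * gaussThird) * (1 + s) + 2 * √(s + 1)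

theorem layerConst_pos (s : ℕ) {c₃ : ℝ} (h : 0 ≤ c₃) : 0 < layerConst s c₃ := by
  have := taylorConst_pos
  have := gaussThird_nonneg
  have : 0 < √((s : ℝ) + 1) := Real.sqrt_pos.2 (by positivity)
  unfold layerConst
  positivity

/-- Weights with the normalization of a layer with `n` inputs: independent, centred, with
common variance `V`, and with third absolute moments of order `n ^ (-3/2)`. -/
structure IsThirdWeights {κ : Type*} {Ω : Type*} [MeasurableSpace Ω] (μ : Measure Ω)
    (X : κ → Ω → ℝ) (n : ℕ) (V : ℝ≥0) (c₃ : ℝ) : Prop where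
  indep : iIndepFun X μ
  centred : ∀ k, IsCentredThird μ (X k)
  sq_eq : ∀ k, ∫ ω, X k ω ^ 2 ∂μ = V
  third_le : ∀ k, ∫ ω, |X k ω| ^ 3 ∂μ ≤ c₃ * (n : ℝ) ^ (-(3 / 2) : ℝ)

/-- Apply z² ≤ 1 + z³ to z = √n |X|. The variances are not among the data on which the final
constant may depend, so they are bounded by moments. -/
theorem variance_le_of_third {Ω : Type*} [MeasurableSpace Ω] {μ : Measure Ω}
    [IsProbabilityMeasure μ] {X : Ω → ℝ} (cX : IsCentredThird μ X) {n : ℕ} (hn : 0 < n) {c₃ : ℝ}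
    (h3 : ∫ ω, |X ω| ^ 3 ∂μ ≤ c₃ * (n : ℝ) ^ (-(3 / 2) : ℝ)) :
    ∫ ω, X ω ^ 2 ∂μ ≤ (1 + c₃) / n := by
  have hn' : (0 : ℝ) < n := by positivity
  set b : ℝ := √n with hb
  have hb0 : 0 < b := Real.sqrt_pos.2 hn'
  have hb2 : b ^ 2 = n := Real.sq_sqrt hn'.le
  have hb3 : (n : ℝ) ^ (-(3 / 2) : ℝ) = (b ^ 3)⁻¹ := by
    rw [hb, Real.sqrt_eq_rpow, ← Real.rpow_natCast, ← Real.rpow_mul hn'.le, Real.rpow_neg hn'.le]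
    norm_num
  have hle : ∀ ω, X ω ^ 2 ≤ (b ^ 2)⁻¹ * (1 + b ^ 3 * |X ω| ^ 3) := fun ω => by
    rw [le_inv_mul_iff₀ (by positivity), ← sq_abs (X ω)]
    have : 0 ≤ b * |X ω| := by positivity
    set z := b * |X ω|
    have e1 : b ^ 2 * |X ω| ^ 2 = z ^ 2 := by ring
    have e2 : b ^ 3 * |X ω| ^ 3 = z ^ 3 := by ring
    rw [e1, e2]
    nlinarith [mul_nonneg this (sq_nonneg (z - 1)), sq_nonneg (z - 1)]
  calc ∫ ω, X ω ^ 2 ∂μ ≤ ∫ ω, (b ^ 2)⁻¹ * (1 + b ^ 3 * |X ω| ^ 3) ∂μ := by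
        refine integral_mono_of_nonneg (Filter.Eventually.of_forall fun ω => by positivity)
          (((integrable_const 1).add (cX.integrable.const_mul _)).const_mul _)
          (Filter.Eventually.of_forall hle)
    _ = (b ^ 2)⁻¹ * (1 + b ^ 3 * ∫ ω, |X ω| ^ 3 ∂μ) := by
        rw [integral_const_mul, integral_add (integrable_const _) (cX.integrable.const_mul _),
          integral_const_mul]
        simp
    _ ≤ (b ^ 2)⁻¹ * (1 + b ^ 3 * (c₃ * (b ^ 3)⁻¹)) := by rw [hb3] at h3; gcongr
    _ = (1 + c₃) / n := by rw [← hb2]; field_simp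

theorem lipClose_layer_le {R : Type*} [Fintype R] [DecidableEq R] [Nonempty R] {n : ℕ} (hn : 0 < n)
    {Ω : Type*} [MeasurableSpace Ω] {μ : Measure Ω} [IsProbabilityMeasure μ]
    {X : R × Fin n → Ω → ℝ} {V : ℝ≥0} {c₃ : ℝ} (hc₃ : 0 ≤ c₃) (hX : IsThirdWeights μ X n V c₃)
    (y : Fin n → Fin s → ℝ) {Γ : Matrix (Fin s) (Fin s) ℝ} (hΓ : Γ.PosSemidef) :
    LipClose (μ.map (fun ω => layer (fun k => X k ω) y)) (gaussLaw R Γ)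
      (layerConst s c₃ * (Fintype.card R : ℝ) ^ (2 / 3 : ℝ) *
        ((n : ℝ) ^ (-(1 / 6) : ℝ) * (1 + fourthAvg y) + √(covDist (empCov V y) Γ))) := by
  have hn' : (0 : ℝ) < n := by positivity
  set M : ℝ := (Fintype.card R : ℝ) with hM
  have hM1 : 1 ≤ M := by
    rw [hM]; exact_mod_cast Fintype.card_pos
  have hM0 : 0 < M := by linarith
  set a : ℝ := M ^ (1 / 6 : ℝ) with ha
  set b : ℝ := (n : ℝ) ^ (-(1 / 6) : ℝ) with hb
  have ha1 : 1 ≤ a := Real.one_le_rpow hM1 (by norm_num)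
  have hb0 : 0 < b := Real.rpow_pos_of_pos hn' _
  have ha6 : M = a ^ 6 := by
    rw [ha, ← Real.rpow_natCast, ← Real.rpow_mul hM0.le]; norm_num
  have ha4 : M ^ (2 / 3 : ℝ) = a ^ 4 := by
    rw [ha, ← Real.rpow_natCast, ← Real.rpow_mul hM0.le]; norm_num
  have hb6 : (n : ℝ) = (b ^ 6)⁻¹ := by
    rw [hb, ← Real.rpow_natCast, ← Real.rpow_mul hn'.le, ← Real.rpow_neg hn'.le]; norm_num
  have hb9 : (n : ℝ) ^ (-(3 / 2) : ℝ) = b ^ 9 := by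
    rw [hb, ← Real.rpow_natCast, ← Real.rpow_mul hn'.le]; norm_num
  obtain ⟨i₀⟩ := ‹Nonempty R›
  have hV : (V : ℝ) ≤ (1 + c₃) * (b ^ 3) ^ 2 := by
    have := variance_le_of_third (hX.centred (i₀, ⟨0, hn⟩)) hn (hX.third_le _)
    rw [hX.sq_eq, hb6] at this
    calc (V : ℝ) ≤ _ := this
      _ = _ := by field_simp
  have hsV : √V ≤ √(1 + c₃) * b ^ 3 := by
    calc √V ≤ √((1 + c₃) * (b ^ 3) ^ 2) := Real.sqrt_le_sqrt hV
      _ = _ := by rw [Real.sqrt_mul (by positivity), Real.sqrt_sq (by positivity)]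
  have hsV3 : √V ^ 3 ≤ √(1 + c₃) ^ 3 * b ^ 9 := by
    calc √V ^ 3 ≤ (√(1 + c₃) * b ^ 3) ^ 3 := by gcongr
      _ = _ := by ring
  have hq := fourthAvg_nonneg y
  have hT := taylorConst_pos
  have hG := gaussThird_nonneg
  have hsqM : √M = a ^ 3 := by
    rw [ha6, show a ^ 6 = (a ^ 3) ^ 2 by ring, Real.sqrt_sq (by positivity)]
  -- The smoothing costs t M^(1/2) and the replacement t⁻² n^(-3/2) · M n, up to constants; at t =
  -- M^(1/6) n^(-1/6) both equal M^(2/3) n^(-1/6).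
  have main := lipClose_layer hX.indep hX.centred V hX.sq_eq hX.third_le y hΓ
    (t := a * b) (by positivity)
  refine main.mono ?_
  rw [← hM, ha4, hb9]
  set q := fourthAvg y
  set δ := covDist (empCov V y) Γ
  have hδ : 0 ≤ δ := covDist_nonneg _ _
  have t1 : 2 * (a * b) * √(M * s) ≤ a ^ 4 * (2 * √s) * (b * (1 + q)) := by
    rw [Real.sqrt_mul hM0.le, hsqM]
    have : 0 ≤ a ^ 4 * (2 * √s) * b * q := by positivity
    nlinarith
  have t2 : taylorConst / (a * b) ^ 2 * (c₃ * b ^ 9 + √V ^ 3 * gaussThird) *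
      (M * ∑ j, √(∑ a, y j a ^ 2) ^ 3) ≤
      a ^ 4 * (taylorConst * (c₃ + √(1 + c₃) ^ 3 * gaussThird) * (1 + s)) * (b * (1 + q)) := by
    calc _ ≤ taylorConst / (a * b) ^ 2 * (c₃ * b ^ 9 + (√(1 + c₃) ^ 3 * b ^ 9) * gaussThird) *
          (a ^ 6 * ((b ^ 6)⁻¹ * ((1 + s) * (1 + q)))) := by
          have h3 := sum_sqrt_pow_three_le hn y
          rw [hb6] at h3
          rw [ha6]
          gcongr
      _ = _ := by field_simp
  have t3 : 2 * √(M * ((s + 1) * δ)) ≤ a ^ 4 * (2 * √(s + 1)) * √δ := by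
    rw [Real.sqrt_mul hM0.le, hsqM, Real.sqrt_mul (by positivity)]
    have h34 : a ^ 3 ≤ a ^ 4 := pow_le_pow_right₀ ha1 (by norm_num)
    calc _ = a ^ 3 * (2 * √(s + 1) * √δ) := by ring
      _ ≤ a ^ 4 * (2 * √(s + 1) * √δ) := by gcongr
      _ = _ := by ring
  have p1 : 0 ≤ a ^ 4 * (2 * √s) * √δ := by positivity
  have p2 : 0 ≤ a ^ 4 * (taylorConst * (c₃ + √(1 + c₃) ^ 3 * gaussThird) * (1 + s)) * √δ := by
    positivity
  have p3 : 0 ≤ a ^ 4 * (2 * √(s + 1)) * (b * (1 + q)) := by positivity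
  unfold layerConst
  linarith

end FixedInput

/-! ### Fourth moments of independent sums and concentration of averages. -/

section FourthMoments

open scoped NNReal Matrix

variable {Ω : Type*} [MeasurableSpace Ω] {μ : Measure Ω} [IsProbabilityMeasure μ]

theorem abs_pow_le_one_add_pow_four (x : ℝ) {k : ℕ} (hk : k ≤ 4) : |x| ^ k ≤ 1 + x ^ 4 := by
  have e : x ^ 4 = |x| ^ 4 := by rw [← abs_pow, abs_of_nonneg (by positivity)]
  rw [e]
  rcases le_total |x| 1 with h | h
  · have := pow_le_one₀ (n := k) (abs_nonneg x) h
    have : 0 ≤ |x| ^ 4 := by positivity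
    linarith
  · have := pow_le_pow_right₀ h hk
    linarith

theorem integrable_pow_of_four {X : Ω → ℝ} (hm : Measurable X)
    (hi : Integrable (fun ω => X ω ^ 4) μ) {k : ℕ} (hk : k ≤ 4) :
    Integrable (fun ω => X ω ^ k) μ :=
  Integrable.mono' ((integrable_const 1).add hi) (by fun_prop) (Filter.Eventually.of_forall fun ω => by
    simpa using abs_pow_le_one_add_pow_four (X ω) hk)

/-- The mixed terms containing a first power factor through a zero mean, so only the term with both
squares survives. -/
theorem moments_add_of_indep {Z S : Ω → ℝ} (hZS : IndepFun Z S μ) (mZ : Measurable Z)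
    (mS : Measurable S) (iZ : Integrable (fun ω => Z ω ^ 4) μ)
    (iS : Integrable (fun ω => S ω ^ 4) μ) (zZ : ∫ ω, Z ω ∂μ = 0) (zS : ∫ ω, S ω ∂μ = 0) :
    Integrable (fun ω => (Z ω + S ω) ^ 4) μ ∧ ∫ ω, (Z ω + S ω) ∂μ = 0 ∧
      ∫ ω, (Z ω + S ω) ^ 2 ∂μ = ∫ ω, Z ω ^ 2 ∂μ + ∫ ω, S ω ^ 2 ∂μ ∧
      ∫ ω, (Z ω + S ω) ^ 4 ∂μ =
        ∫ ω, Z ω ^ 4 ∂μ + 6 * ((∫ ω, Z ω ^ 2 ∂μ) * ∫ ω, S ω ^ 2 ∂μ) + ∫ ω, S ω ^ 4 ∂μ := by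
  have pZ : ∀ k ≤ 4, Integrable (fun ω => Z ω ^ k) μ := fun k hk => integrable_pow_of_four mZ iZ hk
  have pS : ∀ k ≤ 4, Integrable (fun ω => S ω ^ k) μ := fun k hk => integrable_pow_of_four mS iS hk
  have hij : ∀ i j, IndepFun (fun ω => Z ω ^ i) (fun ω => S ω ^ j) μ := fun i j =>
    hZS.comp (φ := fun x => x ^ i) (ψ := fun x => x ^ j) (by fun_prop) (by fun_prop)
  have im : ∀ i ≤ 4, ∀ j ≤ 4, Integrable (fun ω => Z ω ^ i * S ω ^ j) μ := fun i hi j hj =>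
    (hij i j).integrable_mul (pZ i hi) (pS j hj)
  have em : ∀ i j, ∫ ω, Z ω ^ i * S ω ^ j ∂μ = (∫ ω, Z ω ^ i ∂μ) * ∫ ω, S ω ^ j ∂μ := fun i j =>
    (hij i j).integral_fun_mul_eq_mul_integral (by fun_prop) (by fun_prop)
  have z1 : ∫ ω, Z ω ^ 1 ∂μ = 0 := by simpa using zZ
  have s1 : ∫ ω, S ω ^ 1 ∂μ = 0 := by simpa using zS
  have e4 : ∀ ω, (Z ω + S ω) ^ 4 = Z ω ^ 4 + 4 * (Z ω ^ 3 * S ω ^ 1) + 6 * (Z ω ^ 2 * S ω ^ 2) +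
      4 * (Z ω ^ 1 * S ω ^ 3) + S ω ^ 4 := fun ω => by ring
  have e2 : ∀ ω, (Z ω + S ω) ^ 2 = Z ω ^ 2 + 2 * (Z ω ^ 1 * S ω ^ 1) + S ω ^ 2 := fun ω => by ring
  have i31 := (im 3 (by norm_num) 1 (by norm_num)).const_mul 4
  have i22 := (im 2 (by norm_num) 2 (by norm_num)).const_mul 6
  have i13 := (im 1 (by norm_num) 3 (by norm_num)).const_mul 4
  have i11 := (im 1 (by norm_num) 1 (by norm_num)).const_mul 2
  have a1 : Integrable (fun ω => Z ω ^ 4 + 4 * (Z ω ^ 3 * S ω ^ 1)) μ := iZ.add i31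
  have a2 : Integrable (fun ω => Z ω ^ 4 + 4 * (Z ω ^ 3 * S ω ^ 1) + 6 * (Z ω ^ 2 * S ω ^ 2)) μ :=
    a1.add i22
  have a3 : Integrable (fun ω => Z ω ^ 4 + 4 * (Z ω ^ 3 * S ω ^ 1) + 6 * (Z ω ^ 2 * S ω ^ 2) +
      4 * (Z ω ^ 1 * S ω ^ 3)) μ := a2.add i13
  have b1 : Integrable (fun ω => Z ω ^ 2 + 2 * (Z ω ^ 1 * S ω ^ 1)) μ :=
    (pZ 2 (by norm_num)).add i11
  refine ⟨?_, ?_, ?_, ?_⟩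
  · simp_rw [e4]
    exact a3.add iS
  · have h1 := pZ 1 (by norm_num)
    have h2 := pS 1 (by norm_num)
    simp only [pow_one] at h1 h2
    rw [integral_add h1 h2, zZ, zS, add_zero]
  · simp_rw [e2]
    rw [integral_add b1 (pS 2 (by norm_num)), integral_add (pZ 2 (by norm_num)) i11,
      integral_const_mul, em, z1]
    ring
  · simp_rw [e4]
    rw [integral_add a3 iS, integral_add a2 i13, integral_add a1 i22, integral_add iZ i31,
      integral_const_mul, integral_const_mul, integral_const_mul, em, em, em, z1, s1]
    ring

/-- The fourth moment of a linear combination of independent centred variables. -/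
theorem fourth_moment_sum_le {κ : Type*} [DecidableEq κ] {X : κ → Ω → ℝ} (hX : iIndepFun X μ)
    (mX : ∀ k, Measurable (X k)) (iX : ∀ k, Integrable (fun ω => X k ω ^ 4) μ)
    (zX : ∀ k, ∫ ω, X k ω ∂μ = 0) {V Q : ℝ} (vX : ∀ k, ∫ ω, X k ω ^ 2 ∂μ = V)
    (qX : ∀ k, ∫ ω, X k ω ^ 4 ∂μ ≤ Q) (u : κ → ℝ) (T : Finset κ) :
    Integrable (fun ω => (∑ k ∈ T, X k ω * u k) ^ 4) μ ∧
      ∫ ω, ∑ k ∈ T, X k ω * u k ∂μ = 0 ∧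
      ∫ ω, (∑ k ∈ T, X k ω * u k) ^ 2 ∂μ = V * ∑ k ∈ T, u k ^ 2 ∧
      ∫ ω, (∑ k ∈ T, X k ω * u k) ^ 4 ∂μ ≤ 3 * Q * (∑ k ∈ T, u k ^ 2) ^ 2 := by
  induction T using Finset.induction_on with
  | empty => simp
  | insert a T ha ih =>
    obtain ⟨i4, z, e2, l4⟩ := ih
    have hi' : iIndepFun (fun k ω => X k ω * u k) μ :=
      hX.comp (fun k x => x * u k) (fun k => by fun_prop)
    have hm' : ∀ k, Measurable (fun ω => X k ω * u k) := fun k => (mX k).mul_const _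
    have hind := (hi'.indepFun_finsetSum_of_notMem hm' ha).symm
    have hs : (∑ j ∈ T, fun ω => X j ω * u j) = fun ω => ∑ j ∈ T, X j ω * u j := by
      ext1 ω; exact Finset.sum_apply _ _ _
    rw [hs] at hind
    have hiZ : Integrable (fun ω => (X a ω * u a) ^ 4) μ := by
      simp_rw [mul_pow]; exact (iX a).mul_const _
    obtain ⟨j1, j2, j3, j4⟩ := moments_add_of_indep hind (hm' a)
      (Finset.measurable_sum T fun k _ => hm' k) hiZ i4
      (by rw [integral_mul_const, zX, zero_mul]) z
    simp_rw [Finset.sum_insert ha]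
    have k2 : ∫ ω, (X a ω * u a) ^ 2 ∂μ = V * u a ^ 2 := by
      simp_rw [mul_pow]; rw [integral_mul_const, vX]
    have k4 : ∫ ω, (X a ω * u a) ^ 4 ∂μ = (∫ ω, X a ω ^ 4 ∂μ) * u a ^ 4 := by
      simp_rw [mul_pow]; rw [integral_mul_const]
    refine ⟨j1, j2, by rw [j3, k2, e2]; ring, ?_⟩
    -- With V² ≤ Q the mixed term 6 V² u² σ fits into the expansion of 3 Q (u² + σ)².
    have hQ : V ^ 2 ≤ Q := by
      have hL : MemLp (fun ω => X a ω ^ 2) 2 μ := by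
        rw [memLp_two_iff_integrable_sq (by have := mX a; fun_prop)]
        simpa [← pow_mul] using iX a
      have := variance_nonneg (fun ω => X a ω ^ 2) μ
      rw [variance_eq_sub hL] at this
      simp only [Pi.pow_apply, ← pow_mul, vX] at this
      have := qX a
      norm_num at *
      linarith
    rw [j4, k2, k4, e2]
    set σ := ∑ k ∈ T, u k ^ 2 with hσ
    have hσ0 : 0 ≤ σ := Finset.sum_nonneg fun _ _ => sq_nonneg _
    have hQ0 : 0 ≤ Q := (sq_nonneg V).trans hQ
    have h4 : (∫ ω, X a ω ^ 4 ∂μ) * u a ^ 4 ≤ Q * u a ^ 4 := by gcongr; exact qX a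
    have h5 : V ^ 2 * (u a ^ 2 * σ) ≤ Q * (u a ^ 2 * σ) := by gcongr
    have h6 : 0 ≤ Q * u a ^ 4 := by positivity
    nlinarith

/-- If the means of independent variables are close to `g`, then so is their average. -/
theorem integral_abs_avg_sub_le {m : ℕ} (hm : 0 < m) {h : Fin m → Ω → ℝ}
    (hind : Pairwise fun k l => IndepFun (h k) (h l) μ) (hL : ∀ k, MemLp (h k) 2 μ) {g e H : ℝ}
    (he : ∀ k, |∫ ω, h k ω ∂μ - g| ≤ e) (hH : ∀ k, ∫ ω, h k ω ^ 2 ∂μ ≤ H) :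
    ∫ ω, |(m : ℝ)⁻¹ * ∑ k, h k ω - g| ∂μ ≤ (m : ℝ) ^ (-(1 / 2) : ℝ) * (1 + H) + e := by
  have hm' : (0 : ℝ) < m := by positivity
  set r := √(m : ℝ) with hr
  have hr0 : 0 < r := Real.sqrt_pos.2 hm'
  have hr2 : r ^ 2 = m := Real.sq_sqrt hm'.le
  have hpow : (m : ℝ) ^ (-(1 / 2) : ℝ) = r⁻¹ := by
    rw [hr, Real.sqrt_eq_rpow, Real.rpow_neg hm'.le]
  have i1 : ∀ k, Integrable (h k) μ := fun k => (hL k).integrable (by norm_num)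
  set S : Ω → ℝ := fun ω => ∑ k, h k ω with hS
  have hSL : MemLp S 2 μ := memLp_finsetSum _ fun k _ => hL k
  have hSi : Integrable S μ := hSL.integrable (by norm_num)
  set M := ∫ ω, S ω ∂μ with hM
  have hMe : M = ∑ k, ∫ ω, h k ω ∂μ := integral_finsetSum _ fun k _ => i1 k
  have hvar : ∫ ω, (S ω - M) ^ 2 ∂μ ≤ m * H := by
    have hv := IndepFun.variance_sum (s := Finset.univ) (fun k _ => hL k)
      (fun k _ l _ hkl => hind hkl)
    have hSe : (∑ k, h k) = S := by ext1 ω; simp [hS]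
    rw [hSe, variance_eq_integral hSL.aestronglyMeasurable.aemeasurable] at hv
    rw [hv]
    calc ∑ k, Var[h k; μ] ≤ ∑ _k : Fin m, H := by
          refine Finset.sum_le_sum fun k _ => ?_
          exact (variance_le_expectation_sq (hL k).aestronglyMeasurable).trans (hH k)
      _ = m * H := by simp
  have hmean : |(m : ℝ)⁻¹ * M - g| ≤ e := by
    have : (m : ℝ)⁻¹ * M - g = (m : ℝ)⁻¹ * ∑ k, (∫ ω, h k ω ∂μ - g) := by
      rw [hMe, Finset.sum_sub_distrib]; simp; field_simp
    rw [this, abs_mul, abs_of_pos (by positivity)]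
    calc _ ≤ (m : ℝ)⁻¹ * ∑ _k : Fin m, e := by
          gcongr
          exact (Finset.abs_sum_le_sum_abs _ _).trans (Finset.sum_le_sum fun k _ => he k)
      _ = e := by simp; field_simp
  have hpt : ∀ ω, |(m : ℝ)⁻¹ * S ω - g| ≤ (r⁻¹ + (r * m)⁻¹ * (S ω - M) ^ 2) + e := fun ω => by
    have h1 : |(m : ℝ)⁻¹ * S ω - g| ≤ |(m : ℝ)⁻¹ * (S ω - M)| + |(m : ℝ)⁻¹ * M - g| := by
      have := abs_add_le ((m : ℝ)⁻¹ * (S ω - M)) ((m : ℝ)⁻¹ * M - g)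
      have e : (m : ℝ)⁻¹ * (S ω - M) + ((m : ℝ)⁻¹ * M - g) = (m : ℝ)⁻¹ * S ω - g := by ring
      rwa [e] at this
    -- The elementary bound x ≤ 1 + x² with x = r⁻¹ |S ω - M| replaces the Cauchy–Schwarz inequality
    -- and gives the factor 1 + H.
    have h2 : |(m : ℝ)⁻¹ * (S ω - M)| ≤ r⁻¹ + (r * m)⁻¹ * (S ω - M) ^ 2 := by
      rw [abs_mul, abs_of_pos (inv_pos.2 hm'), ← sq_abs (S ω - M), ← hr2]
      set z := |S ω - M| with hz
      have hz0 : 0 ≤ z := abs_nonneg _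
      have : r⁻¹ + (r * r ^ 2)⁻¹ * z ^ 2 - (r ^ 2)⁻¹ * z =
          r⁻¹ * (1 - r⁻¹ * z + (r⁻¹ * z) ^ 2) := by field_simp; ring
      have h3 : 0 ≤ r⁻¹ * (1 - r⁻¹ * z + (r⁻¹ * z) ^ 2) := by
        apply mul_nonneg (by positivity)
        nlinarith [sq_nonneg (r⁻¹ * z - 1), sq_nonneg (r⁻¹ * z)]
      linarith
    linarith
  have hi2 : Integrable (fun ω => (S ω - M) ^ 2) μ := (hSL.sub (memLp_const M)).integrable_sq
  have hi3 : Integrable (fun ω => r⁻¹ + (r * m)⁻¹ * (S ω - M) ^ 2) μ :=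
    (integrable_const _).add (hi2.const_mul _)
  calc _ ≤ ∫ ω, (r⁻¹ + (r * m)⁻¹ * (S ω - M) ^ 2) + e ∂μ :=
        integral_mono_of_nonneg (Filter.Eventually.of_forall fun ω => abs_nonneg _)
          (hi3.add (integrable_const e)) (Filter.Eventually.of_forall hpt)
    _ = r⁻¹ + (r * m)⁻¹ * (∫ ω, (S ω - M) ^ 2 ∂μ) + e := by
        rw [integral_add hi3 (integrable_const e), integral_add (integrable_const _)
          (hi2.const_mul _), integral_const_mul]
        simp
    _ ≤ r⁻¹ + (r * m)⁻¹ * (m * H) + e := by gcongr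
    _ = _ := by rw [hpow]; field_simp

end FourthMoments

/-! ### Truncation and the integrals of products of Lipschitz functions. -/

section Truncation

open scoped NNReal

variable {E : Type*} [NormedAddCommGroup E] [MeasurableSpace E] [BorelSpace E]
  [SecondCountableTopology E]

/-- The truncation of a real number to `[-r, r]`. -/
noncomputable def clip (r x : ℝ) : ℝ := max (-r) (min x r)

theorem abs_clip_le {r : ℝ} (hr : 0 ≤ r) (x : ℝ) : |clip r x| ≤ r := by
  unfold clip
  rw [abs_le]
  exact ⟨le_max_left _ _, max_le (by linarith) (min_le_right _ _)⟩

theorem clip_of_abs_le {r x : ℝ} (h : |x| ≤ r) : clip r x = x := by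
  obtain ⟨h1, h2⟩ := abs_le.1 h
  rw [clip, min_eq_left h2, max_eq_right h1]

theorem abs_clip_le_abs {r : ℝ} (hr : 0 ≤ r) (x : ℝ) : |clip r x| ≤ |x| := by
  rcases le_or_gt |x| r with h | h
  · rw [clip_of_abs_le h]
  · exact (abs_clip_le hr x).trans h.le

theorem abs_clip_sub_clip_le (r x y : ℝ) : |clip r x - clip r y| ≤ |x - y| := by
  unfold clip
  refine (abs_max_sub_max_le_max _ _ _ _).trans ?_
  simp only [sub_self, abs_zero]
  refine max_le (abs_nonneg _) ((abs_min_sub_min_le_max _ _ _ _).trans ?_)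
  simp

/-- The difference vanishes unless x² + y² ≥ r². There it is at most x² + y², and one more factor
(x² + y²) / r² can be inserted. -/
theorem abs_mul_sub_clip_mul_clip_le {r : ℝ} (hr : 0 < r) (x y : ℝ) :
    |x * y - clip r x * clip r y| ≤ 2 / r ^ 2 * (x ^ 4 + y ^ 4) := by
  have h0 : 0 ≤ 2 / r ^ 2 * (x ^ 4 + y ^ 4) := by positivity
  by_cases h : |x| ≤ r ∧ |y| ≤ r
  · rw [clip_of_abs_le h.1, clip_of_abs_le h.2, sub_self, abs_zero]
    exact h0
  · have hbig : r ^ 2 ≤ x ^ 2 + y ^ 2 := by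
      rw [not_and_or, not_le, not_le] at h
      rcases h with h | h
      · have := pow_le_pow_left₀ hr.le h.le 2
        rw [sq_abs] at this
        nlinarith [sq_nonneg y]
      · have := pow_le_pow_left₀ hr.le h.le 2
        rw [sq_abs] at this
        nlinarith [sq_nonneg x]
    have h1 : |x * y - clip r x * clip r y| ≤ x ^ 2 + y ^ 2 := by
      calc _ ≤ |x * y| + |clip r x * clip r y| := abs_sub _ _
        _ ≤ |x| * |y| + |x| * |y| := by
          rw [abs_mul, abs_mul]
          exact add_le_add le_rfl (mul_le_mul (abs_clip_le_abs hr.le _) (abs_clip_le_abs hr.le _)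
            (abs_nonneg _) (abs_nonneg _))
        _ ≤ x ^ 2 + y ^ 2 := by
          rw [← sq_abs x, ← sq_abs y]; nlinarith [sq_nonneg (|x| - |y|)]
    refine h1.trans ?_
    rw [div_mul_eq_mul_div, le_div_iff₀ (by positivity)]
    nlinarith [sq_nonneg (x ^ 2 - y ^ 2), sq_nonneg x, sq_nonneg y]

/-- Closeness in the Wasserstein distance, together with bounds for fourth moments, controls the
integrals of products of two Lipschitz functions. -/
theorem LipClose.abs_integral_mul_sub_le {ρ τ : Measure E} [IsProbabilityMeasure ρ]
    [IsProbabilityMeasure τ] {D : ℝ} (h : LipClose ρ τ D) {p q : E → ℝ} {K : ℝ≥0}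
    (hp : LipschitzWith K p) (hq : LipschitzWith K q) {H H' : ℝ}
    (ipρ : Integrable (fun x => p x ^ 4) ρ) (iqρ : Integrable (fun x => q x ^ 4) ρ)
    (ipτ : Integrable (fun x => p x ^ 4) τ) (iqτ : Integrable (fun x => q x ^ 4) τ)
    (hpρ : ∫ x, p x ^ 4 ∂ρ ≤ H) (hqρ : ∫ x, q x ^ 4 ∂ρ ≤ H)
    (hpτ : ∫ x, p x ^ 4 ∂τ ≤ H') (hqτ : ∫ x, q x ^ 4 ∂τ ≤ H') {r : ℝ} (hr : 0 < r) :
    |∫ x, p x * q x ∂ρ - ∫ x, p x * q x ∂τ| ≤ 2 * r * K * D + 4 / r ^ 2 * (H + H') := by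
  have hpc := hp.continuous
  have hqc := hq.continuous
  -- A product of two Lipschitz functions need not be Lipschitz, but after truncation at r it is,
  -- with constant 2 r K; the fourth moments pay for the part cut off.
  have hcl : LipschitzWith (2 * r.toNNReal * K) (fun x => clip r (p x) * clip r (q x)) := by
    refine LipschitzWith.of_dist_le_mul fun x y => ?_
    rw [Real.dist_eq]
    have e : clip r (p x) * clip r (q x) - clip r (p y) * clip r (q y) =
        (clip r (p x) - clip r (p y)) * clip r (q x) +
          clip r (p y) * (clip r (q x) - clip r (q y)) := by ring
    rw [e]
    have dp := hp.dist_le_mul x y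
    have dq := hq.dist_le_mul x y
    rw [Real.dist_eq] at dp dq
    calc _ ≤ _ := abs_add_le _ _
      _ ≤ (K * dist x y) * r + r * (K * dist x y) := by
        rw [abs_mul, abs_mul]
        gcongr
        · exact (abs_clip_sub_clip_le _ _ _).trans dp
        · exact abs_clip_le hr.le _
        · exact abs_clip_le hr.le _
        · exact (abs_clip_sub_clip_le _ _ _).trans dq
      _ = _ := by push_cast; rw [Real.coe_toNNReal _ hr.le]; ring
  have hmain := h.abs_integral_sub_le hcl
  push_cast at hmain
  rw [Real.coe_toNNReal _ hr.le] at hmain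
  have trunc : ∀ (θ : Measure E) [IsProbabilityMeasure θ] (B : ℝ),
      Integrable (fun x => p x ^ 4) θ → Integrable (fun x => q x ^ 4) θ →
      ∫ x, p x ^ 4 ∂θ ≤ B → ∫ x, q x ^ 4 ∂θ ≤ B →
      |∫ x, p x * q x ∂θ - ∫ x, clip r (p x) * clip r (q x) ∂θ| ≤ 4 / r ^ 2 * B := by
    intro θ _ B ip iq bp bq
    have i1 : Integrable (fun x => p x * q x) θ := by
      refine Integrable.mono' ((integrable_const 1).add (ip.add iq)) (by fun_prop)
        (Filter.Eventually.of_forall fun x => ?_)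
      have h1 := abs_pow_le_one_add_pow_four (p x) (k := 2) (by norm_num)
      have h2 := abs_pow_le_one_add_pow_four (q x) (k := 2) (by norm_num)
      simp only [norm_mul, Real.norm_eq_abs, Pi.add_apply]
      have h3 : 0 ≤ p x ^ 4 := by positivity
      have h4 : 0 ≤ q x ^ 4 := by positivity
      nlinarith [sq_nonneg (|p x| - |q x|)]
    have i2 : Integrable (fun x => clip r (p x) * clip r (q x)) θ := by
      refine Integrable.mono' (integrable_const (r * r)) hcl.continuous.aestronglyMeasurable
        (Filter.Eventually.of_forall fun x => ?_)
      rw [norm_mul]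
      exact mul_le_mul (abs_clip_le hr.le _) (abs_clip_le hr.le _) (abs_nonneg _) hr.le
    rw [← integral_sub i1 i2]
    calc _ ≤ ∫ x, 2 / r ^ 2 * (p x ^ 4 + q x ^ 4) ∂θ :=
          norm_integral_le_of_norm_le (f := fun x => p x * q x - clip r (p x) * clip r (q x))
            ((ip.add iq).const_mul _)
            (Filter.Eventually.of_forall fun x => abs_mul_sub_clip_mul_clip_le hr _ _)
      _ = 2 / r ^ 2 * (∫ x, p x ^ 4 ∂θ + ∫ x, q x ^ 4 ∂θ) := by
          rw [integral_const_mul, integral_add ip iq]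
      _ ≤ 2 / r ^ 2 * (B + B) := by gcongr
      _ = _ := by ring
  have t1 := trunc ρ H ipρ iqρ hpρ hqρ
  have t2 := trunc τ H' ipτ iqτ hpτ hqτ
  rw [abs_sub_comm] at t2
  have a1 := abs_sub_le (∫ x, p x * q x ∂ρ) (∫ x, clip r (p x) * clip r (q x) ∂ρ)
    (∫ x, p x * q x ∂τ)
  have a2 := abs_sub_le (∫ x, clip r (p x) * clip r (q x) ∂ρ)
    (∫ x, clip r (p x) * clip r (q x) ∂τ) (∫ x, p x * q x ∂τ)
  linarith

end Truncation

/-! ### One layer given the previous activations: moments and means. -/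

section Step

open scoped NNReal Matrix

variable {Ω : Type*} [MeasurableSpace Ω] {μ : Measure Ω} [IsProbabilityMeasure μ] {s : ℕ}

/-- Weights with the normalization of a layer with `n` inputs: independent, centred, with
common variance `V`, and with fourth moments of order `n ^ (-2)`. -/
structure IsFourthWeights {κ : Type*} {Ω : Type*} [MeasurableSpace Ω] (μ : Measure Ω)
    (X : κ → Ω → ℝ) (n : ℕ) (V : ℝ≥0) (c₄ : ℝ) : Prop where
  indep : iIndepFun X μ
  measurable : ∀ k, Measurable (X k)
  integrable_four : ∀ k, Integrable (fun ω => X k ω ^ 4) μ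
  centred : ∀ k, ∫ ω, X k ω ∂μ = 0
  sq_eq : ∀ k, ∫ ω, X k ω ^ 2 ∂μ = V
  fourth_le : ∀ k, ∫ ω, X k ω ^ 4 ∂μ ≤ c₄ / (n : ℝ) ^ 2

namespace IsFourthWeights

variable {κ κ' : Type*} {X : κ → Ω → ℝ} {n : ℕ} {V : ℝ≥0} {c₄ : ℝ}

omit [IsProbabilityMeasure μ] in
theorem precomp (h : IsFourthWeights μ X n V c₄) {f : κ' → κ} (hf : f.Injective) :
    IsFourthWeights μ (fun k => X (f k)) n V c₄ :=
  ⟨h.indep.precomp hf, fun _ => h.measurable _, fun _ => h.integrable_four _,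
    fun _ => h.centred _, fun _ => h.sq_eq _, fun _ => h.fourth_le _⟩

/-- Apply |z|³ ≤ 1 + z⁴ to z = √n X, so the conditional limit theorem also applies to hidden layers.
-/
theorem third (h : IsFourthWeights μ X n V c₄) (hn : 0 < n) :
    IsThirdWeights μ X n V (1 + c₄) := by
  have hn' : (0 : ℝ) < n := by positivity
  set b : ℝ := √n with hb
  have hb0 : 0 < b := Real.sqrt_pos.2 hn'
  have hb2 : (n : ℝ) = b ^ 2 := (Real.sq_sqrt hn'.le).symm
  have hb3 : (n : ℝ) ^ (-(3 / 2) : ℝ) = (b ^ 3)⁻¹ := by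
    rw [hb, Real.sqrt_eq_rpow, ← Real.rpow_natCast, ← Real.rpow_mul hn'.le, Real.rpow_neg hn'.le]
    norm_num
  have i3 : ∀ k, Integrable (fun ω => |X k ω| ^ 3) μ := fun k => by
    simpa using (integrable_pow_of_four (h.measurable k) (h.integrable_four k)
      (k := 3) (by norm_num)).abs
  refine ⟨h.indep, fun k => ⟨h.measurable k, i3 k, h.centred k⟩, h.sq_eq, fun k => ?_⟩
  have hle : ∀ ω, |X k ω| ^ 3 ≤ (b ^ 3)⁻¹ * (1 + b ^ 4 * X k ω ^ 4) := fun ω => by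
    rw [le_inv_mul_iff₀ (by positivity)]
    have := abs_pow_le_one_add_pow_four (b * X k ω) (k := 3) (by norm_num)
    rwa [abs_mul, abs_of_pos hb0, mul_pow, mul_pow] at this
  calc ∫ ω, |X k ω| ^ 3 ∂μ ≤ ∫ ω, (b ^ 3)⁻¹ * (1 + b ^ 4 * X k ω ^ 4) ∂μ :=
        integral_mono (i3 k)
          (((integrable_const 1).add ((h.integrable_four k).const_mul _)).const_mul _) hle
    _ = (b ^ 3)⁻¹ * (1 + b ^ 4 * ∫ ω, X k ω ^ 4 ∂μ) := by
        rw [integral_const_mul, integral_add (integrable_const _)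
          ((h.integrable_four k).const_mul _), integral_const_mul]
        simp
    _ ≤ (b ^ 3)⁻¹ * (1 + b ^ 4 * (c₄ / (b ^ 2) ^ 2)) := by
        gcongr
        rw [← hb2]
        exact h.fourth_le k
    _ = (1 + c₄) * (n : ℝ) ^ (-(3 / 2) : ℝ) := by rw [hb3]; field_simp

end IsFourthWeights

/-- The activations of a layer with weights `w` if those of the previous layer are `y`. -/
def nextAct (σ : ℝ → ℝ) {m n : ℕ} (w : Fin m × Fin n → ℝ) (y : Fin n → Fin s → ℝ) :
    Fin m → Fin s → ℝ :=
  fun k a => σ (∑ j, w (k, j) * y j a)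

theorem lipschitz_pow_four_le {σ : ℝ → ℝ} {K : ℝ≥0} (hσ : LipschitzWith K σ) (x : ℝ) :
    σ x ^ 4 ≤ 8 * (σ 0 ^ 4 + K ^ 4 * x ^ 4) := by
  have h := hσ.dist_le_mul x 0
  rw [Real.dist_eq, Real.dist_eq, sub_zero] at h
  have h4 : (σ x - σ 0) ^ 4 ≤ K ^ 4 * x ^ 4 := by
    have := pow_le_pow_left₀ (abs_nonneg _) h 4
    rwa [mul_pow, ← abs_pow, ← abs_pow, abs_of_nonneg (by positivity),
      abs_of_nonneg (by positivity)] at this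
  have key : ∀ u v : ℝ, (u + v) ^ 4 ≤ 8 * (u ^ 4 + v ^ 4) := fun u v => by
    have h1 : (u + v) ^ 2 ≤ 2 * (u ^ 2 + v ^ 2) := by nlinarith [sq_nonneg (u - v)]
    have h2 := pow_le_pow_left₀ (sq_nonneg _) h1 2
    nlinarith [sq_nonneg (u ^ 2 - v ^ 2)]
  have := key (σ 0) (σ x - σ 0)
  rw [add_sub_cancel] at this
  linarith

/-- The constant in the bound for the fourth moments of activations. -/
noncomputable def actConst (σ : ℝ → ℝ) (K : ℝ≥0) (c₄ : ℝ) : ℝ := 8 * (σ 0 ^ 4 + K ^ 4 * (3 * c₄))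

theorem actConst_nonneg (σ : ℝ → ℝ) (K : ℝ≥0) {c₄ : ℝ} (h : 0 ≤ c₄) : 0 ≤ actConst σ K c₄ := by
  unfold actConst; positivity

theorem integrable_comp_pow_four {σ : ℝ → ℝ} {K : ℝ≥0} (hσ : LipschitzWith K σ) {α : Type*}
    [MeasurableSpace α] {θ : Measure α} [IsFiniteMeasure θ] {Z : α → ℝ} (mZ : Measurable Z)
    (iZ : Integrable (fun x => Z x ^ 4) θ) :
    Integrable (fun x => σ (Z x) ^ 4) θ ∧
      ∫ x, σ (Z x) ^ 4 ∂θ ≤ 8 * (σ 0 ^ 4 * θ.real Set.univ + K ^ 4 * ∫ x, Z x ^ 4 ∂θ) := by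
  have hc := hσ.continuous.measurable
  have hb : Integrable (fun x => 8 * (σ 0 ^ 4 + K ^ 4 * Z x ^ 4)) θ :=
    ((integrable_const _).add (iZ.const_mul _)).const_mul _
  have hi : Integrable (fun x => σ (Z x) ^ 4) θ := by
    refine Integrable.mono' hb (by exact ((hc.comp mZ).pow_const 4).aestronglyMeasurable) (Filter.Eventually.of_forall fun x => ?_)
    rw [Real.norm_eq_abs, abs_of_nonneg (by positivity)]
    exact lipschitz_pow_four_le hσ _
  refine ⟨hi, (integral_mono hi hb fun x => lipschitz_pow_four_le hσ _).trans (le_of_eq ?_)⟩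
  rw [integral_const_mul, integral_add (integrable_const _) (iZ.const_mul _), integral_const_mul]
  simp [mul_comm]

section

variable {m n : ℕ} {X : Fin m × Fin n → Ω → ℝ} {V : ℝ≥0} {c₄ : ℝ} {σ : ℝ → ℝ} {K : ℝ≥0}

theorem measurable_preact (mX : ∀ k, Measurable (X k)) (y : Fin n → Fin s → ℝ) (k : Fin m)
    (a : Fin s) : Measurable (fun ω => ∑ j, X (k, j) ω * y j a) :=
  Finset.measurable_sum _ fun _ _ => (mX _).mul_const _

/-- Cauchy–Schwarz turns (Σ y²)² into n Σ y⁴, and the factor n⁻² from the weights makes this an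
average over the neurons: the bound does not depend on the width. -/
theorem preact_fourth (hn : 0 < n) (hX : IsFourthWeights μ X n V c₄) (hc : 0 ≤ c₄)
    (y : Fin n → Fin s → ℝ) (k : Fin m) (a : Fin s) :
    Integrable (fun ω => (∑ j, X (k, j) ω * y j a) ^ 4) μ ∧
      ∫ ω, (∑ j, X (k, j) ω * y j a) ^ 4 ∂μ ≤ 3 * c₄ * fourthAvg y := by
  have hX' := hX.precomp (f := fun j : Fin n => (k, j)) (fun i j h => by simpa using h)
  obtain ⟨h1, -, -, h4⟩ := fourth_moment_sum_le hX'.indep hX'.measurable hX'.integrable_four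
    hX'.centred hX'.sq_eq hX'.fourth_le (fun j => y j a) Finset.univ
  refine ⟨h1, h4.trans ?_⟩
  have hn' : (0 : ℝ) < n := by positivity
  have hcs : (∑ j, y j a ^ 2) ^ 2 ≤ n * ∑ j, y j a ^ 4 := by
    have := sq_sum_le_card_mul_sum_sq (s := Finset.univ) (f := fun j => y j a ^ 2)
    simpa [← pow_mul] using this
  have hle : ∑ j, y j a ^ 4 ≤ ∑ j, ∑ a, y j a ^ 4 :=
    Finset.sum_le_sum fun j _ => Finset.single_le_sum (f := fun a => y j a ^ 4)
      (fun a _ => by positivity) (Finset.mem_univ a)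
  calc 3 * (c₄ / (n : ℝ) ^ 2) * (∑ j, y j a ^ 2) ^ 2
      ≤ 3 * (c₄ / (n : ℝ) ^ 2) * (n * ∑ j, ∑ a, y j a ^ 4) := by
        gcongr; exact hcs.trans (by gcongr)
    _ = 3 * c₄ * fourthAvg y := by unfold fourthAvg; field_simp

theorem nextAct_fourth (hσ : LipschitzWith K σ) (hn : 0 < n) (hX : IsFourthWeights μ X n V c₄)
    (hc : 0 ≤ c₄) (y : Fin n → Fin s → ℝ) (k : Fin m) (a : Fin s) :
    Integrable (fun ω => nextAct σ (fun k => X k ω) y k a ^ 4) μ ∧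
      ∫ ω, nextAct σ (fun k => X k ω) y k a ^ 4 ∂μ ≤ actConst σ K c₄ * (1 + fourthAvg y) := by
  obtain ⟨h1, h2⟩ := preact_fourth hn hX hc y k a
  obtain ⟨h3, h4⟩ := integrable_comp_pow_four hσ (measurable_preact hX.measurable y k a) h1
  refine ⟨h3, h4.trans ?_⟩
  have hq := fourthAvg_nonneg y
  have : 0 ≤ σ 0 ^ 4 * fourthAvg y := by positivity
  have h5 : (K : ℝ) ^ 4 * ∫ ω, (∑ j, X (k, j) ω * y j a) ^ 4 ∂μ ≤
      K ^ 4 * (3 * c₄ * fourthAvg y) := by gcongr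
  have : 0 ≤ (K : ℝ) ^ 4 * (3 * c₄) := by positivity
  unfold actConst
  simp only [probReal_univ, mul_one]
  nlinarith

theorem fourthAvg_nextAct (hσ : LipschitzWith K σ) (hm : 0 < m) (hn : 0 < n)
    (hX : IsFourthWeights μ X n V c₄) (hc : 0 ≤ c₄) (y : Fin n → Fin s → ℝ) :
    Integrable (fun ω => fourthAvg (nextAct σ (fun k => X k ω) y)) μ ∧
      ∫ ω, fourthAvg (nextAct σ (fun k => X k ω) y) ∂μ ≤
        s * actConst σ K c₄ * (1 + fourthAvg y) := by
  have h := nextAct_fourth hσ hn hX hc y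
  have hm' : (0 : ℝ) < m := by positivity
  unfold fourthAvg
  have hi : ∀ k, Integrable (fun ω => ∑ a, nextAct σ (fun k => X k ω) y k a ^ 4) μ := fun k =>
    integrable_finsetSum _ fun a _ => (h k a).1
  refine ⟨(integrable_finsetSum _ fun k _ => hi k).const_mul _, ?_⟩
  rw [integral_const_mul, integral_finsetSum _ fun k _ => hi k]
  calc _ ≤ (m : ℝ)⁻¹ * ∑ _k : Fin m, ∑ _a : Fin s, actConst σ K c₄ * (1 + fourthAvg y) := by
        gcongr with k
        rw [integral_finsetSum _ fun a _ => (h k a).1]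
        exact Finset.sum_le_sum fun a _ => (h k a).2
    _ = _ := by simp [fourthAvg]; field_simp

omit [IsProbabilityMeasure μ] in
-- Distinct neurons are functions of disjoint rows of independent weights once y is fixed.
theorem indepFun_nextAct (hσ : LipschitzWith K σ) (hX : iIndepFun X μ) (mX : ∀ k, Measurable (X k))
    (y : Fin n → Fin s → ℝ) {k l : Fin m} (hkl : k ≠ l) :
    IndepFun (fun ω => nextAct σ (fun k => X k ω) y k) (fun ω => nextAct σ (fun k => X k ω) y l)
      μ := by
  classical
  have hc := hσ.continuous.measurable
  set S : Fin m → Finset (Fin m × Fin n) := fun k => Finset.univ.filter fun p => p.1 = k with hS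
  have hdis : Disjoint (S k) (S l) := by
    rw [Finset.disjoint_left]
    intro p hp hp'
    simp only [hS, Finset.mem_filter, Finset.mem_univ, true_and] at hp hp'
    exact hkl (hp.symm.trans hp')
  have h := hX.indepFun_finset (S k) (S l) hdis mX
  have hmem : ∀ k j, (k, j) ∈ S k := fun k j => by simp [hS]
  let f : ∀ k, (S k → ℝ) → Fin s → ℝ := fun k w a => σ (∑ j, w ⟨(k, j), hmem k j⟩ * y j a)
  have hf : ∀ k, Measurable (f k) := fun k => by
    refine measurable_pi_lambda _ fun a => hc.comp (Finset.measurable_sum _ fun j _ => ?_)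
    exact (measurable_pi_apply _).mul_const _
  exact h.comp (hf k) (hf l)

theorem nextAct_mul_memLp (hσ : LipschitzWith K σ) (hn : 0 < n) (hX : IsFourthWeights μ X n V c₄)
    (hc : 0 ≤ c₄) (y : Fin n → Fin s → ℝ) (k : Fin m) (a b : Fin s) :
    MemLp (fun ω => nextAct σ (fun k => X k ω) y k a * nextAct σ (fun k => X k ω) y k b) 2 μ ∧
      ∫ ω, (nextAct σ (fun k => X k ω) y k a * nextAct σ (fun k => X k ω) y k b) ^ 2 ∂μ ≤
        actConst σ K c₄ * (1 + fourthAvg y) := by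
  obtain ⟨ia, ba⟩ := nextAct_fourth hσ hn hX hc y k a
  obtain ⟨ib, bb⟩ := nextAct_fourth hσ hn hX hc y k b
  have hsc := hσ.continuous.measurable
  have hm : ∀ a, Measurable (fun ω => nextAct σ (fun k => X k ω) y k a) := fun a =>
    hsc.comp (measurable_preact hX.measurable y k a)
  have hma := hm a
  have hmb := hm b
  have hle : ∀ ω, (nextAct σ (fun k => X k ω) y k a * nextAct σ (fun k => X k ω) y k b) ^ 2 ≤
      2⁻¹ * (nextAct σ (fun k => X k ω) y k a ^ 4 + nextAct σ (fun k => X k ω) y k b ^ 4) :=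
    fun ω => by
      nlinarith [sq_nonneg (nextAct σ (fun k => X k ω) y k a ^ 2 -
        nextAct σ (fun k => X k ω) y k b ^ 2)]
  have hib := (ia.add ib).const_mul 2⁻¹
  have hi : Integrable (fun ω => (nextAct σ (fun k => X k ω) y k a *
      nextAct σ (fun k => X k ω) y k b) ^ 2) μ := by
    refine Integrable.mono' hib (by fun_prop) (Filter.Eventually.of_forall fun ω => ?_)
    rw [Real.norm_eq_abs, abs_of_nonneg (by positivity)]
    exact hle ω
  refine ⟨(memLp_two_iff_integrable_sq (by fun_prop)).2 hi, (integral_mono hi hib hle).trans ?_⟩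
  simp only [Pi.add_apply]
  rw [integral_const_mul, integral_add ia ib]
  linarith

/-- The average of products of activations concentrates around the means. -/
theorem nextAct_avg (hσ : LipschitzWith K σ) (hm : 0 < m) (hn : 0 < n)
    (hX : IsFourthWeights μ X n V c₄) (hc : 0 ≤ c₄) (y : Fin n → Fin s → ℝ) (a b : Fin s) {g e : ℝ}
    (he : ∀ k, |∫ ω, nextAct σ (fun k => X k ω) y k a * nextAct σ (fun k => X k ω) y k b ∂μ - g| ≤
      e) :
    ∫ ω, |(m : ℝ)⁻¹ * ∑ k, nextAct σ (fun k => X k ω) y k a *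
        nextAct σ (fun k => X k ω) y k b - g| ∂μ ≤
      (m : ℝ) ^ (-(1 / 2) : ℝ) * (1 + actConst σ K c₄ * (1 + fourthAvg y)) + e := by
  refine integral_abs_avg_sub_le hm (h := fun k ω => nextAct σ (fun k => X k ω) y k a *
    nextAct σ (fun k => X k ω) y k b) (fun k l hkl => ?_)
    (fun k => (nextAct_mul_memLp hσ hn hX hc y k a b).1) he
    (fun k => (nextAct_mul_memLp hσ hn hX hc y k a b).2)
  exact (indepFun_nextAct hσ hX.indep hX.measurable y hkl).comp
    (φ := fun v : Fin s → ℝ => v a * v b) (ψ := fun v : Fin s → ℝ => v a * v b)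
    (by fun_prop) (by fun_prop)

end

/-- The fourth moment of the standard Gaussian law. -/
noncomputable def gaussFourth : ℝ := ∫ x, x ^ 4 ∂gaussianReal 0 1

theorem gaussFourth_nonneg : 0 ≤ gaussFourth := integral_nonneg fun _ => by positivity

theorem gaussLaw_fourth {R : Type*} [Fintype R] [DecidableEq R] {Γ : Matrix (Fin s) (Fin s) ℝ}
    (hΓ : Γ.PosSemidef) (α : R × Fin s) :
    Integrable (fun g => g α ^ 4) (gaussLaw R Γ) ∧
      ∫ g, g α ^ 4 ∂gaussLaw R Γ = Γ α.2 α.2 ^ 2 * gaussFourth := by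
  have mp := measurePreserving_eval_multivariateGaussian (μ := 0)
    (blockCov_posSemidef (R := R) hΓ) (i := α)
  have hv : blockCov R Γ α α = Γ α.2 α.2 := by simp [blockCov]
  have hpos : 0 ≤ Γ α.2 α.2 := hΓ.diag_nonneg
  rw [hv] at mp
  simp only [PiLp.zero_apply] at mp
  have hi : Integrable (fun x : ℝ => x ^ 4) (gaussianReal 0 (Γ α.2 α.2).toNNReal) := by
    have := integrable_abs_pow_gaussianReal (Γ α.2 α.2).toNNReal 4
    refine this.congr (Filter.Eventually.of_forall fun x => ?_)
    simp only
    rw [← abs_pow, abs_of_nonneg (by positivity)]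
  refine ⟨mp.integrable_comp_of_integrable hi, ?_⟩
  have e : ∫ g, g α ^ 4 ∂gaussLaw R Γ = ∫ x, x ^ 4 ∂gaussianReal 0 (Γ α.2 α.2).toNNReal := by
    rw [← mp.map_eq, integral_map mp.measurable.aemeasurable (by fun_prop)]
    rfl
  rw [e, gaussianReal_eq_map_sqrt, integral_map (by fun_prop) (by fun_prop), gaussFourth,
    ← integral_const_mul, Real.coe_toNNReal _ hpos]
  congr 1 with x
  rw [mul_pow, show √(Γ α.2 α.2) ^ 4 = (√(Γ α.2 α.2) ^ 2) ^ 2 by ring, Real.sq_sqrt hpos]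

theorem lipschitz_comp_coord {σ : ℝ → ℝ} {K : ℝ≥0} (hσ : LipschitzWith K σ) {ι : Type*}
    [Fintype ι] (i : ι) : LipschitzWith K (fun g : EuclideanSpace ℝ ι => σ (g i)) := by
  have h1 : LipschitzWith 1 (fun g : EuclideanSpace ℝ ι => g i) := by
    refine LipschitzWith.of_dist_le_mul fun x y => ?_
    rw [dist_eq_norm, dist_eq_norm, NNReal.coe_one, one_mul]
    exact PiLp.norm_apply_le (x - y) i
  have := hσ.comp h1
  rw [mul_one] at this
  exact this

/-- Closeness of the means of products of activations to those of the Gaussian limit. -/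
theorem nextAct_mean_le {m n : ℕ} {X : Fin m × Fin n → Ω → ℝ} {V : ℝ≥0} {c₄ : ℝ} {σ : ℝ → ℝ}
    {K : ℝ≥0} (hσ : LipschitzWith K σ) (hn : 0 < n)
    (hX : IsFourthWeights μ X n V c₄) (hc : 0 ≤ c₄) (y : Fin n → Fin s → ℝ) (k : Fin m)
    (a b : Fin s) {Γ : Matrix (Fin s) (Fin s) ℝ} (hΓ : Γ.PosSemidef) {B : ℝ}
    (hB : ∀ a, Γ a a ≤ B) {r : ℝ} (hr : 0 < r) :
    |∫ ω, nextAct σ (fun k => X k ω) y k a * nextAct σ (fun k => X k ω) y k b ∂μ -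
        ∫ g, σ (g ((), a)) * σ (g ((), b)) ∂gaussLaw Unit Γ| ≤
      2 * r * K * (layerConst s (1 + c₄) *
        ((n : ℝ) ^ (-(1 / 6) : ℝ) * (1 + fourthAvg y) + √(covDist (empCov V y) Γ))) +
      4 / r ^ 2 * (actConst σ K c₄ * (1 + fourthAvg y) +
        8 * (σ 0 ^ 4 + K ^ 4 * (B ^ 2 * gaussFourth))) := by
  -- A single neuron is a layer with one row, so no power of the width appears. The rows need not
  -- share a law in these layers; each is compared with the same Gaussian.
  have hX' := hX.precomp (f := fun p : Unit × Fin n => (k, p.2)) (fun i j h => by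
    ext; simp_all)
  have hclose := lipClose_layer_le hn (by linarith) (hX'.third hn) y hΓ
  simp only [Fintype.card_unit, Nat.cast_one, Real.one_rpow, mul_one] at hclose
  set ρ := μ.map (fun ω => layer (fun p : Unit × Fin n => X (k, p.2) ω) y) with hρ
  have hlm : Measurable (fun ω => layer (fun p : Unit × Fin n => X (k, p.2) ω) y) := by
    have : ∀ k, Measurable (X k) := hX.measurable
    unfold layer
    refine (PiLp.continuous_toLp 2 _).measurable.comp (measurable_pi_lambda _ fun α => ?_)
    exact measurable_preact hX.measurable y k α.2
  have : IsProbabilityMeasure ρ := Measure.isProbabilityMeasure_map hlm.aemeasurable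
  have hsc := hσ.continuous.measurable
  have eval : ∀ (f : ℝ → ℝ → ℝ), Measurable (Function.uncurry f) → ∀ a b,
      ∫ g, f (σ (g ((), a))) (σ (g ((), b))) ∂ρ =
        ∫ ω, f (nextAct σ (fun k => X k ω) y k a) (nextAct σ (fun k => X k ω) y k b) ∂μ := by
    intro f hf a b
    rw [hρ, integral_map hlm.aemeasurable]
    · rfl
    · refine (hf.comp (f := fun g : EuclideanSpace ℝ (Unit × Fin s) =>
        (σ (g ((), a)), σ (g ((), b)))) ?_).aestronglyMeasurable
      fun_prop
  have i4 : ∀ a, Integrable (fun g : EuclideanSpace ℝ (Unit × Fin s) => σ (g ((), a)) ^ 4) ρ := by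
    intro a
    rw [hρ, integrable_map_measure (Measurable.aestronglyMeasurable (by fun_prop))
      hlm.aemeasurable]
    exact (nextAct_fourth hσ hn hX hc y k a).1
  have b4 : ∀ a, ∫ g, σ (g ((), a)) ^ 4 ∂ρ ≤ actConst σ K c₄ * (1 + fourthAvg y) := fun a => by
    rw [eval (fun u _ => u ^ 4) (by unfold Function.uncurry; fun_prop) a a]
    exact (nextAct_fourth hσ hn hX hc y k a).2
  have g4 : ∀ a, Integrable (fun g : EuclideanSpace ℝ (Unit × Fin s) => σ (g ((), a)) ^ 4)
        (gaussLaw Unit Γ) ∧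
      ∫ g, σ (g ((), a)) ^ 4 ∂gaussLaw Unit Γ ≤
        8 * (σ 0 ^ 4 + K ^ 4 * (B ^ 2 * gaussFourth)) := fun a => by
    obtain ⟨h1, h2⟩ := gaussLaw_fourth (R := Unit) hΓ ((), a)
    obtain ⟨h3, h4⟩ := integrable_comp_pow_four hσ (Z := fun g : EuclideanSpace ℝ (Unit × Fin s) =>
      g ((), a)) (by fun_prop) h1
    refine ⟨h3, h4.trans ?_⟩
    rw [h2, probReal_univ, mul_one]
    have := gaussFourth_nonneg
    have h0 : 0 ≤ Γ a a := hΓ.diag_nonneg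
    gcongr
    exact hB a
  have main := hclose.abs_integral_mul_sub_le (lipschitz_comp_coord hσ ((), a))
    (lipschitz_comp_coord hσ ((), b)) (i4 a) (i4 b) (g4 a).1 (g4 b).1 (b4 a) (b4 b) (g4 a).2
    (g4 b).2 hr
  rwa [eval (fun u v => u * v) (by unfold Function.uncurry; fun_prop) a b] at main

end Step

/-! ### The conditional recursion for the distance of covariances. -/

section StepBound

open scoped NNReal Matrix

variable {Ω : Type*} [MeasurableSpace Ω] {μ : Measure Ω} [IsProbabilityMeasure μ] {s : ℕ}
  {m n : ℕ} {X : Fin m × Fin n → Ω → ℝ} {V : ℝ≥0} {c₄ : ℝ} {σ : ℝ → ℝ} {K : ℝ≥0}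

/-- The means may differ from neuron to neuron as long as all are within e of the same matrix g. The
first layer uses e = 0, later layers the Gaussian means. -/
theorem covDist_nextAct (hσ : LipschitzWith K σ) (hm : 0 < m) (hn : 0 < n)
    (hX : IsFourthWeights μ X n V c₄) (hc : 0 ≤ c₄) (y : Fin n → Fin s → ℝ)
    {g : Matrix (Fin s) (Fin s) ℝ} {e : ℝ}
    (he : ∀ k a b, |∫ ω, nextAct σ (fun k => X k ω) y k a * nextAct σ (fun k => X k ω) y k b ∂μ -
      g a b| ≤ e) {c : ℝ} (hc0 : 0 ≤ c) :
    Integrable (fun ω => covDist (empCov (c / m) (nextAct σ (fun k => X k ω) y)) (c • g)) μ ∧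
      ∫ ω, covDist (empCov (c / m) (nextAct σ (fun k => X k ω) y)) (c • g) ∂μ ≤
        c * s ^ 2 * ((m : ℝ) ^ (-(1 / 2) : ℝ) * (1 + actConst σ K c₄ * (1 + fourthAvg y)) + e) := by
  have hab : ∀ ω a b, |empCov (c / m) (nextAct σ (fun k => X k ω) y) a b - (c • g) a b| =
      c * |(m : ℝ)⁻¹ * ∑ k, nextAct σ (fun k => X k ω) y k a *
        nextAct σ (fun k => X k ω) y k b - g a b| := fun ω a b => by
    rw [← abs_of_nonneg hc0, ← abs_mul, abs_of_nonneg hc0]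
    congr 1
    simp only [empCov, Matrix.of_apply, Matrix.smul_apply, smul_eq_mul]
    ring
  have hi : ∀ a b, Integrable (fun ω => c * |(m : ℝ)⁻¹ * ∑ k, nextAct σ (fun k => X k ω) y k a *
        nextAct σ (fun k => X k ω) y k b - g a b|) μ := fun a b => by
    refine Integrable.const_mul (Integrable.abs (Integrable.sub (Integrable.const_mul
      (integrable_finsetSum _ fun k _ => ?_) _) (integrable_const _))) _
    exact (nextAct_mul_memLp hσ hn hX hc y k a b).1.integrable (by norm_num)
  unfold covDist
  simp_rw [hab]
  have hi2 : ∀ a, Integrable (fun ω => ∑ b, c * |(m : ℝ)⁻¹ * ∑ k, nextAct σ (fun k => X k ω) y k a *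
        nextAct σ (fun k => X k ω) y k b - g a b|) μ := fun a =>
    integrable_finsetSum _ fun b _ => hi a b
  refine ⟨integrable_finsetSum _ fun a _ => hi2 a, ?_⟩
  rw [integral_finsetSum _ fun a _ => hi2 a]
  calc _ ≤ ∑ _a : Fin s, ∑ _b : Fin s, c * ((m : ℝ) ^ (-(1 / 2) : ℝ) *
        (1 + actConst σ K c₄ * (1 + fourthAvg y)) + e) := by
        refine Finset.sum_le_sum fun a _ => ?_
        rw [integral_finsetSum _ fun b _ => hi a b]
        refine Finset.sum_le_sum fun b _ => ?_
        rw [integral_const_mul]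
        exact mul_le_mul_of_nonneg_left
          (nextAct_avg hσ hm hn hX hc y a b fun k => he k a b) hc0
    _ = _ := by simp; ring

/-- The matrix of the means of products of activations under the Gaussian law with
covariance `Γ`. -/
noncomputable def gaussMean (σ : ℝ → ℝ) (Γ : Matrix (Fin s) (Fin s) ℝ) :
    Matrix (Fin s) (Fin s) ℝ :=
  Matrix.of fun a b => ∫ g, σ (g ((), a)) * σ (g ((), b)) ∂gaussLaw Unit Γ

/-- The right side is linear in x, so it can be averaged over random x; with x of order S² both
terms have order S. -/
theorem sqrt_le_div_add {x S : ℝ} (hx : 0 ≤ x) (hS : 0 < S) : √x ≤ x / S + S := by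
  rw [Real.sqrt_le_left (by positivity)]
  have : (x / S + S) ^ 2 = (x / S) ^ 2 + 2 * x + S ^ 2 := by field_simp; ring
  rw [this]
  nlinarith [sq_nonneg (x / S), sq_nonneg S]

/-- The bound for the fourth moments of activations under the Gaussian laws. -/
noncomputable def gaussActConst (σ : ℝ → ℝ) (K : ℝ≥0) (B : ℝ) : ℝ :=
  8 * (σ 0 ^ 4 + K ^ 4 * (B ^ 2 * gaussFourth))

theorem gaussActConst_nonneg (σ : ℝ → ℝ) (K : ℝ≥0) (B : ℝ) : 0 ≤ gaussActConst σ K B := by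
  have := gaussFourth_nonneg
  unfold gaussActConst; positivity

/-- The constant in the recursive bound for the covariances. -/
noncomputable def stepConst (s : ℕ) (σ : ℝ → ℝ) (K : ℝ≥0) (c₄ B C : ℝ) : ℝ :=
  C * s ^ 2 * (1 + 5 * actConst σ K c₄ + 4 * (K * layerConst s (1 + c₄)) + 4 * gaussActConst σ K B)

theorem stepConst_nonneg (s : ℕ) (σ : ℝ → ℝ) (K : ℝ≥0) {c₄ : ℝ} (hc : 0 ≤ c₄) (B : ℝ) {C : ℝ}
    (hC : 0 ≤ C) : 0 ≤ stepConst s σ K c₄ B C := by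
  have h1 := actConst_nonneg σ K hc
  have h2 := (layerConst_pos s (c₃ := 1 + c₄) (by linarith)).le
  have h3 := gaussActConst_nonneg σ K B
  unfold stepConst; positivity

/-- The conditional distance of the covariances of a layer, in terms of those of the previous
one. -/
theorem covDist_nextAct_gauss (hσ : LipschitzWith K σ) (hm : 0 < m) (hn : 0 < n)
    (hX : IsFourthWeights μ X n V c₄) (hc : 0 ≤ c₄) (y : Fin n → Fin s → ℝ)
    {Γ : Matrix (Fin s) (Fin s) ℝ} (hΓ : Γ.PosSemidef) {B : ℝ} (hB : ∀ a, Γ a a ≤ B)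
    {S : ℝ} (hS : 0 < S) (hnS : (n : ℝ) ^ (-(1 / 6) : ℝ) ≤ S) {c C : ℝ} (hc0 : 0 ≤ c)
    (hcC : c ≤ C) :
    Integrable (fun ω => covDist (empCov (c / m) (nextAct σ (fun k => X k ω) y))
        (c • gaussMean σ Γ)) μ ∧
      ∫ ω, covDist (empCov (c / m) (nextAct σ (fun k => X k ω) y)) (c • gaussMean σ Γ) ∂μ ≤
        stepConst s σ K c₄ B C * (((m : ℝ) ^ (-(1 / 2) : ℝ) + S ^ (2 / 3 : ℝ)) *
          (1 + fourthAvg y) + S ^ (-(4 / 3) : ℝ) * covDist (empCov V y) Γ) := by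
  -- Truncation at r = u⁻¹ balances r S against r⁻²: both are S^(2/3). The term r √δ becomes S^(2/3)
  -- + S^(-4/3) δ after `sqrt_le_div_add`.
  set u : ℝ := S ^ (1 / 3 : ℝ) with hu
  have hu0 : 0 < u := Real.rpow_pos_of_pos hS _
  have e1 : S = u ^ 3 := by
    rw [hu, ← Real.rpow_natCast, ← Real.rpow_mul hS.le]; norm_num
  have e2 : S ^ (2 / 3 : ℝ) = u ^ 2 := by
    rw [hu, ← Real.rpow_natCast, ← Real.rpow_mul hS.le]; norm_num
  have e3 : S ^ (-(4 / 3) : ℝ) = (u ^ 4)⁻¹ := by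
    rw [hu, ← Real.rpow_natCast, ← Real.rpow_mul hS.le, ← Real.rpow_neg hS.le]; norm_num
  set q := fourthAvg y
  set δ := covDist (empCov V y) Γ
  have hq : 0 ≤ q := fourthAvg_nonneg y
  have hδ : 0 ≤ δ := covDist_nonneg _ _
  have h1 := actConst_nonneg σ K hc
  have h2 := (layerConst_pos s (c₃ := 1 + c₄) (by linarith)).le
  have h3 := gaussActConst_nonneg σ K B
  obtain ⟨i, b⟩ := covDist_nextAct hσ hm hn hX hc y (g := gaussMean σ Γ) (fun k a b =>
    nextAct_mean_le hσ hn hX hc y k a b hΓ hB (r := u⁻¹) (by positivity)) hc0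
  refine ⟨i, b.trans ?_⟩
  rw [e2, e3]
  set A := actConst σ K c₄
  set Lc := layerConst s (1 + c₄)
  change c * s ^ 2 * (_ + (2 * u⁻¹ * K * (Lc * (_ * (1 + q) + √δ)) + 4 / u⁻¹ ^ 2 *
    (A * (1 + q) + gaussActConst σ K B))) ≤ _
  set G := gaussActConst σ K B
  set w : ℝ := (m : ℝ) ^ (-(1 / 2) : ℝ) with hw
  have hw0 : 0 ≤ w := by positivity
  have hsq : √δ ≤ δ / u ^ 3 + u ^ 3 := by
    rw [← e1]; exact sqrt_le_div_add hδ hS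
  have hKL : 0 ≤ (K : ℝ) * Lc := by positivity
  have t1 : 2 * u⁻¹ * K * (Lc * ((n : ℝ) ^ (-(1 / 6) : ℝ) * (1 + q) + √δ)) ≤
      4 * (K * Lc) * (u ^ 2 * (1 + q) + (u ^ 4)⁻¹ * δ) := by
    calc _ ≤ 2 * u⁻¹ * K * (Lc * (u ^ 3 * (1 + q) + (δ / u ^ 3 + u ^ 3))) := by
          rw [e1] at hnS
          gcongr
      _ = 2 * (K * Lc) * (u ^ 2 * (1 + q) + u ^ 2 + (u ^ 4)⁻¹ * δ) := by field_simp; ring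
      _ ≤ 4 * (K * Lc) * (u ^ 2 * (1 + q) + (u ^ 4)⁻¹ * δ) := by
          have p1 : 0 ≤ (K * Lc) * (u ^ 2 * q) := by positivity
          have p2 : 0 ≤ (K * Lc) * ((u ^ 4)⁻¹ * δ) := by positivity
          nlinarith
  have t2 : 4 / u⁻¹ ^ 2 * (A * (1 + q) + G) ≤ (4 * A + 4 * G) * (u ^ 2 * (1 + q)) := by
    have p : 0 ≤ G * (u ^ 2 * q) := by positivity
    have : 4 / u⁻¹ ^ 2 = 4 * u ^ 2 := by field_simp
    rw [this]
    nlinarith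
  have t3 : w * (1 + A * (1 + q)) ≤ (1 + A) * (w * (1 + q)) := by
    have p : 0 ≤ w * q := by positivity
    nlinarith
  have hT : 0 ≤ (w + u ^ 2) * (1 + q) + (u ^ 4)⁻¹ * δ := by positivity
  calc _ ≤ C * s ^ 2 * ((1 + A) * (w * (1 + q)) + (4 * (K * Lc) * (u ^ 2 * (1 + q) + (u ^ 4)⁻¹ * δ) +
        (4 * A + 4 * G) * (u ^ 2 * (1 + q)))) := by
        have hC : 0 ≤ C := hc0.trans hcC
        have hr := add_le_add t3 (add_le_add t1 t2)
        have hl : 0 ≤ (1 + A) * (w * (1 + q)) + (4 * (K * Lc) * (u ^ 2 * (1 + q) + (u ^ 4)⁻¹ * δ) +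
          (4 * A + 4 * G) * (u ^ 2 * (1 + q))) := by positivity
        calc _ ≤ c * s ^ 2 * ((1 + A) * (w * (1 + q)) + (4 * (K * Lc) * (u ^ 2 * (1 + q) +
              (u ^ 4)⁻¹ * δ) + (4 * A + 4 * G) * (u ^ 2 * (1 + q)))) :=
              mul_le_mul_of_nonneg_left hr (by positivity)
          _ ≤ _ := by gcongr
    _ ≤ C * s ^ 2 * ((1 + 5 * A + 4 * (K * Lc) + 4 * G) *
        ((w + u ^ 2) * (1 + q) + (u ^ 4)⁻¹ * δ)) := by
        have hC : 0 ≤ C := hc0.trans hcC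
        refine mul_le_mul_of_nonneg_left ?_ (by positivity)
        have p1 : 0 ≤ A * (w * (1 + q)) := by positivity
        have p2 : 0 ≤ A * (u ^ 2 * (1 + q)) := by positivity
        have p3 : 0 ≤ A * ((u ^ 4)⁻¹ * δ) := by positivity
        have p4 : 0 ≤ (K * Lc) * (w * (1 + q)) := by positivity
        have p5 : 0 ≤ G * (w * (1 + q)) := by positivity
        have p6 : 0 ≤ G * ((u ^ 4)⁻¹ * δ) := by positivity
        have p7 : 0 ≤ u ^ 2 * (1 + q) := by positivity
        have p8 : 0 ≤ (u ^ 4)⁻¹ * δ := by positivity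
        linarith
    _ = _ := by unfold stepConst; ring

end StepBound

/-! ### Averaging conditional bounds over an independent variable. -/

section Conditioning

variable {Ω : Type*} [MeasurableSpace Ω] {μ : Measure Ω} [IsProbabilityMeasure μ]
  {α β : Type*} [MeasurableSpace α] [MeasurableSpace β] {X : Ω → α} {Y : Ω → β}

/-- Integrability and a bound for the integral of a nonnegative function of two independent
variables, from conditional bounds. -/
theorem integral_le_of_conditional (hXY : IndepFun X Y μ) (mX : Measurable X) (mY : Measurable Y)
    {h : α × β → ℝ} (mh : Measurable h) (h0 : ∀ p, 0 ≤ h p) {B : α → ℝ} (mB : Measurable B)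
    (iB : Integrable (fun ω => B (X ω)) μ)
    (hB : ∀ x, Integrable (fun ω => h (x, Y ω)) μ ∧ ∫ ω, h (x, Y ω) ∂μ ≤ B x) :
    Integrable (fun ω => h (X ω, Y ω)) μ ∧ ∫ ω, h (X ω, Y ω) ∂μ ≤ ∫ ω, B (X ω) ∂μ := by
  have := Measure.isProbabilityMeasure_map (μ := μ) mX.aemeasurable
  have := Measure.isProbabilityMeasure_map (μ := μ) mY.aemeasurable
  have hprod := (indepFun_iff_map_prod_eq_prod_map_map mX.aemeasurable mY.aemeasurable).1 hXY
  have mp : Measurable (fun ω => (X ω, Y ω)) := mX.prodMk mY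
  have iB' : Integrable B (μ.map X) := by
    rw [integrable_map_measure mB.aestronglyMeasurable mX.aemeasurable]; exact iB
  have inner : ∀ x, ∫ y, h (x, y) ∂(μ.map Y) = ∫ ω, h (x, Y ω) ∂μ := fun x =>
    integral_map mY.aemeasurable (mh.comp measurable_prodMk_left).aestronglyMeasurable
  have i1 : Integrable (fun x => ∫ y, h (x, y) ∂(μ.map Y)) (μ.map X) := by
    refine Integrable.mono' iB' mh.stronglyMeasurable.integral_prod_right'.aestronglyMeasurable
      (Filter.Eventually.of_forall fun x => ?_)
    rw [inner, Real.norm_eq_abs, abs_of_nonneg (integral_nonneg fun ω => h0 _)]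
    exact (hB x).2
  -- As h is nonnegative, its norm is h itself, and the conditional bounds yield joint
  -- integrability.
  have ip : Integrable h ((μ.map X).prod (μ.map Y)) := by
    rw [integrable_prod_iff mh.aestronglyMeasurable]
    refine ⟨Filter.Eventually.of_forall fun x => ?_, ?_⟩
    · exact (integrable_map_measure (mh.comp (measurable_prodMk_left (x := x))).aestronglyMeasurable
        mY.aemeasurable).2 (hB x).1
    · refine i1.congr (Filter.Eventually.of_forall fun x => ?_)
      simp only [Real.norm_eq_abs, abs_of_nonneg (h0 _)]
  constructor
  · rw [← hprod, integrable_map_measure mh.aestronglyMeasurable mp.aemeasurable] at ip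
    exact ip
  · have e : ∫ ω, h (X ω, Y ω) ∂μ = ∫ x, ∫ y, h (x, y) ∂(μ.map Y) ∂(μ.map X) := by
      rw [← integral_prod _ ip, ← hprod, integral_map mp.aemeasurable mh.aestronglyMeasurable]
    rw [e, ← integral_map mX.aemeasurable mB.aestronglyMeasurable]
    exact integral_mono i1 iB' fun x => by simpa only [inner] using (hB x).2

/-- The mean of a function of two independent variables is close to `g` if the conditional means
are. -/
theorem abs_integral_sub_le_of_conditional (hXY : IndepFun X Y μ) (mX : Measurable X)
    (mY : Measurable Y) {h : α × β → ℝ} (mh : Measurable h)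
    (ih : Integrable (fun ω => h (X ω, Y ω)) μ) {B : α → ℝ} (mB : Measurable B)
    (iB : Integrable (fun ω => B (X ω)) μ) {g : ℝ}
    (hB : ∀ x, |∫ ω, h (x, Y ω) ∂μ - g| ≤ B x) :
    |∫ ω, h (X ω, Y ω) ∂μ - g| ≤ ∫ ω, B (X ω) ∂μ := by
  have := Measure.isProbabilityMeasure_map (μ := μ) mX.aemeasurable
  have := Measure.isProbabilityMeasure_map (μ := μ) mY.aemeasurable
  have hprod := (indepFun_iff_map_prod_eq_prod_map_map mX.aemeasurable mY.aemeasurable).1 hXY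
  have mp : Measurable (fun ω => (X ω, Y ω)) := mX.prodMk mY
  have iB' : Integrable B (μ.map X) := by
    rw [integrable_map_measure mB.aestronglyMeasurable mX.aemeasurable]; exact iB
  have inner : ∀ x, ∫ y, h (x, y) ∂(μ.map Y) = ∫ ω, h (x, Y ω) ∂μ := fun x =>
    integral_map mY.aemeasurable (mh.comp measurable_prodMk_left).aestronglyMeasurable
  have ip : Integrable h ((μ.map X).prod (μ.map Y)) := by
    rw [← hprod, integrable_map_measure mh.aestronglyMeasurable mp.aemeasurable]
    exact ih
  have e : ∫ ω, h (X ω, Y ω) ∂μ = ∫ x, ∫ y, h (x, y) ∂(μ.map Y) ∂(μ.map X) := by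
    rw [← integral_prod _ ip, ← hprod, integral_map mp.aemeasurable mh.aestronglyMeasurable]
  have e2 : ∫ ω, h (X ω, Y ω) ∂μ - g = ∫ x, (∫ y, h (x, y) ∂(μ.map Y) - g) ∂(μ.map X) := by
    rw [integral_sub ip.integral_prod_left (integrable_const g), e]
    simp
  rw [e2, ← integral_map mX.aemeasurable mB.aestronglyMeasurable]
  refine norm_integral_le_of_norm_le (f := fun x => ∫ y, h (x, y) ∂(μ.map Y) - g) iB'
    (Filter.Eventually.of_forall fun x => ?_)
  rw [inner]
  exact hB x

end Conditioning

/-! ### The recursive structure of the network and the independence of successive layers. -/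

section Network

open scoped NNReal Matrix

variable {n : ℕ → ℕ} {s : ℕ}

/-- The inputs of the weights `w l` in the network: the activations of the layer `l`, or the input
itself for `l = 0`. -/
def act (σ : ℝ → ℝ) (w : ∀ l, Matrix (Fin (n (l + 1))) (Fin (n l)) ℝ) (x : Fin s → Fin (n 0) → ℝ) :
    ∀ l, Fin (n l) → Fin s → ℝ
  | 0 => fun k a => x a k
  | l + 1 => fun k a => σ (network σ w (x a) (l + 1) k)

theorem network_succ (σ : ℝ → ℝ) (w : ∀ l, Matrix (Fin (n (l + 1))) (Fin (n l)) ℝ)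
    (x : Fin s → Fin (n 0) → ℝ) (a : Fin s) (l : ℕ) (k : Fin (n (l + 1))) :
    network σ w (x a) (l + 1) k = ∑ j, w l k j * act σ w x l j a := by
  cases l <;> rfl

theorem act_succ (σ : ℝ → ℝ) (w : ∀ l, Matrix (Fin (n (l + 1))) (Fin (n l)) ℝ)
    (x : Fin s → Fin (n 0) → ℝ) (l : ℕ) :
    act σ w x (l + 1) = nextAct σ (fun p => w l p.1 p.2) (act σ w x l) := by
  ext k a
  change σ _ = σ _
  rw [network_succ]

theorem networkSample_succ (σ : ℝ → ℝ) (w : ∀ l, Matrix (Fin (n (l + 1))) (Fin (n l)) ℝ)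
    (x : Fin s → Fin (n 0) → ℝ) (l : ℕ) :
    networkSample σ w x (l + 1) =
      layer (fun p : Fin (n (l + 1)) × Fin (n l) => w l p.1 p.2) (act σ w x l) := by
  ext α
  exact network_succ σ w x α.2 l α.1

/-- The inputs of `w l` involve only weights of smaller index, which is the source of the
independence used at each layer. -/
theorem act_congr (σ : ℝ → ℝ) {w w' : ∀ l, Matrix (Fin (n (l + 1))) (Fin (n l)) ℝ}
    (x : Fin s → Fin (n 0) → ℝ) :
    ∀ l, (∀ l' < l, w l' = w' l') → act σ w x l = act σ w' x l
  | 0, _ => rfl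
  | l + 1, h => by
    rw [act_succ, act_succ, act_congr σ x l fun l' hl' => h l' (hl'.trans l.lt_succ_self),
      h l l.lt_succ_self]

theorem measurable_act {σ : ℝ → ℝ} (hσ : Measurable σ) {Z : Type*} [MeasurableSpace Z]
    {w : Z → ∀ l, Matrix (Fin (n (l + 1))) (Fin (n l)) ℝ} (x : Fin s → Fin (n 0) → ℝ)
    (hw : ∀ l i j, Measurable fun z => w z l i j) :
    ∀ l, Measurable fun z => act σ (w z) x l
  | 0 => measurable_const
  | l + 1 => by
    have ih := measurable_act hσ x hw l
    simp_rw [act_succ]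
    refine measurable_pi_lambda _ fun k => measurable_pi_lambda _ fun a => hσ.comp ?_
    refine Finset.measurable_sum _ fun j _ => (hw l k j).mul ?_
    exact (measurable_pi_apply a).comp ((measurable_pi_apply j).comp ih)

variable {Ω : Type*} [MeasurableSpace Ω] {μ : Measure Ω}
  {W : ∀ l, Ω → Matrix (Fin (n (l + 1))) (Fin (n l)) ℝ}

/-- The activations of a layer are measurable, and independent of the next weights. -/
theorem act_measurable_indep {L : ℕ} {c : ℕ → ℝ} (hW : IsRandomWeights L c μ W) {σ : ℝ → ℝ}
    (hσ : Measurable σ) (x : Fin s → Fin (n 0) → ℝ) {l : ℕ} (hl : l < L) :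
    Measurable (fun ω => act σ (fun l => W l ω) x l) ∧
      IndepFun (fun ω => act σ (fun l => W l ω) x l)
        (fun ω (p : Fin (n (l + 1)) × Fin (n l)) => W l ω p.1 p.2) μ := by
  classical
  let I := Σ l : Fin L, Fin (n (l + 1)) × Fin (n l)
  let S : Finset I := Finset.univ.filter fun k => (k.1 : ℕ) < l
  let T : Finset I := Finset.univ.filter fun k => (k.1 : ℕ) = l
  have hdis : Disjoint S T := by
    rw [Finset.disjoint_left]
    intro k hk hk'
    simp only [S, T, Finset.mem_filter, Finset.mem_univ, true_and] at hk hk'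
    omega
  have mk : ∀ k : I, Measurable (fun ω => W k.1 ω k.2.1 k.2.2) := fun k =>
    hW.measurable _ k.1.2 _ _
  have hind := hW.indep.indepFun_finset S T hdis mk
  -- The network is rebuilt from the weights in `S` alone, with 0 elsewhere. This also removes the
  -- matrices of index at least L, about which nothing is assumed, not even measurability.
  let w' : (S → ℝ) → ∀ l, Matrix (Fin (n (l + 1))) (Fin (n l)) ℝ := fun p l' i j =>
    if h : ∃ hl' : l' < L, (⟨⟨l', hl'⟩, (i, j)⟩ : I) ∈ S then p ⟨_, h.2⟩ else 0
  have mw' : ∀ l i j, Measurable fun p => w' p l i j := fun l' i j => by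
    by_cases h : ∃ hl' : l' < L, (⟨⟨l', hl'⟩, (i, j)⟩ : I) ∈ S
    · simp only [w', dif_pos h]; fun_prop
    · simp only [w', dif_neg h]; fun_prop
  have hact : (fun ω => act σ (fun l => W l ω) x l) =
      (fun p => act σ (w' p) x l) ∘ fun ω (k : S) => W k.1.1 ω k.1.2.1 k.1.2.2 := by
    ext1 ω
    refine act_congr σ x l fun l' hl' => ?_
    ext i j
    have h : ∃ hl' : l' < L, (⟨⟨l', hl'⟩, (i, j)⟩ : I) ∈ S :=
      ⟨hl'.trans hl, by simp [S, hl']⟩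
    simp only [w', dif_pos h]
  have mact := measurable_act hσ x mw' l
  rw [hact]
  let ψ : (T → ℝ) → Fin (n (l + 1)) × Fin (n l) → ℝ := fun q p =>
    q ⟨⟨⟨l, hl⟩, p⟩, by simp [T]⟩
  have hψ : Measurable ψ := by fun_prop
  exact ⟨mact.comp (measurable_pi_lambda _ fun k => mk k), hind.comp mact hψ⟩

theorem measurable_flat {L : ℕ} {c : ℕ → ℝ} (hW : IsRandomWeights L c μ W) {l : ℕ} (hl : l < L) :
    Measurable (fun ω (p : Fin (n (l + 1)) × Fin (n l)) => W l ω p.1 p.2) :=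
  measurable_pi_lambda _ fun p => hW.measurable l hl p.1 p.2

theorem IsRandomWeights.indep_layer {L : ℕ} {c : ℕ → ℝ} (hW : IsRandomWeights L c μ W) {l : ℕ}
    (hl : l < L) :
    iIndepFun (fun (p : Fin (n (l + 1)) × Fin (n l)) ω => W l ω p.1 p.2) μ :=
  hW.indep.precomp (g := fun p => (⟨⟨l, hl⟩, p⟩ : Σ l : Fin L, Fin (n (l + 1)) × Fin (n l)))
    fun p q h => by simpa using h

theorem IsRandomWeights.sq_eq [IsProbabilityMeasure μ] {L : ℕ} {c : ℕ → ℝ}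
    (hW : IsRandomWeights L c μ W) {l : ℕ} (hl : l < L) (i : Fin (n (l + 1))) (j : Fin (n l)) :
    ∫ ω, W l ω i j ^ 2 ∂μ = (c l / n l).toNNReal := by
  have h := hW.variance_eq l hl i j
  rw [variance_eq_sub (hW.memLp l hl i j), hW.centred l hl i j] at h
  rw [Real.coe_toNNReal _ (div_nonneg (hW.pos l hl).le (Nat.cast_nonneg _)), ← h]
  simp

theorem IsRandomWeights.fourthWeights [IsProbabilityMeasure μ] {L : ℕ} {c : ℕ → ℝ}
    (hW : IsRandomWeights L c μ W) {l : ℕ} (hl : l < L) {c₄ : ℝ}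
    (h4 : ∀ i j, Integrable (fun ω => W l ω i j ^ 4) μ ∧
      ∫ ω, W l ω i j ^ 4 ∂μ ≤ c₄ / (n l : ℝ) ^ 2) :
    IsFourthWeights μ (fun (p : Fin (n (l + 1)) × Fin (n l)) ω => W l ω p.1 p.2) (n l)
      (c l / n l).toNNReal c₄ :=
  ⟨hW.indep_layer hl, fun _ => hW.measurable l hl _ _, fun _ => (h4 _ _).1,
    fun _ => hW.centred l hl _ _, fun _ => hW.sq_eq hl _ _, fun _ => (h4 _ _).2⟩

theorem IsRandomWeights.thirdWeights [IsProbabilityMeasure μ] {L : ℕ} {c : ℕ → ℝ}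
    (hW : IsRandomWeights L c μ W) {l : ℕ} (hl : l < L) {c₃ : ℝ}
    (h3 : ∀ i j, Integrable (fun ω => |W l ω i j| ^ 3) μ ∧
      ∫ ω, |W l ω i j| ^ 3 ∂μ ≤ c₃ * (n l : ℝ) ^ (-(3 / 2) : ℝ)) :
    IsThirdWeights μ (fun (p : Fin (n (l + 1)) × Fin (n l)) ω => W l ω p.1 p.2) (n l)
      (c l / n l).toNNReal c₃ :=
  ⟨hW.indep_layer hl, fun _ => ⟨hW.measurable l hl _ _, (h3 _ _).1, hW.centred l hl _ _⟩,
    fun _ => hW.sq_eq hl _ _, fun _ => (h3 _ _).2⟩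

/-- The constants `c l` are thus controlled by the moment bounds, on which the final constant is
allowed to depend. -/
theorem IsRandomWeights.coeff_le [IsProbabilityMeasure μ] [∀ l, NeZero (n l)] {L : ℕ} {c : ℕ → ℝ}
    (hW : IsRandomWeights L c μ W) {l : ℕ} (hl : l < L) {c₃ : ℝ}
    (h3 : IsThirdWeights μ (fun (p : Fin (n (l + 1)) × Fin (n l)) ω => W l ω p.1 p.2) (n l)
      (c l / n l).toNNReal c₃) : c l ≤ 1 + c₃ := by
  have hn : 0 < n l := Nat.pos_of_ne_zero (NeZero.ne _)
  have h := variance_le_of_third (h3.centred (0, 0)) hn (h3.third_le _)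
  have hn' : (0 : ℝ) < n l := by positivity
  rw [h3.sq_eq, Real.coe_toNNReal _ (div_nonneg (hW.pos l hl).le (Nat.cast_nonneg _))] at h
  exact (div_le_div_iff_of_pos_right hn').1 h

end Network

/-! ### Covariances of the limiting fields. -/

section Limit

open scoped NNReal Matrix RealInnerProductSpace

variable {n : ℕ → ℕ} [∀ l, NeZero (n l)] {s : ℕ}

/-- Each row of the limit has the same law whatever the number of rows, so the recursion for
covariances can be written with one row and without the widths. -/
theorem gaussLaw_map_row {R : Type*} [Fintype R] [DecidableEq R] {Γ : Matrix (Fin s) (Fin s) ℝ}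
    (hΓ : Γ.PosSemidef) (i : R) :
    (gaussLaw R Γ).map (fun g => (WithLp.toLp 2 fun p : Unit × Fin s => g (i, p.2))) =
      gaussLaw Unit Γ := by
  have hm : Measurable (fun g : EuclideanSpace ℝ (R × Fin s) =>
      (WithLp.toLp 2 fun p : Unit × Fin s => g (i, p.2))) := by fun_prop
  have := Measure.isProbabilityMeasure_map (μ := gaussLaw R Γ) hm.aemeasurable
  apply Measure.ext_of_charFun
  ext t
  rw [charFun_map_of_inner (r := WithLp.toLp 2 fun p : R × Fin s =>
    if p.1 = i then t ((), p.2) else 0) _ hm]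
  · unfold gaussLaw
    rw [charFun_multivariateGaussian (blockCov_posSemidef hΓ),
      charFun_multivariateGaussian (blockCov_posSemidef hΓ), blockCov_quadratic, blockCov_quadratic]
    congr 2
    · simp
    · congr 2
      rw [Finset.sum_eq_single i]
      · simp
      · intro j _ hj
        simp only [hj, if_false]
        exact zero_dotProduct _
      · simp
  · intro g
    simp [PiLp.inner_apply, Fintype.sum_prod_type]

/-- The common covariance of the rows of the limit of the layer `l + 1`. -/
noncomputable def limitCov (σ : ℝ → ℝ) (c : ℕ → ℝ)
    (ν : Measure (EuclideanSpace ℝ (Fin (n 1) × Fin s))) (l : ℕ) : Matrix (Fin s) (Fin s) ℝ :=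
  c l • Matrix.of fun a b => ∫ g, σ (g (0, a)) * σ (g (0, b)) ∂limitLaw σ c ν l

theorem limitLaw_succ_succ (σ : ℝ → ℝ) (c : ℕ → ℝ)
    (ν : Measure (EuclideanSpace ℝ (Fin (n 1) × Fin s))) (l : ℕ) :
    limitLaw σ c ν (l + 2) = gaussLaw (Fin (n (l + 2))) (limitCov σ c ν (l + 1)) := rfl

/-- Positivity is assumed because the explicit characteristic function of `multivariateGaussian`
requires it; it is established along the induction. -/
theorem limitCov_succ_succ {σ : ℝ → ℝ} (hσ : Measurable σ) (c : ℕ → ℝ)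
    (ν : Measure (EuclideanSpace ℝ (Fin (n 1) × Fin s))) (l : ℕ)
    (hΓ : (limitCov σ c ν (l + 1)).PosSemidef) :
    limitCov σ c ν (l + 2) = c (l + 2) • gaussMean σ (limitCov σ c ν (l + 1)) := by
  rw [limitCov, limitLaw_succ_succ]
  congr 1
  ext a b
  simp only [Matrix.of_apply, gaussMean]
  rw [← gaussLaw_map_row hΓ (0 : Fin (n (l + 2))), integral_map (by fun_prop)]
  exact Measurable.aestronglyMeasurable (by fun_prop)

/-- The quadratic form at x is the mean of (Σ x_a p_a)², and t² ≤ 1 + t⁴ bounds the diagonal. -/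
theorem gram_posSemidef {E : Type*} [MeasurableSpace E] {θ : Measure E} [IsProbabilityMeasure θ]
    {p : Fin s → E → ℝ} (mp : ∀ a, Measurable (p a)) (ip : ∀ a, Integrable (fun g => p a g ^ 4) θ)
    {H : ℝ} (hp : ∀ a, ∫ g, p a g ^ 4 ∂θ ≤ H) {c C : ℝ} (hc : 0 ≤ c) (hcC : c ≤ C) :
    (c • Matrix.of fun a b => ∫ g, p a g * p b g ∂θ).PosSemidef ∧
      ∀ a, (c • Matrix.of fun a b => ∫ g, p a g * p b g ∂θ) a a ≤ C * (1 + H) := by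
  have i2 : ∀ a, Integrable (fun g => p a g ^ 2) θ := fun a =>
    integrable_pow_of_four (mp a) (ip a) (by norm_num)
  have iab : ∀ a b, Integrable (fun g => p a g * p b g) θ := fun a b =>
    ((memLp_two_iff_integrable_sq (mp a).aestronglyMeasurable).2 (i2 a)).integrable_mul
      ((memLp_two_iff_integrable_sq (mp b).aestronglyMeasurable).2 (i2 b))
  constructor
  · refine Matrix.PosSemidef.smul (posSemidef_of_quadratic ?_ fun x => ?_) hc
    · ext a b
      simp [Matrix.conjTranspose_apply, mul_comm]
    · have : x ⬝ᵥ (Matrix.of fun a b => ∫ g, p a g * p b g ∂θ) *ᵥ x =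
          ∫ g, (∑ a, x a * p a g) ^ 2 ∂θ := by
        have e : ∀ g, (∑ a, x a * p a g) ^ 2 = ∑ a, ∑ b, x a * (p a g * p b g * x b) := fun g => by
          rw [sq, Finset.sum_mul_sum]
          exact Finset.sum_congr rfl fun a _ => Finset.sum_congr rfl fun b _ => by ring
        simp_rw [e]
        rw [integral_finsetSum _ fun a _ => integrable_finsetSum _ fun b _ =>
          ((iab a b).mul_const _).const_mul _]
        simp only [dotProduct, Matrix.mulVec, Matrix.of_apply, Finset.mul_sum]
        refine Finset.sum_congr rfl fun a _ => ?_
        rw [integral_finsetSum _ fun b _ => ((iab a b).mul_const _).const_mul _]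
        refine Finset.sum_congr rfl fun b _ => ?_
        rw [integral_const_mul, integral_mul_const]
      rw [this]
      exact integral_nonneg fun g => sq_nonneg _
  · intro a
    simp only [Matrix.smul_apply, Matrix.of_apply, smul_eq_mul, ← sq]
    have h1 : ∫ g, p a g ^ 2 ∂θ ≤ 1 + H := by
      calc ∫ g, p a g ^ 2 ∂θ ≤ ∫ g, (1 + p a g ^ 4) ∂θ :=
            integral_mono (i2 a) ((integrable_const 1).add (ip a)) fun g => by
              simpa using abs_pow_le_one_add_pow_four (p a g) (k := 2) (by norm_num)
        _ = 1 + ∫ g, p a g ^ 4 ∂θ := by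
            rw [integral_add (integrable_const _) (ip a)]; simp
        _ ≤ 1 + H := by have := hp a; linarith
    have h0 : 0 ≤ ∫ g, p a g ^ 2 ∂θ := integral_nonneg fun g => sq_nonneg _
    calc _ ≤ C * ∫ g, p a g ^ 2 ∂θ := by gcongr
      _ ≤ _ := by
        have := hc.trans hcC
        gcongr

end Limit

/-! ### The rate of convergence and its recursion. -/

section Rate

/-- The rate of convergence of the first `l` layers. -/
noncomputable def rate (n : ℕ → ℕ) (l : ℕ) : ℝ :=
  ∑ m ∈ Finset.Icc 1 l, (n m : ℝ) ^ (-((1 / 6 : ℝ) ^ (l + 1 - m)))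

theorem rate_nonneg (n : ℕ → ℕ) (l : ℕ) : 0 ≤ rate n l :=
  Finset.sum_nonneg fun _ _ => by positivity

theorem rpow_sum_le_sum_rpow {ι : Type*} (S : Finset ι) {f : ι → ℝ} (hf : ∀ i, 0 ≤ f i) {p : ℝ}
    (hp : 0 < p) (hp1 : p ≤ 1) : (∑ i ∈ S, f i) ^ p ≤ ∑ i ∈ S, f i ^ p := by
  classical
  induction S using Finset.induction_on with
  | empty => simp [Real.zero_rpow hp.ne']
  | insert i S hi ih =>
    rw [Finset.sum_insert hi, Finset.sum_insert hi]
    exact (Real.rpow_add_le_add_rpow (hf i) (Finset.sum_nonneg fun _ _ => hf _) hp.le hp1).trans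
      (by gcongr)

variable {n : ℕ → ℕ} [∀ l, NeZero (n l)]

theorem one_le_width (l : ℕ) : (1 : ℝ) ≤ n l := by
  exact_mod_cast Nat.one_le_iff_ne_zero.2 (NeZero.ne (n l))

theorem rate_succ (l : ℕ) : rate n (l + 1) =
    ∑ m ∈ Finset.Icc 1 l, (n m : ℝ) ^ (-((1 / 6 : ℝ) ^ (l + 2 - m))) +
      (n (l + 1) : ℝ) ^ (-(1 / 6) : ℝ) := by
  rw [rate, Finset.sum_Icc_succ_top (by omega)]
  congr 2
  rw [show l + 1 + 1 - (l + 1) = 1 by omega]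
  norm_num

theorem width_le_rate (l : ℕ) : (n (l + 1) : ℝ) ^ (-(1 / 6) : ℝ) ≤ rate n (l + 1) := by
  rw [rate_succ]
  exact le_add_of_nonneg_left (Finset.sum_nonneg fun _ _ => by positivity)

theorem rate_pos (l : ℕ) : 0 < rate n (l + 1) :=
  lt_of_lt_of_le (Real.rpow_pos_of_pos (zero_lt_one.trans_le (one_le_width _)) _) (width_le_rate l)

/-- The power 1/3 is subadditive and divides the exponents by 3 only, whereas the definition of
`rate` divides them by 6; all widths are at least 1. -/
theorem rate_step (l : ℕ) :
    rate n l ^ (1 / 3 : ℝ) + (n (l + 1) : ℝ) ^ (-(1 / 6) : ℝ) ≤ rate n (l + 1) := by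
  rw [rate_succ]
  gcongr
  refine (rpow_sum_le_sum_rpow _ (fun m => by positivity) (by norm_num) (by norm_num)).trans ?_
  refine Finset.sum_le_sum fun m hm => ?_
  rw [Finset.mem_Icc] at hm
  rw [← Real.rpow_mul (Nat.cast_nonneg _)]
  refine Real.rpow_le_rpow_of_exponent_le (one_le_width m) ?_
  rw [show l + 2 - m = l + 1 - m + 1 by omega, pow_succ]
  have : (0 : ℝ) < (1 / 6 : ℝ) ^ (l + 1 - m) := by positivity
  linarith

/-- The square of the rate dominates the terms of the recursion for the covariances. -/
theorem rate_terms_le (l : ℕ) : (n (l + 2) : ℝ) ^ (-(1 / 2) : ℝ) ≤ rate n (l + 2) ^ 2 ∧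
    rate n (l + 1) ^ (2 / 3 : ℝ) ≤ rate n (l + 2) ^ 2 := by
  have h := rate_step (n := n) (l + 1)
  have h0 := (rate_pos (n := n) l).le
  have p1 : 0 ≤ rate n (l + 1) ^ (1 / 3 : ℝ) := by positivity
  have p2 : (0 : ℝ) ≤ (n (l + 2) : ℝ) ^ (-(1 / 6) : ℝ) := by positivity
  constructor
  -- The law of large numbers gives (width)^(-1/2), better than the square of (width)^(-1/6) that is
  -- required.
  · calc (n (l + 2) : ℝ) ^ (-(1 / 2) : ℝ) ≤ (n (l + 2) : ℝ) ^ (-(1 / 3) : ℝ) :=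
          Real.rpow_le_rpow_of_exponent_le (one_le_width _) (by norm_num)
      _ = ((n (l + 2) : ℝ) ^ (-(1 / 6) : ℝ)) ^ 2 := by
          rw [← Real.rpow_natCast, ← Real.rpow_mul (Nat.cast_nonneg _)]; norm_num
      _ ≤ _ := by gcongr; linarith
  · calc rate n (l + 1) ^ (2 / 3 : ℝ) = (rate n (l + 1) ^ (1 / 3 : ℝ)) ^ 2 := by
          rw [← Real.rpow_natCast, ← Real.rpow_mul h0]; norm_num
      _ ≤ _ := by gcongr; linarith

theorem rate_one_sq : (n 1 : ℝ) ^ (-(1 / 2) : ℝ) ≤ rate n 1 ^ 2 := by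
  calc (n 1 : ℝ) ^ (-(1 / 2) : ℝ) ≤ (n 1 : ℝ) ^ (-(1 / 3) : ℝ) :=
        Real.rpow_le_rpow_of_exponent_le (one_le_width _) (by norm_num)
    _ = ((n 1 : ℝ) ^ (-(1 / 6) : ℝ)) ^ 2 := by
        rw [← Real.rpow_natCast, ← Real.rpow_mul (Nat.cast_nonneg _)]; norm_num
    _ ≤ _ := by gcongr; exact width_le_rate 0

end Rate

/-! ### Uniform hypotheses and the law of the first layer. -/

section Invariant

open scoped NNReal Matrix

/-- Random weights with uniform bounds for their moments and for the input. -/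
structure IsControlled (L : ℕ) (c₄ c₃ X₀ : ℝ) {n : ℕ → ℕ} (c : ℕ → ℝ) {Ω : Type*}
    [MeasurableSpace Ω] (μ : Measure Ω) (W : ∀ l, Ω → Matrix (Fin (n (l + 1))) (Fin (n l)) ℝ)
    {s : ℕ} (x : Fin s → Fin (n 0) → ℝ) : Prop where
  weights : IsRandomWeights L c μ W
  fourth : ∀ l, l + 2 ≤ L → ∀ i j, Integrable (fun ω => W l ω i j ^ 4) μ ∧
    ∫ ω, W l ω i j ^ 4 ∂μ ≤ c₄ / (n l : ℝ) ^ 2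
  third : ∀ l, l + 1 = L → ∀ i j, Integrable (fun ω => |W l ω i j| ^ 3) μ ∧
    ∫ ω, |W l ω i j| ^ 3 ∂μ ≤ c₃ * (n l : ℝ) ^ (-(3 / 2) : ℝ)
  input : fourthAvg (fun k a => x a k) ≤ X₀

variable {L : ℕ} {c₄ c₃ X₀ : ℝ} {n : ℕ → ℕ} [∀ l, NeZero (n l)] {c : ℕ → ℝ} {Ω : Type*}
  [MeasurableSpace Ω] {μ : Measure Ω} [IsProbabilityMeasure μ]
  {W : ∀ l, Ω → Matrix (Fin (n (l + 1))) (Fin (n l)) ℝ} {s : ℕ} {x : Fin s → Fin (n 0) → ℝ}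
  {σ : ℝ → ℝ} {K : ℝ≥0}

theorem IsControlled.fourthWeights (h : IsControlled L c₄ c₃ X₀ c μ W x) {l : ℕ}
    (hl : l + 2 ≤ L) : IsFourthWeights μ
      (fun (p : Fin (n (l + 1)) × Fin (n l)) ω => W l ω p.1 p.2) (n l) (c l / n l).toNNReal c₄ :=
  h.weights.fourthWeights (by omega) (h.fourth l hl)

theorem IsControlled.coeff_le (h : IsControlled L c₄ c₃ X₀ c μ W x) (h4 : 0 ≤ c₄) (h3 : 0 ≤ c₃)
    {l : ℕ} (hl : l < L) : c l ≤ 2 + c₄ + c₃ := by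
  rcases (Nat.succ_le_of_lt hl).eq_or_lt with h' | h'
  · have := h.weights.coeff_le hl (h.weights.thirdWeights hl (h.third l h'))
    linarith
  · have := h.weights.coeff_le hl ((h.fourthWeights h').third (Nat.pos_of_ne_zero (NeZero.ne _)))
    linarith

theorem fourthAvg_measurable {m s : ℕ} :
    Measurable (fourthAvg : (Fin m → Fin s → ℝ) → ℝ) := by
  unfold fourthAvg; fun_prop

theorem covDist_empCov_measurable {m s : ℕ} (V : ℝ) (Γ : Matrix (Fin s) (Fin s) ℝ) :
    Measurable (fun y : Fin m → Fin s → ℝ => covDist (empCov V y) Γ) := by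
  unfold covDist empCov
  simp only [Matrix.of_apply]
  fun_prop

/-- Rows of the first weight matrix have the same law. -/
theorem IsRandomWeights.integral_row_eq (h : IsRandomWeights L c μ W) (hL : 0 < L)
    {f : (Fin (n 0) → ℝ) → ℝ} (hf : Measurable f) (k k' : Fin (n 1)) :
    ∫ ω, f (W 0 ω k) ∂μ = ∫ ω, f (W 0 ω k') ∂μ := by
  have mr : ∀ k : Fin (n 1), ∀ j, AEMeasurable (fun ω => W 0 ω k j) μ := fun k j =>
    (h.measurable 0 hL k j).aemeasurable
  have law : ∀ k : Fin (n 1), μ.map (fun ω j => W 0 ω k j) =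
      Measure.pi fun j => μ.map (fun ω => W 0 ω k j) := fun k =>
    (iIndepFun_iff_map_fun_eq_pi_map (mr k)).1
      ((h.indep_layer hL).precomp (g := fun j : Fin (n 0) => (k, j)) fun i j e => by simpa using e)
  have e : μ.map (fun ω j => W 0 ω k j) = μ.map (fun ω j => W 0 ω k' j) := by
    rw [law, law]
    congr 1
    ext1 j
    exact (h.identDistrib k k' j).map_eq
  rw [← integral_map (f := f) (φ := fun ω j => W 0 ω k j) (aemeasurable_pi_lambda _ (mr k))
    hf.aestronglyMeasurable, e, integral_map (aemeasurable_pi_lambda _ (mr k'))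
    hf.aestronglyMeasurable]

/-- The covariance of the second layer of the limit, from the law of the first layer. -/
theorem limitCov_one (h : IsRandomWeights L c μ W) (hL : 0 < L) (hσ : Measurable σ) :
    limitCov σ c (networkLaw σ μ W x 1) 1 = c 1 • Matrix.of fun a b =>
      ∫ ω, nextAct σ (fun p : Fin (n 1) × Fin (n 0) => W 0 ω p.1 p.2) (fun k a => x a k) 0 a *
        nextAct σ (fun p : Fin (n 1) × Fin (n 0) => W 0 ω p.1 p.2) (fun k a => x a k) 0 b ∂μ := by
  unfold limitCov
  congr 1
  ext a b
  simp only [Matrix.of_apply]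
  have mF : Measurable (fun ω => networkSample σ (fun l => W l ω) x 1) := by
    have := measurable_flat h hL
    refine (WithLp.measurable_toLp 2 _).comp (measurable_pi_lambda _ fun α => ?_)
    simp only [network, Matrix.mulVec, dotProduct]
    exact Finset.measurable_sum _ fun j _ => (h.measurable 0 hL _ _).mul_const _
  change ∫ g, _ ∂(networkLaw σ μ W x 1) = _
  rw [networkLaw, integral_map mF.aemeasurable (Measurable.aestronglyMeasurable (by fun_prop))]
  rfl

end Invariant

/-! ### Induction over the hidden layers. -/

section Induction

open scoped NNReal Matrix

variable {L : ℕ} {c₄ c₃ X₀ : ℝ} {n : ℕ → ℕ} [∀ l, NeZero (n l)] {c : ℕ → ℝ} {Ω : Type*}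
  [MeasurableSpace Ω] {μ : Measure Ω} [IsProbabilityMeasure μ]
  {W : ∀ l, Ω → Matrix (Fin (n (l + 1))) (Fin (n l)) ℝ} {s : ℕ} {x : Fin s → Fin (n 0) → ℝ}
  {σ : ℝ → ℝ} {K : ℝ≥0}

/-- The activations of the layer `l + 1` have a fourth moment, and their empirical covariances are
close to the limit. -/
structure LayerBound (σ : ℝ → ℝ) (c : ℕ → ℝ) (μ : Measure Ω)
    (W : ∀ l, Ω → Matrix (Fin (n (l + 1))) (Fin (n l)) ℝ) (x : Fin s → Fin (n 0) → ℝ) (l : ℕ)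
    (M B C : ℝ) : Prop where
  mean_integrable : Integrable (fun ω => fourthAvg (act σ (fun l => W l ω) x (l + 1))) μ
  mean_le : ∫ ω, fourthAvg (act σ (fun l => W l ω) x (l + 1)) ∂μ ≤ M
  posSemidef : (limitCov σ c (networkLaw σ μ W x 1) (l + 1)).PosSemidef
  diag_le : ∀ a, limitCov σ c (networkLaw σ μ W x 1) (l + 1) a a ≤ B
  dist_integrable : Integrable (fun ω => covDist (empCov (c (l + 1) / n (l + 1))
    (act σ (fun l => W l ω) x (l + 1))) (limitCov σ c (networkLaw σ μ W x 1) (l + 1))) μ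
  dist_le : ∫ ω, covDist (empCov (c (l + 1) / n (l + 1))
    (act σ (fun l => W l ω) x (l + 1))) (limitCov σ c (networkLaw σ μ W x 1) (l + 1)) ∂μ ≤
      C * rate n (l + 1) ^ 2

/-- The first layer has exactly the law of its limit and its rows are identically distributed, so
there is no error in the means: only the fluctuation (width)^(-1/2) of the average remains. -/
theorem layerBound_zero (hσ : LipschitzWith K σ) (h4 : 0 ≤ c₄) (h3 : 0 ≤ c₃)
    (h : IsControlled L c₄ c₃ X₀ c μ W x) (hL : 2 ≤ L) :
    LayerBound σ c μ W x 0 (s * actConst σ K c₄ * (1 + X₀))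
      ((2 + c₄ + c₃) * (1 + actConst σ K c₄ * (1 + X₀)))
      ((2 + c₄ + c₃) * s ^ 2 * (1 + actConst σ K c₄ * (1 + X₀))) := by
  have hA := actConst_nonneg σ K h4
  have hw := h.fourthWeights (l := 0) hL
  have hpos : ∀ l, 0 < n l := fun l => Nat.pos_of_ne_zero (NeZero.ne _)
  have hcC := h.coeff_le h4 h3 (l := 1) (by omega)
  have hc0 := (h.weights.pos 1 (by omega)).le
  have hX := h.input
  have hmean := fourthAvg_nextAct hσ (hpos 1) (hpos 0) hw h4 (fun k a => x a k)
  have hm : ∀ k a, Measurable fun ω => nextAct σ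
      (fun p : Fin (n 1) × Fin (n 0) => W 0 ω p.1 p.2) (fun k a => x a k) k a := fun k a =>
    hσ.continuous.measurable.comp (measurable_preact hw.measurable (fun k a => x a k) k a)
  have hgram := gram_posSemidef (fun a => hm 0 a)
    (fun a => (nextAct_fourth hσ (hpos 0) hw h4 (fun k a => x a k) 0 a).1)
    (fun a => (nextAct_fourth hσ (hpos 0) hw h4 (fun k a => x a k) 0 a).2.trans
      (mul_le_mul_of_nonneg_left (add_le_add_right hX 1) hA)) hc0 hcC
  have hd := covDist_nextAct hσ (hpos 1) (hpos 0) hw h4 (fun k a => x a k)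
    (g := Matrix.of fun a b =>
      ∫ ω, nextAct σ (fun p : Fin (n 1) × Fin (n 0) => W 0 ω p.1 p.2) (fun k a => x a k) 0 a *
        nextAct σ (fun p : Fin (n 1) × Fin (n 0) => W 0 ω p.1 p.2) (fun k a => x a k) 0 b ∂μ)
    (e := 0) (fun k a b => by
      have := h.weights.integral_row_eq (by omega)
        (f := fun r => σ (∑ j, r j * x a j) * σ (∑ j, r j * x b j))
        (by have := hσ.continuous.measurable; fun_prop) k 0
      rw [Matrix.of_apply, abs_nonpos_iff, sub_eq_zero]
      exact this) hc0
  have hlim := limitCov_one (x := x) h.weights (by omega) hσ.continuous.measurable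
  refine ⟨hmean.1, hmean.2.trans ?_, hlim ▸ hgram.1, fun a => hlim ▸ hgram.2 a, ?_, ?_⟩
  · gcongr
  · rw [hlim]; exact hd.1
  · rw [hlim]
    refine hd.2.trans ?_
    have hq : 0 ≤ fourthAvg (fun (k : Fin (n 0)) a => x a k) := fourthAvg_nonneg _
    have hr := rate_one_sq (n := n)
    rw [add_zero]
    calc _ ≤ (2 + c₄ + c₃) * s ^ 2 * (rate n 1 ^ 2 * (1 + actConst σ K c₄ * (1 + X₀))) := by
          gcongr
      _ = _ := by ring

/-- The activations of one layer are independent of the weights that follow, so the conditional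
bounds integrate. Their linearity in the fourth powers and in the covariance distance makes the
previous means sufficient. -/
theorem layerBound_succ (hσ : LipschitzWith K σ) (h4 : 0 ≤ c₄) (h3 : 0 ≤ c₃)
    (h : IsControlled L c₄ c₃ X₀ c μ W x) {l : ℕ} (hL : l + 3 ≤ L) {M B C : ℝ}
    (hb : LayerBound σ c μ W x l M B C) :
    LayerBound σ c μ W x (l + 1) (s * actConst σ K c₄ * (1 + M))
      ((2 + c₄ + c₃) * (1 + gaussActConst σ K B))
      (stepConst s σ K c₄ B (2 + c₄ + c₃) * (2 * (1 + M) + C)) := by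
  have hA := actConst_nonneg σ K h4
  have hw := h.fourthWeights (l := l + 1) hL
  have hpos : ∀ l, 0 < n l := fun l => Nat.pos_of_ne_zero (NeZero.ne _)
  have hcC := h.coeff_le h4 h3 (l := l + 2) (by omega)
  have hc0 := (h.weights.pos (l + 2) (by omega)).le
  obtain ⟨mX, hXY⟩ := act_measurable_indep h.weights hσ.continuous.measurable x
    (l := l + 1) (by omega)
  have mY := measurable_flat h.weights (l := l + 1) (by omega)
  have hV : (((c (l + 1) / n (l + 1)).toNNReal : ℝ≥0) : ℝ) = c (l + 1) / n (l + 1) :=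
    Real.coe_toNNReal _ (div_nonneg (h.weights.pos _ (by omega)).le (Nat.cast_nonneg _))
  set Γ := limitCov σ c (networkLaw σ μ W x 1) (l + 1) with hΓ
  have hlim : limitCov σ c (networkLaw σ μ W x 1) (l + 2) = c (l + 2) • gaussMean σ Γ :=
    limitCov_succ_succ hσ.continuous.measurable c _ l hb.posSemidef
  have mnext : Measurable fun p : (Fin (n (l + 1)) → Fin s → ℝ) ×
      (Fin (n (l + 2)) × Fin (n (l + 1)) → ℝ) => nextAct σ p.2 p.1 := by
    have := hσ.continuous.measurable
    unfold nextAct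
    fun_prop
  have mcoord : ∀ a, Measurable fun g : EuclideanSpace ℝ (Unit × Fin s) => σ (g ((), a)) :=
    fun a => hσ.continuous.measurable.comp (by fun_prop)
  have hfour : ∀ a, Integrable (fun g : EuclideanSpace ℝ (Unit × Fin s) => σ (g ((), a)) ^ 4)
      (gaussLaw Unit Γ) ∧ ∫ g : EuclideanSpace ℝ (Unit × Fin s), σ (g ((), a)) ^ 4
        ∂(gaussLaw Unit Γ) ≤ gaussActConst σ K B := fun a => by
    obtain ⟨g1, g2⟩ := gaussLaw_fourth hb.posSemidef ((), a)
    obtain ⟨g3, g4⟩ := integrable_comp_pow_four hσ (by fun_prop) g1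
    refine ⟨g3, g4.trans ?_⟩
    rw [g2, probReal_univ, mul_one, gaussActConst]
    have := gaussFourth_nonneg
    have := hb.posSemidef.diag_nonneg (i := a)
    have := hb.diag_le a
    gcongr
  have hgram := gram_posSemidef mcoord (fun a => (hfour a).1) (fun a => (hfour a).2) hc0 hcC
  have i1 : Integrable (fun ω => 1 + fourthAvg (act σ (fun l => W l ω) x (l + 1))) μ :=
    (integrable_const 1).add hb.mean_integrable
  have hmean := integral_le_of_conditional hXY mX mY
    (h := fun p => fourthAvg (nextAct σ p.2 p.1)) (fourthAvg_measurable.comp mnext)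
    (fun p => fourthAvg_nonneg _) (B := fun y => s * actConst σ K c₄ * (1 + fourthAvg y))
    (by have := @fourthAvg_measurable (n (l + 1)) s; fun_prop)
    (i1.const_mul _)
    fun y => fourthAvg_nextAct hσ (hpos _) (hpos _) hw h4 y
  have hS := rate_pos (n := n) l
  set S := rate n (l + 1) with hSdef
  set D := stepConst s σ K c₄ B (2 + c₄ + c₃)
  have hD : 0 ≤ D := stepConst_nonneg s σ K h4 B (by positivity)
  have iB : Integrable (fun ω => D * (((n (l + 2) : ℝ) ^ (-(1 / 2) : ℝ) + S ^ (2 / 3 : ℝ)) *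
        (1 + fourthAvg (act σ (fun l => W l ω) x (l + 1))) + S ^ (-(4 / 3) : ℝ) *
        covDist (empCov (c (l + 1) / n (l + 1)) (act σ (fun l => W l ω) x (l + 1))) Γ)) μ :=
    ((i1.const_mul _).add
      (hb.dist_integrable.const_mul _)).const_mul _
  have hdist := integral_le_of_conditional hXY mX mY
    (h := fun p => covDist (empCov (c (l + 2) / n (l + 2)) (nextAct σ p.2 p.1))
      (c (l + 2) • gaussMean σ Γ)) ((covDist_empCov_measurable _ _).comp mnext)
    (fun p => covDist_nonneg _ _)
    (B := fun y => D * (((n (l + 2) : ℝ) ^ (-(1 / 2) : ℝ) + S ^ (2 / 3 : ℝ)) *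
        (1 + fourthAvg y) + S ^ (-(4 / 3) : ℝ) *
        covDist (empCov (c (l + 1) / n (l + 1)) y) Γ))
    (by
      have m1 := @fourthAvg_measurable (n (l + 1)) s
      have m2 := covDist_empCov_measurable (m := n (l + 1)) (c (l + 1) / n (l + 1)) Γ
      fun_prop) iB
    fun y => by
      have := covDist_nextAct_gauss hσ (hpos (l + 2)) (hpos _) hw h4 y hb.posSemidef hb.diag_le hS
        (width_le_rate l) hc0 hcC
      rwa [hV] at this
  refine ⟨?_, ?_, ?_, ?_, ?_, ?_⟩
  · simp_rw [act_succ σ _ x (l + 1)]; exact hmean.1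
  · simp_rw [act_succ σ _ x (l + 1)]
    refine hmean.2.trans ?_
    rw [integral_const_mul, integral_add (integrable_const _) hb.mean_integrable]
    have := hb.mean_le
    simp only [integral_const, probReal_univ, smul_eq_mul, one_mul]
    gcongr
  · rw [hlim]; exact hgram.1
  · rw [hlim]; exact hgram.2
  · simp_rw [act_succ σ _ x (l + 1)]; rw [hlim]; exact hdist.1
  · simp_rw [act_succ σ _ x (l + 1)]; rw [hlim]
    refine hdist.2.trans ?_
    rw [integral_const_mul, integral_add (i1.const_mul _)
      (hb.dist_integrable.const_mul _), integral_const_mul, integral_const_mul,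
      integral_add (integrable_const _) hb.mean_integrable]
    simp only [integral_const, probReal_univ, smul_eq_mul, one_mul]
    obtain ⟨r1, r2⟩ := rate_terms_le (n := n) l
    have q0 : 0 ≤ ∫ ω, fourthAvg (act σ (fun l => W l ω) x (l + 1)) ∂μ :=
      integral_nonneg fun ω => fourthAvg_nonneg _
    -- `C` bounds a nonnegative mean divided by a positive squared rate.
    have hC : 0 ≤ C := by
      have := (integral_nonneg fun ω => covDist_nonneg (empCov (c (l + 1) / n (l + 1))
        (act σ (fun l => W l ω) x (l + 1))) Γ).trans hb.dist_le
      exact nonneg_of_mul_nonneg_left this (by positivity)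
    -- The hypothesis E δ ≤ C S² turns the term S^(-4/3) δ into C S^(2/3), the order of the other
    -- errors.
    have hpow : S ^ (-(4 / 3) : ℝ) * (C * S ^ 2) = C * S ^ (2 / 3 : ℝ) := by
      rw [mul_left_comm, ← Real.rpow_natCast S 2, ← Real.rpow_add hS]
      norm_num
    calc _ ≤ D * ((rate n (l + 2) ^ 2 + rate n (l + 2) ^ 2) * (1 + M) +
          S ^ (-(4 / 3) : ℝ) * (C * S ^ 2)) := by
          have := hb.mean_le
          have := hb.dist_le
          gcongr
      _ ≤ D * ((rate n (l + 2) ^ 2 + rate n (l + 2) ^ 2) * (1 + M) + C * rate n (l + 2) ^ 2) := by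
          rw [hpow]; gcongr
      _ = _ := by ring

/-- The constants are chosen before the widths, the probability space and the weights; this order is
what makes the final constant uniform. -/
theorem exists_layerBound.{u} {σ : ℝ → ℝ} {K : ℝ≥0} (hσ : LipschitzWith K σ) (L s : ℕ)
    {c₄ c₃ X₀ : ℝ} (h4 : 0 ≤ c₄) (h3 : 0 ≤ c₃) (l : ℕ) :
    ∃ M B C : ℝ, ∀ {n : ℕ → ℕ} [∀ l, NeZero (n l)] {c : ℕ → ℝ} {Ω : Type u}
      [MeasurableSpace Ω] {μ : Measure Ω} [IsProbabilityMeasure μ]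
      {W : ∀ l, Ω → Matrix (Fin (n (l + 1))) (Fin (n l)) ℝ} {x : Fin s → Fin (n 0) → ℝ},
      IsControlled L c₄ c₃ X₀ c μ W x → l + 2 ≤ L → LayerBound σ c μ W x l M B C := by
  induction l with
  | zero => exact ⟨_, _, _, fun h hl => layerBound_zero hσ h4 h3 h hl⟩
  | succ l ih =>
    obtain ⟨M, B, C, hb⟩ := ih
    exact ⟨_, _, _, fun h hl => layerBound_succ hσ h4 h3 h hl (hb h (by omega))⟩

end Induction

/-! ### The last layer. -/

section Core

open scoped NNReal Matrix

variable {L : ℕ} {c₄ c₃ X₀ : ℝ} {n : ℕ → ℕ} [∀ l, NeZero (n l)] {c : ℕ → ℝ} {Ω : Type*}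
  [MeasurableSpace Ω] {μ : Measure Ω} [IsProbabilityMeasure μ]
  {W : ∀ l, Ω → Matrix (Fin (n (l + 1))) (Fin (n l)) ℝ} {s : ℕ} {x : Fin s → Fin (n 0) → ℝ}
  {σ : ℝ → ℝ} {K : ℝ≥0}

theorem integrable_of_fourthAvg {m : ℕ} (hm : 0 < m) {Y : Ω → Fin m → Fin s → ℝ}
    (mY : Measurable Y) (iY : Integrable (fun ω => fourthAvg (Y ω)) μ) (k : Fin m) (a : Fin s) :
    Integrable (fun ω => Y ω k a) μ := by
  refine Integrable.mono' ((integrable_const 1).add (iY.const_mul (m : ℝ)))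
    (by fun_prop) (Filter.Eventually.of_forall fun ω => ?_)
  have h1 := abs_pow_le_one_add_pow_four (Y ω k a) (k := 1) (by norm_num)
  have h2 : Y ω k a ^ 4 ≤ m * fourthAvg (Y ω) := by
    have : (m : ℝ) ≠ 0 := by positivity
    rw [fourthAvg, mul_inv_cancel_left₀ this]
    exact (Finset.single_le_sum (f := fun a => Y ω k a ^ 4) (fun _ _ => by positivity)
      (Finset.mem_univ a)).trans (Finset.single_le_sum (f := fun k => ∑ a, Y ω k a ^ 4)
      (fun _ _ => by positivity) (Finset.mem_univ k))
  rw [pow_one] at h1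
  simp only [Real.norm_eq_abs, Pi.add_apply]
  linarith

theorem measurable_layer {m n : ℕ} {s : ℕ} : Measurable fun p : (Fin n → Fin s → ℝ) ×
    (Fin m × Fin n → ℝ) => layer p.2 p.1 := by
  unfold layer
  refine (WithLp.measurable_toLp 2 _).comp (measurable_pi_lambda _ fun α => ?_)
  fun_prop

/-- Each entry is a finite sum of products of independent integrable variables. -/
theorem integrable_networkSample (hW : IsRandomWeights L c μ W) (hσ : Measurable σ) {l : ℕ}
    (hl : l < L) (hact : ∀ k a, Integrable (fun ω => act σ (fun l => W l ω) x l k a) μ) :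
    Measurable (fun ω => networkSample σ (fun l => W l ω) x (l + 1)) ∧
    Integrable (fun ω => networkSample σ (fun l => W l ω) x (l + 1)) μ := by
  obtain ⟨mX, hXY⟩ := act_measurable_indep hW hσ x hl
  have mY := measurable_flat hW hl
  simp_rw [networkSample_succ]
  refine ⟨measurable_layer.comp (mX.prodMk mY), Integrable.of_eval_piLp fun α => ?_⟩
  change Integrable (fun ω => ∑ j, W l ω α.1 j * act σ (fun l => W l ω) x l j α.2) μ
  refine integrable_finsetSum _ fun j _ => ?_
  have hi : IndepFun (fun ω => act σ (fun l => W l ω) x l j α.2) (fun ω => W l ω α.1 j) μ :=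
    IndepFun.comp (φ := fun y : Fin (n l) → Fin s → ℝ => y j α.2)
      (ψ := fun w : Fin (n (l + 1)) × Fin (n l) → ℝ => w (α.1, j)) hXY (by fun_prop) (by fun_prop)
  exact hi.symm.integrable_mul ((hW.memLp l hl α.1 j).integrable (by norm_num)) (hact j α.2)

/-- The bound for the law of the last layer, in terms of those of the previous one. -/
theorem lipClose_networkLaw (hσ : LipschitzWith K σ) (h3 : 0 ≤ c₃) {l : ℕ} (hL : l + 2 = L)
    (h : IsControlled L c₄ c₃ X₀ c μ W x) {M B C : ℝ} (hb : LayerBound σ c μ W x l M B C) :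
    Integrable id (networkLaw σ μ W x (l + 2)) ∧
      Integrable id (limitLaw σ c (networkLaw σ μ W x 1) (l + 2)) ∧
      LipClose (networkLaw σ μ W x (l + 2)) (limitLaw σ c (networkLaw σ μ W x 1) (l + 2))
        (layerConst s c₃ * (2 + M + C) * (n (l + 2) : ℝ) ^ (2 / 3 : ℝ) * rate n (l + 1)) := by
  have hl : l + 1 < L := by omega
  have hpos : ∀ l, 0 < n l := fun l => Nat.pos_of_ne_zero (NeZero.ne _)
  have mσ := hσ.continuous.measurable
  obtain ⟨mX, hXY⟩ := act_measurable_indep h.weights mσ x hl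
  have mY := measurable_flat h.weights hl
  have hw := h.weights.thirdWeights hl (h.third (l + 1) (by omega))
  have hV : (((c (l + 1) / n (l + 1)).toNNReal : ℝ≥0) : ℝ) = c (l + 1) / n (l + 1) :=
    Real.coe_toNNReal _ (div_nonneg (h.weights.pos _ hl).le (Nat.cast_nonneg _))
  obtain ⟨mN, iN⟩ := integrable_networkSample (x := x) h.weights mσ hl
    (integrable_of_fourthAvg (hpos _) mX hb.mean_integrable)
  refine ⟨integrable_id_map mN.aemeasurable iN, ?_, fun ζ hζ => ?_⟩
  · rw [limitLaw_succ_succ]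
    exact IsGaussian.integrable_id
  rw [limitLaw_succ_succ]
  set Γ := limitCov σ c (networkLaw σ μ W x 1) (l + 1)
  have mζ := hζ.continuous.measurable
  have hS := rate_pos (n := n) l
  set S := rate n (l + 1)
  have e : ∫ v, ζ v ∂(networkLaw σ μ W x (l + 2)) = ∫ ω, ζ (layer
      (fun p : Fin (n (l + 2)) × Fin (n (l + 1)) => W (l + 1) ω p.1 p.2)
      (act σ (fun l => W l ω) x (l + 1))) ∂μ := by
    rw [networkLaw, integral_map mN.aemeasurable mζ.aestronglyMeasurable]
    simp_rw [networkSample_succ]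
  rw [e]
  set D : ℝ := layerConst s c₃ * (n (l + 2) : ℝ) ^ (2 / 3 : ℝ) with hD
  have hD0 : 0 ≤ D := mul_nonneg (layerConst_pos s h3).le (by positivity)
  -- The conditional error √δ is again replaced by δ / S + S, whose mean is at most (C + 1) S.
  have iB : Integrable (fun ω => D * (S * (1 + fourthAvg (act σ (fun l => W l ω) x (l + 1))) +
      (covDist (empCov (c (l + 1) / n (l + 1)) (act σ (fun l => W l ω) x (l + 1))) Γ / S + S))) μ :=
    ((((integrable_const 1).add hb.mean_integrable).const_mul _).add
      ((hb.dist_integrable.div_const _).add (integrable_const _))).const_mul _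
  refine (abs_integral_sub_le_of_conditional hXY mX mY (h := fun p => ζ (layer p.2 p.1))
    (mζ.comp measurable_layer) ?_
    (B := fun y => D * (S * (1 + fourthAvg y) +
      (covDist (empCov (c (l + 1) / n (l + 1)) y) Γ / S + S))) ?_ iB fun y => ?_).trans ?_
  · have := (integrable_map_measure (by exact mζ.aestronglyMeasurable) mN.aemeasurable).1
      (integrable_of_lipschitz (integrable_id_map mN.aemeasurable iN) hζ)
    simpa only [Function.comp_def, networkSample_succ] using this
  · have m1 := @fourthAvg_measurable (n (l + 1)) s
    have m2 := covDist_empCov_measurable (m := n (l + 1)) (c (l + 1) / n (l + 1)) Γ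
    fun_prop
  · have hc := lipClose_layer_le (hpos (l + 1)) h3 hw y hb.posSemidef ζ hζ
    have my : Measurable (fun ω => layer
        (fun p : Fin (n (l + 2)) × Fin (n (l + 1)) => W (l + 1) ω p.1 p.2) y) :=
      measurable_layer.comp (measurable_const.prodMk mY)
    rw [integral_map my.aemeasurable mζ.aestronglyMeasurable,
      hV, Fintype.card_fin] at hc
    refine hc.trans (mul_le_mul_of_nonneg_left ?_ hD0)
    have hq := fourthAvg_nonneg y
    exact add_le_add (mul_le_mul_of_nonneg_right (width_le_rate l) (by positivity))
      (sqrt_le_div_add (covDist_nonneg _ _) hS)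
  · have i1 : Integrable (fun ω => 1 + fourthAvg (act σ (fun l => W l ω) x (l + 1))) μ :=
      (integrable_const 1).add hb.mean_integrable
    have i2 : Integrable (fun ω => covDist (empCov (c (l + 1) / n (l + 1))
        (act σ (fun l => W l ω) x (l + 1))) Γ / S + S) μ :=
      (hb.dist_integrable.div_const _).add (integrable_const _)
    rw [integral_const_mul, integral_add (i1.const_mul _) i2, integral_const_mul,
      integral_add (integrable_const _) hb.mean_integrable,
      integral_add (hb.dist_integrable.div_const _) (integrable_const _), integral_div]
    simp only [integral_const, probReal_univ, smul_eq_mul, one_mul]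
    calc _ ≤ D * (S * (1 + M) + (C * S ^ 2 / S + S)) := by
          have := hb.mean_le
          have := hb.dist_le
          gcongr
      _ = _ := by rw [hD]; field_simp; ring

theorem exists_lipClose.{u} {σ : ℝ → ℝ} {K : ℝ≥0} (hσ : LipschitzWith K σ) {L : ℕ} (hL : 1 ≤ L)
    (s : ℕ) {c₄ c₃ X₀ : ℝ} (h4 : 0 ≤ c₄) (h3 : 0 ≤ c₃) :
    ∃ C₀ : ℝ, 0 < C₀ ∧ ∀ {n : ℕ → ℕ} [∀ l, NeZero (n l)] {c : ℕ → ℝ} {Ω : Type u}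
      [MeasurableSpace Ω] {μ : Measure Ω} [IsProbabilityMeasure μ]
      {W : ∀ l, Ω → Matrix (Fin (n (l + 1))) (Fin (n l)) ℝ} {x : Fin s → Fin (n 0) → ℝ},
      IsControlled L c₄ c₃ X₀ c μ W x →
      Integrable id (networkLaw σ μ W x L) ∧
      Integrable id (limitLaw σ c (networkLaw σ μ W x 1) L) ∧
      LipClose (networkLaw σ μ W x L) (limitLaw σ c (networkLaw σ μ W x 1) L)
        (C₀ * (n L : ℝ) ^ (2 / 3 : ℝ) * rate n (L - 1)) := by
  obtain rfl | ⟨l, rfl⟩ : L = 1 ∨ ∃ l, L = l + 2 := by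
    rcases L with _ | _ | l
    · omega
    · exact Or.inl rfl
    · exact Or.inr ⟨l, rfl⟩
  -- Without hidden layers F and G have the same law and the rate is an empty sum.
  · refine ⟨1, one_pos, fun {n} _ {c Ω} _ {μ} _ {W x} h => ?_⟩
    obtain ⟨mN, iN⟩ := integrable_networkSample (x := x) h.weights hσ.continuous.measurable
      zero_lt_one (fun k a => integrable_const (x a k))
    have hi := integrable_id_map mN.aemeasurable iN
    refine ⟨hi, hi, ?_⟩
    change LipClose (networkLaw σ μ W x 1) (networkLaw σ μ W x 1) _
    simpa [rate] using LipClose.refl (networkLaw σ μ W x 1)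
  · obtain ⟨M, B, C, hb⟩ := exists_layerBound.{u} hσ (l + 2) s (X₀ := X₀) h4 h3 l
    have hlc := layerConst_pos s h3
    -- `M` and `C` come without a sign, and absolute values keep the constant positive.
    refine ⟨layerConst s c₃ * (2 + |M| + |C|), by positivity, fun {n} _ {c Ω} _ {μ} _ {W x} h => ?_⟩
    obtain ⟨i1, i2, hl⟩ := lipClose_networkLaw hσ h3 rfl h (hb h le_rfl)
    refine ⟨i1, i2, hl.mono ?_⟩
    have := rate_nonneg n (l + 1)
    rw [show l + 2 - 1 = l + 1 by omega]
    gcongr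
    · exact le_abs_self M
    · exact le_abs_self C

end Core

/-! ### From the stated hypotheses to uniform bounds, and from `rate` to the stated rates. -/

section Conclusion

theorem LipClose.wassersteinOne_le {E : Type*} [PseudoEMetricSpace E] [MeasurableSpace E]
    {μ ν : Measure E} {B : ℝ} (h : LipClose μ ν B) : wassersteinOne μ ν ≤ ENNReal.ofReal B :=
  iSup₂_le fun ζ hζ => ENNReal.ofReal_le_ofReal (h ζ hζ)

variable {Ω : Type*} [MeasurableSpace Ω] {μ : Measure Ω} [IsProbabilityMeasure μ]

/-- With z = n x² this is z² ≤ 1 + z^p, valid for z ≥ 0 because p > 2. -/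
theorem HasMomentLE.fourth {X : Ω → ℝ} (mX : Measurable X) {p C : ℝ} (hp : 2 < p) {n : ℕ}
    (hn : 0 < n) (h : HasMomentLE μ X (2 * p) (C / (n : ℝ) ^ p)) :
    Integrable (fun ω => X ω ^ 4) μ ∧ ∫ ω, X ω ^ 4 ∂μ ≤ (1 + C) / (n : ℝ) ^ 2 := by
  have hn' : (0 : ℝ) < n := by positivity
  have hb : ∀ x : ℝ, x ^ 4 ≤ (1 + |x| ^ (2 * p) * (n : ℝ) ^ p) / (n : ℝ) ^ 2 := fun x => by
    rw [le_div_iff₀ (by positivity)]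
    have e : |x| ^ (2 * p) * (n : ℝ) ^ p = (x ^ 2 * n) ^ p := by
      rw [Real.mul_rpow (sq_nonneg _) hn'.le, Real.rpow_mul (abs_nonneg x)]
      norm_num
    rw [e, show x ^ 4 * (n : ℝ) ^ 2 = (x ^ 2 * n) ^ 2 by ring]
    have h0 : 0 ≤ x ^ 2 * n := by positivity
    rcases le_total (x ^ 2 * n) 1 with h1 | h1
    · have : (0 : ℝ) ≤ (x ^ 2 * n) ^ p := by positivity
      have := pow_le_one₀ h0 h1 (n := 2)
      linarith
    · have := Real.rpow_le_rpow_of_exponent_le h1 hp.le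
      rw [Real.rpow_two] at this
      linarith
  have iB : Integrable (fun ω => (1 + |X ω| ^ (2 * p) * (n : ℝ) ^ p) / (n : ℝ) ^ 2) μ :=
    ((integrable_const 1).add (h.1.mul_const _)).div_const _
  have hi : Integrable (fun ω => X ω ^ 4) μ := by
    refine Integrable.mono' iB (by fun_prop) (Filter.Eventually.of_forall fun ω => ?_)
    rw [Real.norm_eq_abs, abs_of_nonneg (by positivity)]
    exact hb _
  refine ⟨hi, (integral_mono hi iB fun ω => hb _).trans ?_⟩
  rw [integral_div, integral_add (integrable_const _) (h.1.mul_const _), integral_mul_const]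
  have := (le_div_iff₀ (by positivity)).1 h.2
  simp only [integral_const, probReal_univ, smul_eq_mul, one_mul]
  gcongr

theorem HasMomentLE.third {X : Ω → ℝ} {B : ℝ} (h : HasMomentLE μ X 3 B) :
    Integrable (fun ω => |X ω| ^ 3) μ ∧ ∫ ω, |X ω| ^ 3 ∂μ ≤ B := by
  simpa only [HasMomentLE, Real.rpow_ofNat] using h

/-- Absolute values and the maximum with 0 give nonnegative constants that do not depend on the
layer. The input bound is computed from χ, so it does not depend on the network. -/
theorem isControlled_of_moments {L : ℕ} {n : ℕ → ℕ} [∀ l, NeZero (n l)] {c : ℕ → ℝ}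
    {W : ∀ l, Ω → Matrix (Fin (n (l + 1))) (Fin (n l)) ℝ} (hW : IsRandomWeights L c μ W)
    {p : ℝ} (hp : 2 < p) {C : ℕ → ℝ}
    (h2p : ∀ l, l + 2 ≤ L → ∀ i j,
      HasMomentLE μ (fun ω => W l ω i j) (2 * p) (C l / (n l : ℝ) ^ p)) {c₃ : ℝ}
    (h3 : ∀ i j, HasMomentLE μ (fun ω => W (L - 1) ω i j) 3
      (c₃ * (n (L - 1) : ℝ) ^ (-(3 / 2) : ℝ)))
    {n₀ s : ℕ} (χ : Fin s → Fin n₀ → ℝ) (h₀ : n 0 = n₀) :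
    IsControlled L (1 + ∑ l ∈ Finset.range L, |C l|) (max c₃ 0) (fourthAvg fun k a => χ a k) c μ W
      (fun a j => χ a (Fin.cast h₀ j)) := by
  refine ⟨hW, fun l hl i j => ?_, fun l hl i j => ?_, ?_⟩
  · obtain ⟨i4, b4⟩ := (h2p l hl i j).fourth (hW.measurable l (by omega) i j) hp
      (Nat.pos_of_ne_zero (NeZero.ne _))
    refine ⟨i4, b4.trans ?_⟩
    gcongr
    exact (le_abs_self _).trans (Finset.single_le_sum (f := fun l => |C l|)
      (fun _ _ => abs_nonneg _) (Finset.mem_range.2 (by omega)))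
  · subst hl
    obtain ⟨i3, b3⟩ := (h3 i j).third
    refine ⟨i3, b3.trans ?_⟩
    rw [Nat.add_sub_cancel]
    gcongr
    exact le_max_left _ _
  · subst h₀
    exact le_rfl

/-- For widths at least 1 a smaller exponent gives a weaker bound, and (p - 2) / (3 (2p - 1))
increases to 1/6 as p tends to infinity. -/
theorem rate_le_sum {n : ℕ → ℕ} [∀ l, NeZero (n l)] (L : ℕ) {p : ℝ} (hp : 2 < p) :
    rate n (L - 1) ≤ ∑ m ∈ Finset.Icc 1 (L - 1),
      (n m : ℝ) ^ (-(1 / 6 : ℝ) * ((p - 2) / (3 * (2 * p - 1))) ^ (L - m - 1)) := by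
  refine Finset.sum_le_sum fun m hm => ?_
  rw [Finset.mem_Icc] at hm
  refine Real.rpow_le_rpow_of_exponent_le (one_le_width m) ?_
  rw [show L - 1 + 1 - m = L - m - 1 + 1 by omega, pow_succ]
  have h0 : 0 ≤ (p - 2) / (3 * (2 * p - 1)) := div_nonneg (by linarith) (by linarith)
  have h1 : (p - 2) / (3 * (2 * p - 1)) ≤ 1 / 6 := by
    rw [div_le_div_iff₀ (by linarith) (by norm_num)]
    linarith
  have := pow_le_pow_left₀ h0 h1 (L - m - 1)
  linarith

/-- The smallest exponent, (1/6)^(L-1), belongs to m = 1 and dominates since N ≥ 1. As all exponents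
lie in (0, 1], the powers of κ⁻¹ are at most `max 1 κ⁻¹`. -/
theorem rate_le_of_width {n : ℕ → ℕ} {L N : ℕ} (hN : 0 < N) {κ ε : ℝ} (hκ : 0 < κ)
    (hε : 0 ≤ ε) (h : ∀ m ∈ Finset.Icc 1 (L - 1), κ * N ≤ (n m : ℝ)) :
    rate n (L - 1) ≤ L * max 1 κ⁻¹ * (N : ℝ) ^ (ε - (1 / 6 : ℝ) ^ (L - 1)) := by
  have hN' : (1 : ℝ) ≤ N := by exact_mod_cast hN
  calc rate n (L - 1) ≤ ∑ m ∈ Finset.Icc 1 (L - 1),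
        max 1 κ⁻¹ * (N : ℝ) ^ (ε - (1 / 6 : ℝ) ^ (L - 1)) := by
        refine Finset.sum_le_sum fun m hm => ?_
        have hn := h m hm
        rw [Finset.mem_Icc] at hm
        set e : ℝ := (1 / 6 : ℝ) ^ (L - 1 + 1 - m) with he
        have e0 : 0 < e := by positivity
        have e1 : e ≤ 1 := pow_le_one₀ (by norm_num) (by norm_num)
        have e2 : (1 / 6 : ℝ) ^ (L - 1) ≤ e :=
          pow_le_pow_of_le_one (by norm_num) (by norm_num) (by omega)
        calc (n m : ℝ) ^ (-e) ≤ (κ * N) ^ (-e) :=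
              Real.rpow_le_rpow_of_nonpos (by positivity) hn (by linarith)
          _ = κ⁻¹ ^ e * (N : ℝ) ^ (-e) := by
              rw [Real.mul_rpow hκ.le (by positivity), Real.rpow_neg hκ.le, Real.inv_rpow hκ.le]
          _ ≤ max 1 κ⁻¹ * (N : ℝ) ^ (ε - (1 / 6 : ℝ) ^ (L - 1)) := by
              gcongr
              · calc κ⁻¹ ^ e ≤ (max 1 κ⁻¹) ^ e :=
                      Real.rpow_le_rpow (by positivity) (le_max_right _ _) e0.le
                  _ ≤ (max 1 κ⁻¹) ^ (1 : ℝ) :=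
                      Real.rpow_le_rpow_of_exponent_le (le_max_left _ _) e1
                  _ = _ := Real.rpow_one _
              · linarith
    _ = ((L - 1 : ℕ) : ℝ) * (max 1 κ⁻¹ * (N : ℝ) ^ (ε - (1 / 6 : ℝ) ^ (L - 1))) := by simp
    _ ≤ (L : ℝ) * (max 1 κ⁻¹ * (N : ℝ) ^ (ε - (1 / 6 : ℝ) ^ (L - 1))) := by
        gcongr
        omega
    _ = _ := by ring

theorem rpow_two_thirds {x : ℝ} (hx : 0 ≤ x) :
    x ^ (2 / 3 : ℝ) = x ^ (1 / 3 : ℝ) * x ^ (1 / 3 : ℝ) := by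
  rw [← sq, ← Real.rpow_natCast, ← Real.rpow_mul hx]
  norm_num

end Conclusion

end DeepNet

theorem theorem1 (L : ℕ) (hL : 1 ≤ L) (σ : ℝ → ℝ) (hσ : ∃ K, LipschitzWith K σ)
    (n₀ s : ℕ) (χ : Fin s → Fin n₀ → ℝ) (c₃ : ℝ) :
    -- the bound for a fixed moment exponent `p`
    (∀ (p : ℝ) (_ : 2 < p) (c₂ₚ : ℕ → ℝ) (_ : ∀ l, l + 2 ≤ L → 1 ≤ c₂ₚ l),
      ∃ C₀ : ℝ, 0 < C₀ ∧ ∀ nL : ℕ, 0 < nL →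
      ∃ C : ℝ, 0 < C ∧ C ≤ C₀ * (nL : ℝ) ^ (1 / 3 : ℝ) ∧
        ∀ (n : ℕ → ℕ) [∀ l, NeZero (n l)] (h₀ : n 0 = n₀) (_ : n L = nL) (c : ℕ → ℝ)
          {Ω : Type*} [MeasurableSpace Ω] (μ : Measure Ω) [IsProbabilityMeasure μ]
          (W : ∀ l, Ω → Matrix (Fin (n (l + 1))) (Fin (n l)) ℝ)
          (_ : DeepNet.IsRandomWeights L c μ W)
          (_ : ∀ l, l + 2 ≤ L → ∀ i j,
            DeepNet.HasMomentLE μ (fun ω => W l ω i j) (2 * p) (c₂ₚ l / (n l : ℝ) ^ p))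
          (_ : ∀ i j, DeepNet.HasMomentLE μ (fun ω => W (L - 1) ω i j) 3
            (c₃ * (n (L - 1) : ℝ) ^ (-(3 / 2) : ℝ))),
          let x : Fin s → Fin (n 0) → ℝ := fun a j => χ a (Fin.cast h₀ j)
          let lawF := DeepNet.networkLaw σ μ W x L
          let lawG := DeepNet.limitLaw σ c (DeepNet.networkLaw σ μ W x 1) L
          Integrable id lawF ∧ Integrable id lawG ∧
          DeepNet.wassersteinOne lawF lawG ≤ ENNReal.ofReal
            (C * (nL : ℝ) ^ (1 / 3 : ℝ) * ∑ m ∈ Finset.Icc 1 (L - 1),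
              (n m : ℝ) ^ (-(1 / 6 : ℝ) * ((p - 2) / (3 * (2 * p - 1))) ^ (L - m - 1)))) ∧
    -- the rate in a common scale `N` of the hidden widths, when all moments are controlled
    (∀ (c₂ₚ : ℕ → ℝ → ℝ) (_ : ∀ l, l + 2 ≤ L → ∀ p, 2 < p → 1 ≤ c₂ₚ l p)
      (κ κ' : ℝ) (_ : 0 < κ) (_ : κ ≤ κ') (ε : ℝ) (_ : 0 < ε),
      ∃ C₀ : ℝ, 0 < C₀ ∧ ∀ nL : ℕ, 0 < nL →
      ∃ C : ℝ, 0 < C ∧ C ≤ C₀ * (nL : ℝ) ^ (1 / 3 : ℝ) ∧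
        ∀ (n : ℕ → ℕ) [∀ l, NeZero (n l)] (h₀ : n 0 = n₀) (_ : n L = nL)
          (N : ℕ) (_ : 0 < N)
          (_ : ∀ m ∈ Finset.Icc 1 (L - 1), κ * N ≤ (n m : ℝ) ∧ (n m : ℝ) ≤ κ' * N)
          (c : ℕ → ℝ)
          {Ω : Type*} [MeasurableSpace Ω] (μ : Measure Ω) [IsProbabilityMeasure μ]
          (W : ∀ l, Ω → Matrix (Fin (n (l + 1))) (Fin (n l)) ℝ)
          (_ : DeepNet.IsRandomWeights L c μ W)
          (_ : ∀ l, l + 2 ≤ L → ∀ p : ℝ, 2 < p → ∀ i j,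
            DeepNet.HasMomentLE μ (fun ω => W l ω i j) (2 * p) (c₂ₚ l p / (n l : ℝ) ^ p))
          (_ : ∀ i j, DeepNet.HasMomentLE μ (fun ω => W (L - 1) ω i j) 3
            (c₃ * (n (L - 1) : ℝ) ^ (-(3 / 2) : ℝ))),
          let x : Fin s → Fin (n 0) → ℝ := fun a j => χ a (Fin.cast h₀ j)
          let lawF := DeepNet.networkLaw σ μ W x L
          let lawG := DeepNet.limitLaw σ c (DeepNet.networkLaw σ μ W x 1) L
          DeepNet.wassersteinOne lawF lawG ≤ ENNReal.ofReal
            (C * (nL : ℝ) ^ (1 / 3 : ℝ) * (N : ℝ) ^ (ε - (1 / 6 : ℝ) ^ (L - 1)))) := by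
  obtain ⟨K, hσ⟩ := hσ
  refine ⟨fun p hp C _ => ?_, fun C _ κ κ' hκ _ ε hε => ?_⟩
  · obtain ⟨C₀, hC₀, h⟩ := DeepNet.exists_lipClose hσ hL s
      (c₄ := 1 + ∑ l ∈ Finset.range L, |C l|) (c₃ := max c₃ 0)
      (X₀ := DeepNet.fourthAvg fun k a => χ a k) (by positivity) (le_max_right _ _)
    -- The total power 2/3 of the output dimension is split evenly between the constant and the
    -- displayed factor.
    refine ⟨C₀, hC₀, fun nL hnL => ⟨C₀ * (nL : ℝ) ^ (1 / 3 : ℝ), by positivity, le_rfl, ?_⟩⟩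
    intro n _ h₀ hn c Ω _ μ _ W hW h2p h3
    obtain ⟨i1, i2, hl⟩ := h (DeepNet.isControlled_of_moments hW hp h2p h3 χ h₀)
    refine ⟨i1, i2, (hl.mono ?_).wassersteinOne_le⟩
    rw [hn, DeepNet.rpow_two_thirds (Nat.cast_nonneg _)]
    refine (mul_le_mul_of_nonneg_left (DeepNet.rate_le_sum (n := n) L hp) (by positivity)).trans_eq ?_
    ring
  · obtain ⟨C₀, hC₀, h⟩ := DeepNet.exists_lipClose hσ hL s
      (c₄ := 1 + ∑ l ∈ Finset.range L, |C l 3|) (c₃ := max c₃ 0)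
      (X₀ := DeepNet.fourthAvg fun k a => χ a k) (by positivity) (le_max_right _ _)
    have hL' : (0 : ℝ) < L := by exact_mod_cast hL
    have hm : 0 < max 1 κ⁻¹ := lt_max_of_lt_left one_pos
    refine ⟨C₀ * (L * max 1 κ⁻¹), by positivity, fun nL hnL =>
      ⟨C₀ * (L * max 1 κ⁻¹) * (nL : ℝ) ^ (1 / 3 : ℝ), by positivity, le_rfl, ?_⟩⟩
    intro n _ h₀ hn N hN hw c Ω _ μ _ W hW h2p h3
    -- Fourth moments suffice, so a single exponent above 2 is enough; p = 3 is a convenient choice.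
    obtain ⟨-, -, hl⟩ := h (DeepNet.isControlled_of_moments hW (p := 3) (by norm_num)
      (C := fun l => C l 3) (fun l hl => h2p l hl 3 (by norm_num)) h3 χ h₀)
    refine (hl.mono ?_).wassersteinOne_le
    rw [hn, DeepNet.rpow_two_thirds (Nat.cast_nonneg _)]
    refine (mul_le_mul_of_nonneg_left
      (DeepNet.rate_le_of_width hN hκ hε.le fun m hm => (hw m hm).1) (by positivity)).trans_eq ?_
    ring
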